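/- Let $n$ be a positive integer and let $K$ be an oriented virtual knot diagram in the plane (a generic immersed circle whose finitely many transverse double points are marked as classical over/under crossings or as virtual crossings) which misses the origin and is invariant under rotation by $2\pi/n$ about the origin ($K$ is $n$-periodic). Let $K_*$ be its quotient, obtained by closing up one fundamental sector of angle $2\pi/n$. For a virtual knot diagram $D$ let $G_D$ be the knot group, presented by one generator for each long arc (from one classical under-crossing to the next; a single generator if there are no classical crossings) and one Wirtinger relation $x_{i+1}=x_k^{-\varepsilon_i}x_ix_k^{\varepsilon_i}$ for each classical crossing. Let $A_D=G_D'/G_D''$ be its Alexander module over $\mathbb Z[t^{\pm1}]$, where $t$ acts as conjugation by a meridian, and let $J_D$ be the Jacobian matrix of Fox derivatives of the Wirtinger relators evaluated at $x_i=t$. For a finitely presented module $M$, $\mathcal E_\ell(M)$ is the $\ell$-th elementary ideal, generated by the $(c-\ell)\times(c-\ell)$ minors of any presentation matrix of $M$ with $c$ columns, and $\mathcal E_\ell(J)$ is defined in the same way for a matrix $J$; a generator of the smallest principal ideal containing $\mathcal E_\ell(M)$ (resp. $\mathcal E_\ell(J)$), which is unique up to units, is denoted $\Delta^\ell(M)$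 (resp. $\Delta^\ell(J)$). 1. For all $\ell\ge 0$: $\mathcal E_\ell(A_K)\subset\mathcal E_\ell(A_{K_*})$, and consequently $\Delta^\ell(A_{K_*})$ divides $\Delta^\ell(A_K)$ in $\mathbb Z[t^{\pm1}]$. Likewise $\mathcal E_\ell(J_K)\subset\mathcal E_\ell(J_{K_*})$, and $\Delta^\ell(J_{K_*})$ divides $\Delta^\ell(J_K)$. 2. Suppose that $n=p^r$ with $p$ prime. For all $\ell\ge0$: $\mathcal E_\ell(\mathbb F_p\otimes A_K)\subset\mathcal E_\ell(\mathbb F_p\otimes A_{K_*})^{p^r}$, and consequently $\Delta^\ell(\mathbb F_p\otimes A_{K_*})^{p^r}$ divides $\Delta^\ell(\mathbb F_p\otimes A_K)$ in $\mathbb F_p[t^{\pm1}]$. Likewise, with $J_D \bmod p$ the reduction of $J_D$ to $\mathbb F_p[t^{\pm 1}]$, $\mathcal E_\ell(J_K \bmod p)\subset\mathcal E_\ell(J_{K_*}\bmod p)^{p^r}$, and $\Delta^\ell(J_{K_*}\bmod p)^{p^r}$ divides $\Delta^\ell(J_K\bmod p)$. Moreover, for the integral Alexander polynomials $\Delta_D=\Delta^1(J_D)\in\mathbb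 Z[t^{\pm1}]$, the reduction of $(\Delta_{K_*})^{p^r}$ modulo $p$ divides the reduction of $\Delta_K$ modulo $p$. -/

import Mathlib

open scoped LaurentPolynomial TensorProduct ContDiff

noncomputable section

namespace PeriodicVirtualKnot

/-! ### Elementary ideals and elementary divisors -/

section Algebra

/-- The `ℓ`-th elementary ideal of a matrix with `n` columns: the ideal generated by its
`(n - ℓ) × (n - ℓ)` minors. Truncated subtraction gives the whole ring for `n ≤ ℓ` (the empty
determinant is `1`). Repeated row or column indices contribute the determinant `0`, so the ideal
is zero if `n - ℓ` exceeds the number of rows. -/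
def matrixElementaryIdeal {R : Type*} [CommRing R] {m n : Type*} [Fintype n]
    (A : Matrix m n R) (ℓ : ℕ) : Ideal R :=
  Ideal.span {d : R | ∃ (f : Fin (Fintype.card n - ℓ) → m) (g : Fin (Fintype.card n - ℓ) → n),
    d = (A.submatrix f g).det}

/-- `A` is a presentation matrix of `M`: the columns are generators and the rows are a generating
set of the relations between them. -/
def IsPresentationMatrix {R : Type*} [CommRing R] {m n : Type*} [Fintype n]
    (A : Matrix m n R) (M : Type*) [AddCommGroup M] [Module R M] : Prop :=
  ∃ π : (n → R) →ₗ[R] M, Function.Surjective π ∧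
    LinearMap.ker π = Submodule.span R (Set.range fun i => A i)

/-- The `ℓ`-th elementary ideal of a finitely presented module: the elementary ideal of any
presentation matrix (these all coincide, so the supremum below is their common value). -/
def elementaryIdeal (R : Type*) [CommRing R] (M : Type*) [AddCommGroup M] [Module R M]
    (ℓ : ℕ) : Ideal R :=
  sSup {I : Ideal R | ∃ (m n : ℕ) (A : Matrix (Fin m) (Fin n) R),
    IsPresentationMatrix A M ∧ I = matrixElementaryIdeal A ℓ}

/-- `d` is a greatest common divisor of the elements of `I`, that is, `d` generates the smallest
principal ideal containing `I`. -/
def IsIdealGcd {R : Type*} [CommRing R] (I : Ideal R) (d : R) : Prop :=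
  I ≤ Ideal.span {d} ∧ ∀ c : R, I ≤ Ideal.span {c} → Ideal.span {d} ≤ Ideal.span {c}

open Classical in
/-- The greatest common divisor of an ideal, well defined up to units. -/
def idealGcd {R : Type*} [CommRing R] (I : Ideal R) : R :=
  if h : ∃ d, IsIdealGcd I d then h.choose else 0

/-- Over a Noetherian unique factorization domain every ideal has a greatest common divisor. -/
theorem exists_isIdealGcd {R : Type*} [CommRing R] [IsDomain R] [IsNoetherianRing R]
    [UniqueFactorizationMonoid R] (I : Ideal R) : ∃ d, IsIdealGcd I d := by
  classical
  obtain ⟨_⟩ : Nonempty (NormalizedGCDMonoid R) := inferInstance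
  obtain ⟨s, rfl⟩ := IsNoetherian.noetherian I
  refine ⟨s.gcd id, ?_, fun c hc => ?_⟩
  · refine Submodule.span_le.2 fun x hx => ?_
    exact Ideal.mem_span_singleton.2 (Finset.gcd_dvd (f := id) hx)
  · rw [Ideal.span_singleton_le_span_singleton]
    exact Finset.dvd_gcd fun x hx =>
      Ideal.mem_span_singleton.1 (hc (Submodule.subset_span hx))

theorem isIdealGcd_idealGcd {R : Type*} [CommRing R] [IsDomain R] [IsNoetherianRing R]
    [UniqueFactorizationMonoid R] (I : Ideal R) : IsIdealGcd I (idealGcd I) := by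
  have h := exists_isIdealGcd I
  rw [idealGcd, dif_pos h]
  exact h.choose_spec

/-- Laurent polynomial rings over Noetherian unique factorization domains are again Noetherian
unique factorization domains, so the previous lemma applies to `ℤ[t^±1]` and `𝔽_p[t^±1]`. -/
instance laurentUFM (k : Type*) [CommRing k] [IsDomain k] [UniqueFactorizationMonoid k] :
    UniqueFactorizationMonoid k[T;T⁻¹] :=
  UniqueFactorizationMonoid.of_isLocalization (Submonoid.powers (Polynomial.X : Polynomial k))
    k[T;T⁻¹]

instance laurentNoetherian (k : Type*) [CommRing k] [IsNoetherianRing k] :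
    IsNoetherianRing k[T;T⁻¹] :=
  IsLocalization.isNoetherianRing (Submonoid.powers (Polynomial.X : Polynomial k)) k[T;T⁻¹]
    inferInstance

/-- Coefficientwise reduction `ℤ[t^±1] → 𝔽_p[t^±1]`. -/
def reduceMod (p : ℕ) : ℤ[T;T⁻¹] →+* (ZMod p)[T;T⁻¹] :=
  AddMonoidAlgebra.mapRingHom ℤ (Int.castRingHom (ZMod p))

instance reduceModAlgebra (p : ℕ) : Algebra ℤ[T;T⁻¹] (ZMod p)[T;T⁻¹] :=
  (reduceMod p).toAlgebra

/-- `𝔽_p ⊗ M` as a module over `𝔽_p ⊗ ℤ[t^±1] = 𝔽_p[t^±1]`. -/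
abbrev ModP (p : ℕ) (M : Type*) [AddCommGroup M] [Module ℤ[T;T⁻¹] M] : Type _ :=
  (ZMod p)[T;T⁻¹] ⊗[ℤ[T;T⁻¹]] M

end Algebra

/-! ### The module `G' / G''` -/

section Metabelian

/-- `G' / G''`, written additively; `t` will act as conjugation `c ↦ x c x⁻¹`. The element `x` is
recorded because it selects the action of `t`, which depends only on the class of `x` in
`G / G'`. -/
def CommutatorModule (G : Type*) [Group G] (_x : G) : Type _ :=
  Additive (Abelianization (commutator G))

instance (G : Type*) [Group G] (x : G) : AddCommGroup (CommutatorModule G x) :=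
  inferInstanceAs (AddCommGroup (Additive (Abelianization (commutator G))))

/-- Conjugation by `x` on `G' / G''`. -/
def conjEquiv (G : Type*) [Group G] (x : G) : CommutatorModule G x ≃+ CommutatorModule G x :=
  MulEquiv.toAdditive (MulAut.conjNormal (H := commutator G) x).abelianizationCongr

/-- The action of the powers of `t` on `G' / G''`. -/
def tAction (G : Type*) [Group G] (x : G) :
    Multiplicative ℤ →* Module.End ℤ (CommutatorModule G x) :=
  (Units.coeHom _).comp
    (zpowersHom _ (LinearMap.GeneralLinearGroup.ofLinearEquiv (conjEquiv G x).toIntLinearEquiv))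

instance (G : Type*) [Group G] (x : G) : Module ℤ[T;T⁻¹] (CommutatorModule G x) :=
  Module.compHom _ (AddMonoidAlgebra.lift ℤ (Module.End ℤ (CommutatorModule G x)) ℤ
    (tAction G x)).toRingHom

/-- The class in `G' / G''` of an element of `G'`. -/
def commutatorClass {G : Type*} [Group G] (x : G) (c : commutator G) : CommutatorModule G x :=
  Additive.ofMul (Abelianization.of c)

theorem T_one_smul_commutatorClass {G : Type*} [Group G] (x : G) (c : commutator G) :
    (LaurentPolynomial.T 1 : ℤ[T;T⁻¹]) • commutatorClass x c =
      commutatorClass x (MulAut.conjNormal (H := commutator G) x c) := by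
  change (AddMonoidAlgebra.lift ℤ (Module.End ℤ (CommutatorModule G x)) ℤ
    (tAction G x)) (LaurentPolynomial.T 1) (commutatorClass x c) = _
  rw [LaurentPolynomial.T, AddMonoidAlgebra.lift_single, one_smul]
  simp only [tAction, MonoidHom.comp_apply, zpowersHom_apply, toAdd_ofAdd, zpow_one]
  rfl

end Metabelian

/-! ### Virtual knot diagrams -/

/-- An oriented virtual knot diagram: a smooth immersion of the circle `ℝ / ℤ` in the plane whose
only multiple points are finitely many transverse double points, together with the set `overSet` of
parameters at which the curve is the over-crossing strand of a classical crossing. A double point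
neither of whose parameters lies in `overSet` is a virtual crossing. -/
structure VirtualKnotDiagram where
  curve : UnitAddCircle → ℂ
  smooth : ContDiff ℝ ∞ fun x : ℝ => curve (x : UnitAddCircle)
  immersion : ∀ x : ℝ, deriv (fun y : ℝ => curve (y : UnitAddCircle)) x ≠ 0
  finite_double : {s | ∃ s', s' ≠ s ∧ curve s' = curve s}.Finite
  no_triple : ∀ a b c, curve a = curve b → curve b = curve c → a = b ∨ b = c ∨ a = c
  transverse : ∀ x y : ℝ, (x : UnitAddCircle) ≠ y →
    curve (x : UnitAddCircle) = curve (y : UnitAddCircle) →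
    (starRingEnd ℂ (deriv (fun z : ℝ => curve (z : UnitAddCircle)) x) *
      deriv (fun z : ℝ => curve (z : UnitAddCircle)) y).im ≠ 0
  overSet : Set UnitAddCircle
  over_double : ∀ s ∈ overSet, ∃ s', s' ≠ s ∧ curve s' = curve s ∧ s' ∉ overSet

namespace VirtualKnotDiagram

variable (K : VirtualKnotDiagram)

/-- The tangent vector of the curve. -/
def velocity (s : UnitAddCircle) : ℂ :=
  deriv (fun x : ℝ => K.curve (s + (x : UnitAddCircle))) 0

/-- The parameters at which the curve is the under-crossing strand of a classical crossing. -/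
def underPoints : Set UnitAddCircle :=
  {u | ∃ o ∈ K.overSet, o ≠ u ∧ K.curve o = K.curve u}

theorem underPoints_finite : K.underPoints.Finite :=
  K.finite_double.subset fun _ ⟨o, _, hne, h⟩ => ⟨o, hne, h⟩

/-- The classical crossings, each given by the parameter of its under-crossing strand. -/
def Crossing : Type := {u // u ∈ K.underPoints}

/-- The parameter of the over-crossing strand of a classical crossing. -/
def overPoint (c : K.Crossing) : UnitAddCircle := c.2.choose

/-- The sign of a classical crossing: it is `1` (a right-handed crossing) if the tangent vectors
of the over-strand and of the under-strand, in this order, form a positive basis of the plane. -/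
def sign (c : K.Crossing) : ℤ :=
  if 0 < (starRingEnd ℂ (K.velocity (K.overPoint c)) * K.velocity c.1).im then 1 else -1

/-- The endpoints of the long arcs: the under-crossing parameters, or an arbitrary basepoint if
there is no classical crossing, in which case there is exactly one arc. -/
def arcEnds : Set UnitAddCircle :=
  K.underPoints ∪ {s | s = 0 ∧ K.underPoints = ∅}

/-- The long arcs, which run from one under-crossing to the next. Each arc is given by its
terminal point. -/
def Arc : Type := {s // s ∈ K.arcEnds}

instance : Finite K.Arc :=
  (K.underPoints_finite.union ((Set.finite_singleton (0 : UnitAddCircle)).subset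
    fun _ h => h.1)).to_subtype

instance : Fintype K.Arc := Fintype.ofFinite _

instance : DecidableEq K.Arc := Classical.decEq _

instance : Nonempty K.Arc := by
  by_cases h : K.underPoints = ∅
  · exact ⟨⟨0, Or.inr ⟨rfl, h⟩⟩⟩
  · obtain ⟨u, hu⟩ := Set.nonempty_iff_ne_empty.2 h
    exact ⟨⟨u, Or.inl hu⟩⟩

/-- The length, in `(0, 1]`, of the positively oriented path from `s` to `e` in `ℝ / ℤ`. -/
def forwardDist (s e : UnitAddCircle) : ℝ := (AddCircle.equivIoc (1 : ℝ) 0 (e - s) : ℝ)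

/-- The arc along which one travels when leaving the parameter `s` in the positive direction:
its terminal point is the first endpoint met strictly after `s`. -/
def arcFrom (s : UnitAddCircle) : K.Arc :=
  (Finite.exists_min fun a : K.Arc => forwardDist s a.1).choose

/-- The arc that ends at the under-crossing of `c`. -/
def arcIn (c : K.Crossing) : K.Arc := ⟨c.1, Or.inl c.2⟩

/-- The arc that starts at the under-crossing of `c`. -/
def arcOut (c : K.Crossing) : K.Arc := K.arcFrom c.1

/-- The arc that contains the over-crossing of `c`. -/
def arcOver (c : K.Crossing) : K.Arc := K.arcFrom (K.overPoint c)

/-- The Wirtinger relator `x_k^{-ε} x_i x_k^ε x_{i+1}⁻¹` of a classical crossing. -/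
def relator (c : K.Crossing) : FreeGroup K.Arc :=
  FreeGroup.of (K.arcOver c) ^ (-K.sign c) * FreeGroup.of (K.arcIn c) *
    FreeGroup.of (K.arcOver c) ^ K.sign c * (FreeGroup.of (K.arcOut c))⁻¹

/-- The knot group, by its Wirtinger presentation. -/
abbrev KnotGroup : Type := PresentedGroup (Set.range K.relator)

/-- A meridian of the knot. -/
def meridian : K.KnotGroup := PresentedGroup.of (K.arcFrom 0)

/-- The Alexander module `G' / G''` of the knot group `G`, with `t` acting by conjugation by a
meridian. -/
abbrev AlexanderModule : Type := CommutatorModule K.KnotGroup K.meridian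

/-- The Jacobian matrix: the Fox derivatives of the Wirtinger relators, evaluated at
`x_1 = ⋯ = x_n = t`. Entries are added when the arcs at a crossing coincide. -/
def jacobian : Matrix K.Crossing K.Arc ℤ[T;T⁻¹] := fun c =>
  Pi.single (K.arcIn c) (LaurentPolynomial.T (-K.sign c)) - Pi.single (K.arcOut c) 1 +
    Pi.single (K.arcOver c) (1 - LaurentPolynomial.T (-K.sign c))

/-- The Jacobian matrix reduced modulo `p`. -/
def jacobianMod (p : ℕ) : Matrix K.Crossing K.Arc (ZMod p)[T;T⁻¹] :=
  K.jacobian.map (reduceMod p)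

/-! ### Periodicity -/

/-- `f : ℝ → ℝ` is a lift of an orientation preserving smooth `d`-fold covering of the circle
`ℝ / ℤ` by itself. -/
structure IsCoveringLift (d : ℕ) (f : ℝ → ℝ) : Prop where
  smooth : ContDiff ℝ ∞ f
  deriv_pos : ∀ x, 0 < deriv f x
  degree : ∀ x, f (x + 1) = f x + d

/-- `K` is periodic with period `q`: it misses the origin, and the rotation by `2π / q` carries the
diagram to itself, that is, to a reparametrization of itself with the same classical crossings,
over- and under-strands and virtual crossings. -/
def IsPeriodic (q : ℕ) : Prop :=
  (∀ s, K.curve s ≠ 0) ∧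
  ∃ f : ℝ → ℝ, IsCoveringLift 1 f ∧
    (∀ x : ℝ, K.curve (f x : UnitAddCircle) =
      Complex.exp (2 * Real.pi * Complex.I / q) * K.curve (x : UnitAddCircle)) ∧
    ∀ x : ℝ, (f x : UnitAddCircle) ∈ K.overSet ↔ (x : UnitAddCircle) ∈ K.overSet

/-- The map `r e^{iθ} ↦ r e^{iqθ}`, which closes up a sector of angle `2π / q` by identifying its
two edges along concentric circles. -/
def closeSector (q : ℕ) (z : ℂ) : ℂ := (‖z‖ : ℂ) * (z / (‖z‖ : ℂ)) ^ q

/-- `Kq` is the quotient of the `q`-periodic diagram `K`: the closure of one fundamental sector of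
`K`, with the crossings of that sector. The diagram `K` is mapped to it `q` to one. -/
def IsQuotient (q : ℕ) (Kq : VirtualKnotDiagram) : Prop :=
  ∃ g : ℝ → ℝ, IsCoveringLift q g ∧
    (∀ x : ℝ, Kq.curve (g x : UnitAddCircle) = closeSector q (K.curve (x : UnitAddCircle))) ∧
    ∀ x : ℝ, (g x : UnitAddCircle) ∈ Kq.overSet ↔ (x : UnitAddCircle) ∈ K.overSet

end VirtualKnotDiagram

end PeriodicVirtualKnot

end

/-! The rotation acts freely on the crossings and on the arcs of $K$, and its orbits are the
crossings and arcs of $K_*$. After one lift of each has been chosen, $J_K$ is block circulant, with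
entries $a_{cx}(j-i)$ for $i,j$ modulo $n$, and $J_{K_*}$ has the entries $\sum_d a_{cx}(d)$. With
$J(X)=\sum_d a(d)X^d$ this says that $J_K=J(P)$ for the cyclic shift $P$ and that $J_{K_*}=J(1)$
(`IsCyclicCover.exists_circulant`, `blockEval_circulantPoly`).

Already over $\mathbb Z$, passing from the basis $x^i$ of $\mathbb Z[x]/(x^n-1)$ to the powers of
$y=x-1$ conjugates $P$ to a matrix $W$ whose first column is the first unit vector
(`pascalMatrix_mul_binomialShift`). Hence $J(W)$ is block triangular with diagonal blocks $J(C)$ and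
$J(1)$, where $C$ is the rest of $W$. A count of rows and columns in a Laplace expansion puts
$\mathcal E_\ell$ of a block triangular matrix in the product of the $\mathcal E_\ell$ of its
diagonal blocks (`matrixElementaryIdeal_fromBlocks_le`); this is the integral inclusion. In
characteristic $p$ with $n=p^r$ the binomial coefficients in $W$ vanish, $W$ is unitriangular, and
repeated splitting yields the $n$-th power (`matrixElementaryIdeal_blockEval_le_pow`).

The statements on modules follow from $\mathcal E_\ell(A_D)=\mathcal E_{\ell+1}(J_D)$: by Fox
calculus the Jacobian without one column presents $A_D$ (`isPresentationMatrix_jacobian`), the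
ideals do not depend on the presentation, and presentations are compatible with base change.

The last claim needs more, because a greatest common divisor does not commute with reduction modulo
$p$. As $\det J(1)=0$, one has $\det J(X)=(X-1)\eta(X)$ with $\eta(1)\in\mathcal E_1(J_{K_*})$. The
adjugate of the block triangular matrix shows that $\Delta_{K_*}\det\eta(C)$ divides all first
minors of $J_K$ over $\mathbb Z[t^{\pm1}]$. Modulo $p$ the matrix $C$ is unitriangular of size
$n-1$, so $\det\eta(C)$ reduces to $\eta(1)^{n-1}$, which is divisible by $\Delta_{K_*}^{n-1}$. -/

namespace PeriodicVirtualKnot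

/-! ### Ideals of minors and Laplace expansion -/

section Minors

variable {R : Type*} [CommRing R]

/-- The ideal generated by the `k × k` minors of a matrix. -/
def minorIdeal {m n : Type*} (A : Matrix m n R) (k : ℕ) : Ideal R :=
  Ideal.span {d : R | ∃ (f : Fin k → m) (g : Fin k → n), d = (A.submatrix f g).det}

theorem matrixElementaryIdeal_eq {m n : Type*} [Fintype n] (A : Matrix m n R) (ℓ : ℕ) :
    matrixElementaryIdeal A ℓ = minorIdeal A (Fintype.card n - ℓ) := rfl

theorem det_submatrix_mem_minorIdeal {m n ι : Type*} [Fintype ι] [DecidableEq ι]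
    (A : Matrix m n R) (f : ι → m) (g : ι → n) {k : ℕ} (hk : Fintype.card ι = k) :
    (A.submatrix f g).det ∈ minorIdeal A k := by
  let e : Fin k ≃ ι := (Fintype.equivFinOfCardEq hk).symm
  refine Ideal.subset_span ⟨f ∘ e, g ∘ e, ?_⟩
  rw [← Matrix.submatrix_submatrix, Matrix.det_submatrix_equiv_self]

theorem minorIdeal_le_iff {m n : Type*} {A : Matrix m n R} {k : ℕ} {I : Ideal R} :
    minorIdeal A k ≤ I ↔ ∀ (f : Fin k → m) (g : Fin k → n), (A.submatrix f g).det ∈ I := by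
  refine ⟨fun h f g => h (Ideal.subset_span ⟨f, g, rfl⟩), fun h => Ideal.span_le.2 ?_⟩
  rintro _ ⟨f, g, rfl⟩
  exact h f g

theorem minorIdeal_zero {m n : Type*} (A : Matrix m n R) : minorIdeal A 0 = ⊤ := by
  rw [Ideal.eq_top_iff_one]
  exact Ideal.subset_span ⟨Fin.elim0, Fin.elim0, by simp⟩

theorem minorIdeal_transpose {m n : Type*} (A : Matrix m n R) (k : ℕ) :
    minorIdeal A.transpose k = minorIdeal A k := by
  apply le_antisymm <;> rw [minorIdeal_le_iff] <;> intro f g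
  · rw [← Matrix.det_transpose]
    exact det_submatrix_mem_minorIdeal A g f (Fintype.card_fin k)
  · rw [← Matrix.det_transpose]
    exact det_submatrix_mem_minorIdeal A.transpose g f (Fintype.card_fin k)

theorem minorIdeal_submatrix_le {m n m' n' : Type*} (A : Matrix m n R) (f : m' → m) (g : n' → n)
    (k : ℕ) : minorIdeal (A.submatrix f g) k ≤ minorIdeal A k := by
  rw [minorIdeal_le_iff]
  intro f' g'
  exact det_submatrix_mem_minorIdeal A (f ∘ f') (g ∘ g') (Fintype.card_fin k)

/-- A weak form of the Laplace expansion: the value of an alternating form is a combination of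
its values at basis vectors, with minors as coefficients. -/
theorem alternatingMap_mem_of_forall_minor {ι κ : Type*} [Fintype ι] [DecidableEq ι] [Fintype κ]
    [DecidableEq κ] (F : (ι → R) [⋀^κ]→ₗ[R] R) (v : κ → ι → R) (I : Ideal R)
    (h : ∀ g : κ → ι, (Matrix.of fun i j => v i (g j)).det *
      F (fun j => Pi.single (g j) 1) ∈ I) : F v ∈ I := by
  classical
  have hv : v = fun i => ∑ a, v i a • (Pi.single a (1 : R) : ι → R) := by
    funext i
    exact (pi_eq_sum_univ' (v i)).trans (by congr)
  have key : F v = ∑ g : κ → ι, (∏ i, v i (g i)) * F (fun j => Pi.single (g j) 1) := by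
    conv_lhs => rw [hv]
    have := F.toMultilinearMap.map_sum (fun i a => v i a • (Pi.single a (1 : R) : ι → R))
    refine this.trans (Finset.sum_congr rfl fun g _ => ?_)
    exact (F.toMultilinearMap.map_smul_univ (fun i => v i (g i)) _)
  rw [key, ← Finset.sum_filter_add_sum_filter_not _ (fun g : κ → ι => Function.Injective g)]
  refine I.add_mem ?_ ?_
  -- The injective selections with a given image are the reorderings of one of them, `g0`. By
  -- alternation their terms add up to a minor times the value of `F` at `g0`.
  · rw [← Finset.sum_fiberwise_of_maps_to (g := fun g : κ → ι => Finset.univ.image g)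
      (t := Finset.univ) (fun _ _ => Finset.mem_univ _)]
    refine I.sum_mem fun s _ => ?_
    rcases (Finset.filter (fun g : κ → ι => Finset.univ.image g = s)
      (Finset.filter (fun g : κ → ι => Function.Injective g) Finset.univ)).eq_empty_or_nonempty with
      h0 | ⟨g0, hg0⟩
    · rw [h0, Finset.sum_empty]; exact I.zero_mem
    · simp only [Finset.mem_filter, Finset.mem_univ, true_and] at hg0
      obtain ⟨hinj, himg⟩ := hg0
      convert h g0 using 1
      rw [Matrix.det_apply, Finset.sum_mul]
      symm
      refine Finset.sum_bij (fun σ _ => g0 ∘ (σ⁻¹ : Equiv.Perm κ)) ?_ ?_ ?_ ?_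
      · intro σ _
        simp only [Finset.mem_filter, Finset.mem_univ, true_and]
        refine ⟨hinj.comp (σ⁻¹ : Equiv.Perm κ).injective, ?_⟩
        rw [← himg, ← Finset.image_image]
        congr 1
        exact Finset.image_univ_of_surjective (σ⁻¹ : Equiv.Perm κ).surjective
      · intro σ _ τ _ hst
        have : (σ⁻¹ : Equiv.Perm κ) = τ⁻¹ := by
          ext k
          exact hinj (congrFun hst k)
        exact inv_injective this
      · intro g hg
        simp only [Finset.mem_filter, Finset.mem_univ, true_and] at hg
        obtain ⟨hgi, hgs⟩ := hg
        have hex : ∀ k, ∃ k', g0 k' = g k := fun k => by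
          have : g k ∈ Finset.univ.image g0 := by
            rw [himg, ← hgs]; exact Finset.mem_image_of_mem _ (Finset.mem_univ _)
          simpa using this
        choose τ hτ using hex
        have hτi : Function.Injective τ := fun a b hab => hgi (by rw [← hτ, ← hτ, hab])
        refine ⟨(Equiv.ofBijective τ (Finite.injective_iff_bijective.1 hτi))⁻¹,
          Finset.mem_univ _, ?_⟩
        funext k
        simpa using hτ k
      · intro σ _
        have h1 : F (fun j => Pi.single ((g0 ∘ (σ⁻¹ : Equiv.Perm κ)) j) 1) =
            ((Equiv.Perm.sign σ : ℤ) : R) * F (fun j => Pi.single (g0 j) 1) := by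
          have := F.map_perm (fun j => (Pi.single (g0 j) 1 : ι → R)) (σ⁻¹ : Equiv.Perm κ)
          rw [Equiv.Perm.sign_inv] at this
          refine Eq.trans ?_ (this.trans ?_)
          · rfl
          · rw [Units.smul_def, zsmul_eq_mul]
        rw [h1, Units.smul_def, zsmul_eq_mul]
        have h2 : ∏ i, v i ((g0 ∘ (σ⁻¹ : Equiv.Perm κ)) i) = ∏ i, v (σ i) (g0 i) := by
          rw [← Equiv.prod_comp σ]
          simp
        rw [h2]
        simp only [Matrix.of_apply]
        ring
  · refine I.sum_mem fun g hg => ?_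
    simp only [Finset.mem_filter, Finset.mem_univ, true_and] at hg
    have : F (fun j => Pi.single (g j) 1) = 0 := by
      refine F.map_eq_zero_of_not_injective _ fun hi => hg fun a b hab => hi ?_
      simp only [hab]
    rw [this, mul_zero]
    exact I.zero_mem

/-- The determinant as an alternating function of the first rows. -/
def detInl {κ κ' : Type*} [Fintype κ] [hκ : DecidableEq κ] [Fintype κ'] [DecidableEq κ']
    (w' : κ' → (κ ⊕ κ') → R) : ((κ ⊕ κ') → R) [⋀^κ]→ₗ[R] R where
  toFun w := Matrix.det (Matrix.of (Sum.elim w w'))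
  map_update_add' {D} w i x y := by
    obtain rfl : D = hκ := Subsingleton.elim _ _
    simp only [← Sum.update_elim_inl]
    exact Matrix.detRowAlternating.map_update_add _ _ _ _
  map_update_smul' {D} w i c x := by
    obtain rfl : D = hκ := Subsingleton.elim _ _
    simp only [← Sum.update_elim_inl]
    exact Matrix.detRowAlternating.map_update_smul _ _ _ _
  map_eq_zero_of_eq' w i j hij hne :=
    Matrix.det_zero_of_row_eq (i := Sum.inl i) (j := Sum.inl j)
      (fun h => hne (Sum.inl_injective h)) hij

theorem det_sum_mem {κ κ' : Type*} [Fintype κ] [DecidableEq κ] [Fintype κ'] [DecidableEq κ']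
    (N : Matrix (κ ⊕ κ') (κ ⊕ κ') R) (I : Ideal R)
    (h : ∀ g : κ → κ ⊕ κ', (N.submatrix Sum.inl g).det *
      (Matrix.of (Sum.elim (fun j => Pi.single (g j) 1) (fun k => N (Sum.inr k)))).det ∈ I) :
    N.det ∈ I := by
  have := alternatingMap_mem_of_forall_minor (detInl fun k => N (Sum.inr k))
    (fun k => N (Sum.inl k)) I h
  convert this using 1
  change N.det = Matrix.det (Matrix.of (Sum.elim (fun k => N (Sum.inl k)) fun k => N (Sum.inr k)))
  congr 1
  ext (i | i) j <;> rfl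

/-- A determinant lies in every ideal that contains all maximal minors of some of its rows. -/
theorem det_mem_of_rows {ι : Type*} [Fintype ι] [DecidableEq ι] (N : Matrix ι ι R)
    (p : ι → Prop) [DecidablePred p] (I : Ideal R)
    (h : ∀ g : {i // p i} → ι, (N.submatrix Subtype.val g).det ∈ I) : N.det ∈ I := by
  let e : {i // p i} ⊕ {i // ¬ p i} ≃ ι := Equiv.sumCompl p
  rw [← Matrix.det_submatrix_equiv_self e]
  refine det_sum_mem _ I fun g => I.mul_mem_right _ ?_
  exact h (e ∘ g)

/-- A determinant lies in every ideal that contains all maximal minors of some of its columns. -/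
theorem det_mem_of_columns {ι : Type*} [Fintype ι] [DecidableEq ι] (N : Matrix ι ι R)
    (p : ι → Prop) [DecidablePred p] (I : Ideal R)
    (h : ∀ g : {i // p i} → ι, (N.submatrix g Subtype.val).det ∈ I) : N.det ∈ I := by
  rw [← Matrix.det_transpose]
  refine det_mem_of_rows _ p I fun g => ?_
  rw [← Matrix.det_transpose]
  exact h g

theorem minorIdeal_antitone {m n : Type*} (A : Matrix m n R) {k k' : ℕ} (h : k ≤ k') :
    minorIdeal A k' ≤ minorIdeal A k := by
  rw [minorIdeal_le_iff]
  intro f g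
  refine det_mem_of_rows _ (fun i : Fin k' => (i : ℕ) < k) _ fun g' => ?_
  rw [Matrix.submatrix_submatrix]
  refine det_submatrix_mem_minorIdeal A _ _ ?_
  rw [Fintype.card_subtype]
  have := Fin.card_filter_val_lt (n := k') (m := k)
  simp [this, h]

/-- The determinant of a matrix with a block of zeros lies in the product of the ideals of the
maximal minors of the two strips determined by the block. -/
theorem det_mem_mul_of_block {κ κ' : Type*} [Fintype κ] [DecidableEq κ] [Fintype κ']
    [DecidableEq κ'] (N : Matrix (κ ⊕ κ') (κ ⊕ κ') R) (Q : κ ⊕ κ' → Prop) [DecidablePred Q]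
    (I I' : Ideal R) (h0 : ∀ i j, ¬ Q j → N (Sum.inl i) j = 0)
    (h1 : ∀ g : κ → κ ⊕ κ', (∀ k, Q (g k)) → (N.submatrix Sum.inl g).det ∈ I)
    (h2 : ∀ r : {j // ¬ Q j} → κ',
      (N.submatrix (fun a => Sum.inr (r a)) (Subtype.val : {j // ¬ Q j} → _)).det ∈ I') :
    N.det ∈ I * I' := by
  refine det_sum_mem N _ fun g => ?_
  -- A selection that leaves `Q` meets the zero block and contributes nothing. Otherwise the unit
  -- vectors in the upper rows vanish on all columns outside `Q`, so a nonzero minor on those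
  -- columns uses lower rows only.
  by_cases hg : ∀ k, Q (g k)
  · refine Ideal.mul_mem_mul (h1 g hg) ?_
    refine det_mem_of_columns _ (fun j => ¬ Q j) I' fun r => ?_
    by_cases hr : ∃ a k, r a = Sum.inl k
    · obtain ⟨a, k, hk⟩ := hr
      rw [Matrix.det_eq_zero_of_row_eq_zero a]
      · exact I'.zero_mem
      · intro b
        have : (b : κ ⊕ κ') ≠ g k := fun h => b.2 (h ▸ hg k)
        simp [hk, this]
    · have : ∀ a, ∃ k, r a = Sum.inr k := fun a => by
        rcases hra : r a with k | k
        · exact (hr ⟨a, k, hra⟩).elim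
        · exact ⟨k, rfl⟩
      choose r' hr' using this
      convert h2 r' using 2
      ext a b
      simp [hr']
  · push Not at hg
    obtain ⟨k, hk⟩ := hg
    rw [Matrix.det_eq_zero_of_column_eq_zero k (fun i => h0 i _ hk), zero_mul]
    exact Ideal.zero_mem _

/-- The elementary ideals of a block triangular matrix. -/
theorem matrixElementaryIdeal_fromBlocks_le {m n m' n' : Type*} [Fintype n] [Fintype m']
    [Fintype n'] (A : Matrix m n R) (B : Matrix m' n R) (D : Matrix m' n' R)
    (hcard : Fintype.card m' ≤ Fintype.card n') (ℓ : ℕ) :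
    matrixElementaryIdeal (Matrix.fromBlocks A 0 B D) ℓ ≤
      matrixElementaryIdeal A ℓ * matrixElementaryIdeal D ℓ := by
  classical
  simp only [matrixElementaryIdeal_eq]
  rw [minorIdeal_le_iff, Fintype.card_sum]
  intro f g
  generalize hs : Fintype.card n + Fintype.card n' - ℓ = s at f g
  by_cases hf : Function.Injective f
  swap
  · rw [Function.Injective] at hf
    push Not at hf
    obtain ⟨a, b, hab, hne⟩ := hf
    rw [Matrix.det_zero_of_row_eq hne]
    · exact Ideal.zero_mem _
    · funext j; simp [hab]
  by_cases hg : Function.Injective g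
  swap
  · rw [Function.Injective] at hg
    push Not at hg
    obtain ⟨a, b, hab, hne⟩ := hg
    rw [Matrix.det_zero_of_column_eq hne]
    · exact Ideal.zero_mem _
    · intro j; simp [hab]
  let P : Fin s → Prop := fun i => (f i).isLeft
  let Q : Fin s → Prop := fun i => (g i).isLeft
  let e : {i // P i} ⊕ {i // ¬ P i} ≃ Fin s := Equiv.sumCompl P
  have hP : Fintype.card {i // P i} + Fintype.card {i // ¬ P i} = s := by
    rw [← Fintype.card_sum, Fintype.card_congr e, Fintype.card_fin]
  have hQ : Fintype.card {i // Q i} + Fintype.card {i // ¬ Q i} = s := by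
    rw [← Fintype.card_sum, Fintype.card_congr (Equiv.sumCompl Q), Fintype.card_fin]
  -- At most `card m' ≤ card n'` rows are lower rows, so at least `card n - ℓ` are upper ones. At
  -- most `card n` columns are left columns, so at least `card n' - ℓ` are right ones. Hence both
  -- factors below are minors of sufficient size.
  have hP' : Fintype.card {i // ¬ P i} ≤ Fintype.card m' := by
    have : ∀ i : {i // ¬ P i}, ∃ k, f i.1 = Sum.inr k := fun i => by
      rcases hi : f i.1 with k | k
      · exact (i.2 (by simp [P, hi])).elim
      · exact ⟨k, rfl⟩
    choose t ht using this
    refine Fintype.card_le_of_injective t fun a b hab => Subtype.ext (hf ?_)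
    rw [ht, ht, hab]
  have hQ' : Fintype.card {i // Q i} ≤ Fintype.card n := by
    have : ∀ i : {i // Q i}, ∃ k, g i.1 = Sum.inl k := fun i => by
      rcases hi : g i.1 with k | k
      · exact ⟨k, rfl⟩
      · exact absurd i.2 (by simp [Q, hi])
    choose t ht using this
    refine Fintype.card_le_of_injective t fun a b hab => Subtype.ext (hg ?_)
    rw [ht, ht, hab]
  rw [← Matrix.det_submatrix_equiv_self e]
  refine det_mem_mul_of_block _ (fun j => Q (e j)) _ _ ?_ ?_ ?_
  · intro i j hj
    have hi : (f i.1).isLeft := i.2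
    obtain ⟨a, ha⟩ := Sum.isLeft_iff.1 hi
    have hj' : (g (e j)).isLeft = false := by simpa [Q] using hj
    obtain ⟨b, hb⟩ := Sum.isRight_iff.1 (Sum.isLeft_eq_false.1 hj')
    simp [e, ha, hb]
  · intro g' hg'
    refine minorIdeal_antitone A (k' := Fintype.card {i // P i}) (by omega) ?_
    have h1 : ∀ k, ∃ b, g (e (g' k)) = Sum.inl b := fun k => Sum.isLeft_iff.1 (hg' k)
    have h2 : ∀ k : {i // P i}, ∃ b, f k.1 = Sum.inl b := fun k => Sum.isLeft_iff.1 k.2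
    choose t ht using h1
    choose u hu using h2
    convert det_submatrix_mem_minorIdeal A u t rfl using 2
    ext a b
    change Matrix.fromBlocks A 0 B D (f a.1) (g (e (g' b))) = A (u a) (t b)
    rw [hu, ht, Matrix.fromBlocks_apply₁₁]
  · intro r
    have hc : Fintype.card {j // ¬ Q (e j)} = Fintype.card {j // ¬ Q j} :=
      Fintype.card_congr (e.subtypeEquiv fun _ => Iff.rfl)
    refine minorIdeal_antitone D (k' := Fintype.card {j // ¬ Q (e j)}) (by omega) ?_
    have h1 : ∀ k : {j // ¬ Q (e j)}, ∃ b, g (e k.1) = Sum.inr b := fun k => by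
      have := k.2
      exact Sum.isRight_iff.1 (Sum.isLeft_eq_false.1 (by simpa [Q] using this))
    have h2 : ∀ k : {i // ¬ P i}, ∃ b, f k.1 = Sum.inr b := fun k =>  by
      have := k.2
      exact Sum.isRight_iff.1 (Sum.isLeft_eq_false.1 (by simpa [P] using this))
    choose t ht using h1
    choose u hu using h2
    convert det_submatrix_mem_minorIdeal D (u ∘ r) t rfl using 2
    ext a b
    change Matrix.fromBlocks A 0 B D (f (r a).1) (g (e b.1)) = D (u (r a)) (t b)
    rw [hu, ht, Matrix.fromBlocks_apply₂₂]

end Minors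

/-! ### Elementary ideals of modules: independence of the presentation and base change -/

section ElementaryIdeals

variable {R : Type*} [CommRing R]

theorem multilinearMap_mem_of_span {κ V : Type*} [Fintype κ] [AddCommGroup V] [Module R V]
    (F : MultilinearMap R (fun _ : κ => V) R) (S : Set V) (I : Ideal R)
    (h : ∀ w : κ → V, (∀ i, w i ∈ S) → F w ∈ I) (v : κ → V)
    (hv : ∀ i, v i ∈ Submodule.span R S) : F v ∈ I := by
  classical
  -- The arguments are released from `S` to its span one at a time; `T` is the set of those already
  -- released.
  suffices H : ∀ (T : Finset κ) (v : κ → V), (∀ i ∈ T, v i ∈ Submodule.span R S) →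
      (∀ i ∉ T, v i ∈ S) → F v ∈ I from
    H Finset.univ v (fun i _ => hv i) (fun i hi => (hi (Finset.mem_univ i)).elim)
  intro T
  induction T using Finset.induction_on with
  | empty => exact fun v _ hv => h v fun i => hv i (Finset.notMem_empty i)
  | insert a T ha ih =>
    intro v hv hv'
    have key : ∀ x ∈ Submodule.span R S, F (Function.update v a x) ∈ I := by
      intro x hx
      induction hx using Submodule.span_induction with
      | mem x hx =>
        refine ih _ (fun i hi => ?_) (fun i hi => ?_)
        · rw [Function.update_of_ne (by rintro rfl; exact ha hi)]
          exact hv i (Finset.mem_insert_of_mem hi)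
        · by_cases hia : i = a
          · subst hia; rwa [Function.update_self]
          · rw [Function.update_of_ne hia]
            exact hv' i (by simp [hia, hi])
      | zero => rw [F.map_update_zero]; exact I.zero_mem
      | add x y _ _ hx hy => rw [F.map_update_add]; exact I.add_mem hx hy
      | smul c x _ hx => rw [F.map_update_smul]; exact I.mul_mem_left c hx
    have := key (v a) (hv a (Finset.mem_insert_self a T))
    rwa [Function.update_eq_self] at this

theorem minorIdeal_le_of_rows_mem_span {m m' n : Type*} (A : Matrix m n R) (B : Matrix m' n R)
    (h : ∀ i, A i ∈ Submodule.span R (Set.range fun i => B i)) (k : ℕ) :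
    minorIdeal A k ≤ minorIdeal B k := by
  rw [minorIdeal_le_iff]
  intro f g
  refine multilinearMap_mem_of_span
    ((Matrix.detRowAlternating (R := R) (n := Fin k)).compLinearMap
      (LinearMap.funLeft R R g)).toMultilinearMap (Set.range fun i => B i) _ ?_
    (fun i => A (f i)) (fun i => h _)
  intro w hw
  choose t ht using hw
  have := det_submatrix_mem_minorIdeal B t g (Fintype.card_fin k)
  convert this using 1
  simp only [AlternatingMap.coe_multilinearMap, AlternatingMap.compLinearMap_apply]
  change Matrix.det _ = _
  congr 1
  ext i j
  change w i (g j) = B (t i) (g j)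
  rw [← ht]

theorem minorIdeal_mul_left_le {m m' n : Type*} [Fintype m'] (U : Matrix m m' R)
    (A : Matrix m' n R) (k : ℕ) : minorIdeal (U * A) k ≤ minorIdeal A k := by
  refine minorIdeal_le_of_rows_mem_span _ _ (fun i => ?_) k
  have : (U * A) i = ∑ j, U i j • A j := by
    ext x
    simp [Matrix.mul_apply, Finset.sum_apply]
  rw [this]
  exact Submodule.sum_mem _ fun j _ => Submodule.smul_mem _ _ (Submodule.subset_span ⟨j, rfl⟩)

theorem minorIdeal_mul_right_le {m n n' : Type*} [Fintype n] (A : Matrix m n R)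
    (V : Matrix n n' R) (k : ℕ) : minorIdeal (A * V) k ≤ minorIdeal A k := by
  rw [← minorIdeal_transpose, Matrix.transpose_mul, ← minorIdeal_transpose A]
  exact minorIdeal_mul_left_le _ _ k

theorem matrixElementaryIdeal_submatrix_le {m n m' n' : Type*} [Fintype n] [Fintype n']
    (A : Matrix m n R) (f : m' → m) (e : n' ≃ n) (ℓ : ℕ) :
    matrixElementaryIdeal (A.submatrix f e) ℓ ≤ matrixElementaryIdeal A ℓ := by
  simp only [matrixElementaryIdeal_eq, Fintype.card_congr e]
  exact minorIdeal_submatrix_le _ _ _ _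

theorem matrixElementaryIdeal_submatrix {m n m' n' : Type*} [Fintype n] [Fintype n']
    (A : Matrix m n R) (f : m' ≃ m) (e : n' ≃ n) (ℓ : ℕ) :
    matrixElementaryIdeal (A.submatrix f e) ℓ = matrixElementaryIdeal A ℓ := by
  refine le_antisymm (matrixElementaryIdeal_submatrix_le A f e ℓ) ?_
  have := matrixElementaryIdeal_submatrix_le (A.submatrix f e) f.symm e.symm ℓ
  simpa using this

/-- Adding a generator together with a relation that expresses it does not change the elementary
ideals. -/
theorem matrixElementaryIdeal_fromBlocks_one {m n n' : Type*} [Fintype n] [Fintype n']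
    [DecidableEq n'] (A : Matrix m n R) (B : Matrix n' n R) (ℓ : ℕ) :
    matrixElementaryIdeal (Matrix.fromBlocks A 0 B (1 : Matrix n' n' R)) ℓ =
      matrixElementaryIdeal A ℓ := by
  classical
  apply le_antisymm
  · exact (matrixElementaryIdeal_fromBlocks_le A B 1 le_rfl ℓ).trans Ideal.mul_le_left
  -- For `ℓ ≤ card n` a minor of `A` is extended by the identity block without changing its value.
  -- Otherwise truncated subtraction makes the ideal of `A` the whole ring, and the identity block
  -- provides a minor equal to `1`.
  · rcases le_total ℓ (Fintype.card n) with hℓ | hℓ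
    · simp only [matrixElementaryIdeal_eq]
      rw [minorIdeal_le_iff]
      intro f g
      have := det_submatrix_mem_minorIdeal (Matrix.fromBlocks A 0 B (1 : Matrix n' n' R))
        (Sum.map f id) (Sum.map g id) (k := Fintype.card (n ⊕ n') - ℓ)
        (by simp only [Fintype.card_sum, Fintype.card_fin]; omega)
      convert this using 1
      have hM : (Matrix.fromBlocks A 0 B (1 : Matrix n' n' R)).submatrix (Sum.map f id)
          (Sum.map g id) = Matrix.fromBlocks (A.submatrix f g) 0 (B.submatrix id g) 1 := by
        ext (i | i) (j | j) <;> rfl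
      rw [hM, Matrix.det_fromBlocks_zero₁₂, Matrix.det_one, mul_one]
    · refine le_trans le_top (le_of_eq ?_)
      symm
      rw [Ideal.eq_top_iff_one, matrixElementaryIdeal_eq]
      refine minorIdeal_antitone _ (k' := Fintype.card n')
        (by simp only [Fintype.card_sum]; omega) ?_
      have := det_submatrix_mem_minorIdeal (Matrix.fromBlocks A 0 B (1 : Matrix n' n' R))
        Sum.inr Sum.inr (k := Fintype.card n') rfl
      convert this using 1
      have hM : (Matrix.fromBlocks A 0 B (1 : Matrix n' n' R)).submatrix Sum.inr Sum.inr = 1 := by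
        ext i j; rfl
      rw [hM, Matrix.det_one]

/-- Two generating sets of a module give rise to a presentation on their union. -/
theorem span_rows_fromBlocks_one {M m n n' : Type*} [AddCommGroup M] [Module R M] [Fintype n]
    [Fintype n'] [DecidableEq n'] (A : Matrix m n R) (π : (n → R) →ₗ[R] M)
    (hA : LinearMap.ker π = Submodule.span R (Set.range fun i => A i)) (π' : (n' → R) →ₗ[R] M)
    (B : Matrix n' n R) (hB : ∀ i, π (B i) = - π' (Pi.single i 1)) :
    Submodule.span R (Set.range fun i =>
      (Matrix.fromBlocks A 0 B (1 : Matrix n' n' R)) i) =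
      LinearMap.ker (π ∘ₗ LinearMap.funLeft R R Sum.inl + π' ∘ₗ LinearMap.funLeft R R Sum.inr :
        (n ⊕ n' → R) →ₗ[R] M) := by
  apply le_antisymm
  · rw [Submodule.span_le]
    rintro _ ⟨i | i, rfl⟩
    · have h1 : π (A i) = 0 := by
        rw [← LinearMap.mem_ker, hA]
        exact Submodule.subset_span ⟨i, rfl⟩
      have e1 : LinearMap.funLeft R R Sum.inl
        ((Matrix.fromBlocks A 0 B (1 : Matrix n' n' R)) (Sum.inl i)) = A i := rfl
      have e2 : LinearMap.funLeft R R Sum.inr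
        ((Matrix.fromBlocks A 0 B (1 : Matrix n' n' R)) (Sum.inl i)) = 0 := rfl
      simp [e1, e2, h1]
    · have e1 : LinearMap.funLeft R R Sum.inl
        ((Matrix.fromBlocks A 0 B (1 : Matrix n' n' R)) (Sum.inr i)) = B i := rfl
      have e2 : LinearMap.funLeft R R Sum.inr
        ((Matrix.fromBlocks A 0 B (1 : Matrix n' n' R)) (Sum.inr i)) = Pi.single i 1 := by
        ext j
        simp [LinearMap.funLeft, Matrix.one_apply, Pi.single_apply, eq_comm]
      simp [e1, e2, hB]
  · intro v hv
    set M' := Matrix.fromBlocks A 0 B (1 : Matrix n' n' R) with hM'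
    -- Subtracting `u` clears the coordinates of `v` in `n'`; what remains is a relation between the
    -- old generators.
    let u : n ⊕ n' → R := ∑ j, v (Sum.inr j) • M' (Sum.inr j)
    have hu : u ∈ Submodule.span R (Set.range fun i => M' i) :=
      Submodule.sum_mem _ fun j _ => Submodule.smul_mem _ _ (Submodule.subset_span ⟨_, rfl⟩)
    have hur : ∀ j, u (Sum.inr j) = v (Sum.inr j) := by
      intro j
      simp [u, hM', Finset.sum_apply, Matrix.one_apply]
    have hul : (fun i => u (Sum.inl i)) = ∑ j, v (Sum.inr j) • B j := by
      ext i
      simp [u, hM', Finset.sum_apply]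
    have hw : (fun i => v (Sum.inl i) - u (Sum.inl i)) ∈
        Submodule.span R (Set.range fun i => A i) := by
      rw [← hA, LinearMap.mem_ker]
      have h1 : π (fun i => v (Sum.inl i)) + π' (fun i => v (Sum.inr i)) = 0 := hv
      have h2 : π' (fun i => v (Sum.inr i)) = ∑ j, v (Sum.inr j) • π' (Pi.single j 1) := by
        conv_lhs => rw [pi_eq_sum_univ' (fun i => v (Sum.inr i))]
        rw [map_sum]
        refine Finset.sum_congr rfl fun j _ => ?_
        rw [map_smul]
      have h3 : (fun i => v (Sum.inl i) - u (Sum.inl i)) =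
          (fun i => v (Sum.inl i)) - fun i => u (Sum.inl i) := rfl
      rw [h3, map_sub, hul, map_sum]
      simp only [map_smul, hB, smul_neg, Finset.sum_neg_distrib, sub_neg_eq_add]
      rw [← h2, h1]
    have hext : ∀ w ∈ Submodule.span R (Set.range fun i => A i),
        Sum.elim w (0 : n' → R) ∈ Submodule.span R (Set.range fun i => M' i) := by
      intro w hw
      induction hw using Submodule.span_induction with
      | mem x hx =>
        obtain ⟨i, rfl⟩ := hx
        refine Submodule.subset_span ⟨Sum.inl i, ?_⟩
        ext (j | j) <;> rfl
      | zero =>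
        convert Submodule.zero_mem _ using 1
        ext (j | j) <;> rfl
      | add x y _ _ hx hy =>
        convert Submodule.add_mem _ hx hy using 1
        ext (j | j) <;> simp
      | smul c x _ hx =>
        convert Submodule.smul_mem _ c hx using 1
        ext (j | j) <;> simp
    have : v = Sum.elim (fun i => v (Sum.inl i) - u (Sum.inl i)) (0 : n' → R) + u := by
      ext (j | j) <;> simp [hur]
    rw [this]
    exact Submodule.add_mem _ (hext _ hw) hu

/-- Every generating set of a presented module extends a presentation to the union of the two
generating sets, with the same elementary ideals. -/
theorem exists_span_eq_ker_sum {M m n n' : Type*} [AddCommGroup M] [Module R M] [Fintype n]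
    [Fintype n'] [DecidableEq n'] (A : Matrix m n R) (π : (n → R) →ₗ[R] M)
    (hπ : Function.Surjective π)
    (hA : LinearMap.ker π = Submodule.span R (Set.range fun i => A i)) (π' : (n' → R) →ₗ[R] M) :
    ∃ A' : Matrix (m ⊕ n') (n ⊕ n') R, Submodule.span R (Set.range fun i => A' i) =
      LinearMap.ker (π ∘ₗ LinearMap.funLeft R R Sum.inl + π' ∘ₗ LinearMap.funLeft R R Sum.inr :
        (n ⊕ n' → R) →ₗ[R] M) ∧
      ∀ ℓ, matrixElementaryIdeal A' ℓ = matrixElementaryIdeal A ℓ := by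
  choose B hB using fun i : n' => hπ (- π' (Pi.single i 1))
  exact ⟨_, span_rows_fromBlocks_one A π hA π' B hB,
    fun ℓ => matrixElementaryIdeal_fromBlocks_one A B ℓ⟩

/-- The elementary ideals of a presentation matrix depend only on the module. -/
theorem matrixElementaryIdeal_eq_of_isPresentationMatrix {M m n m' n' : Type*} [AddCommGroup M]
    [Module R M] [Fintype n] [Fintype n'] (A : Matrix m n R) (B : Matrix m' n' R)
    (hA : IsPresentationMatrix A M) (hB : IsPresentationMatrix B M) (ℓ : ℕ) :
    matrixElementaryIdeal A ℓ = matrixElementaryIdeal B ℓ := by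
  classical
  obtain ⟨π, hπ, hA⟩ := hA
  obtain ⟨π', hπ', hB⟩ := hB
  obtain ⟨A', hA', hAe⟩ := exists_span_eq_ker_sum A π hπ hA π'
  obtain ⟨B', hB', hBe⟩ := exists_span_eq_ker_sum B π' hπ' hB π
  rw [← hAe, ← hBe]
  -- Up to the order of the summands both extended matrices present the same map on the union of the
  -- generators, so their rows span the same kernel.
  have hswap : Submodule.span R (Set.range fun i => (B'.submatrix id Sum.swap) i) =
      Submodule.span R (Set.range fun i => A' i) := by
    rw [hA']
    have h1 : (Set.range fun i => (B'.submatrix id Sum.swap) i) =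
        LinearMap.funLeft R R (Sum.swap : n ⊕ n' → n' ⊕ n) '' Set.range fun i => B' i := by
      rw [← Set.range_comp]; rfl
    rw [h1, ← Submodule.map_span, hB']
    ext v
    constructor
    · rintro ⟨w, hw, rfl⟩
      change π' (fun i => w (Sum.inl i)) + π (fun i => w (Sum.inr i)) = 0 at hw
      change π (fun i => w (Sum.inr i)) + π' (fun i => w (Sum.inl i)) = 0
      rw [add_comm, hw]
    · intro hv
      change π (fun i => v (Sum.inl i)) + π' (fun i => v (Sum.inr i)) = 0 at hv
      refine ⟨v ∘ Sum.swap, ?_, ?_⟩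
      · change π' (fun i => v (Sum.inr i)) + π (fun i => v (Sum.inl i)) = 0
        rw [add_comm, hv]
      · ext i
        simp [LinearMap.funLeft]
  have hE : matrixElementaryIdeal B' ℓ = matrixElementaryIdeal (B'.submatrix id Sum.swap) ℓ :=
    (matrixElementaryIdeal_submatrix B' (Equiv.refl _) (Equiv.sumComm n n') ℓ).symm
  rw [hE]
  simp only [matrixElementaryIdeal_eq]
  apply le_antisymm
  · refine minorIdeal_le_of_rows_mem_span _ _ (fun i => ?_) _
    rw [hswap]
    exact Submodule.subset_span ⟨i, rfl⟩
  · refine minorIdeal_le_of_rows_mem_span _ _ (fun i => ?_) _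
    rw [← hswap]
    exact Submodule.subset_span ⟨i, rfl⟩

theorem IsPresentationMatrix.submatrix {M m n m' n' : Type*} [AddCommGroup M] [Module R M]
    [Fintype n] [Fintype n'] {A : Matrix m n R} (hA : IsPresentationMatrix A M) (f : m' ≃ m)
    (e : n' ≃ n) : IsPresentationMatrix (A.submatrix f e) M := by
  obtain ⟨π, hπ, hA⟩ := hA
  refine ⟨π ∘ₗ LinearMap.funLeft R R e.symm, ?_, ?_⟩
  · exact hπ.comp (LinearMap.funLeft_surjective_of_injective R R _ e.symm.injective)
  · have h1 : (Set.range fun i => (A.submatrix f e) i) =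
        LinearMap.funLeft R R e '' Set.range fun i => A i := by
      rw [← Set.range_comp]
      exact f.surjective.range_comp (fun i => LinearMap.funLeft R R e (A i))
    rw [h1, ← Submodule.map_span, ← hA]
    ext v
    constructor
    · intro hv
      refine ⟨v ∘ e.symm, hv, ?_⟩
      ext i
      simp [LinearMap.funLeft]
    · rintro ⟨w, hw, rfl⟩
      have : LinearMap.funLeft R R e.symm (LinearMap.funLeft R R e w) = w := by
        ext i; simp [LinearMap.funLeft]
      rw [LinearMap.mem_ker, LinearMap.comp_apply, this]
      exact hw

/-- Finiteness of `m` places a reindexed copy of `A` among the matrices over which the supremum is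
taken; independence of the presentation does the rest. -/
theorem elementaryIdeal_eq_of_isPresentationMatrix {M m n : Type*} [AddCommGroup M] [Module R M]
    [Finite m] [Fintype n] (A : Matrix m n R) (hA : IsPresentationMatrix A M) (ℓ : ℕ) :
    elementaryIdeal R M ℓ = matrixElementaryIdeal A ℓ := by
  have : Fintype m := Fintype.ofFinite m
  apply le_antisymm
  · refine sSup_le ?_
    rintro _ ⟨m', n', B, hB, rfl⟩
    exact (matrixElementaryIdeal_eq_of_isPresentationMatrix B A hB hA ℓ).le
  · refine le_sSup ⟨Fintype.card m, Fintype.card n,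
      A.submatrix (Fintype.equivFin m).symm (Fintype.equivFin n).symm, hA.submatrix _ _, ?_⟩
    exact (matrixElementaryIdeal_submatrix A _ _ ℓ).symm

/-- Base change of a presentation matrix. -/
theorem IsPresentationMatrix.baseChange {M m n : Type*} [AddCommGroup M] [Module R M] [Fintype n]
    {A : Matrix m n R} (hA : IsPresentationMatrix A M) (S : Type*) [CommRing S] [Algebra R S] :
    IsPresentationMatrix (A.map (algebraMap R S)) (S ⊗[R] M) := by
  classical
  obtain ⟨π, hπ, hA⟩ := hA
  let N : Submodule S (n → S) :=
    Submodule.span S (Set.range fun i => (A.map (algebraMap R S)) i)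
  let Pm : (n → S) →ₗ[S] S ⊗[R] M :=
    (Pi.basisFun S n).constr S fun i => (1 : S) ⊗ₜ[R] π (Pi.single i 1)
  let c : (n → R) →ₗ[R] (n → S) := (Algebra.linearMap R S).compLeft n
  have hPmsingle : ∀ i, Pm (Pi.single i 1) = 1 ⊗ₜ[R] π (Pi.single i 1) := fun i => by
    have := (Pi.basisFun S n).constr_basis S (fun i => (1 : S) ⊗ₜ[R] π (Pi.single i 1)) i
    rwa [Pi.basisFun_apply] at this
  have hPmc : ∀ w : n → R, Pm (c w) = 1 ⊗ₜ[R] π w := by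
    have : (Pm.restrictScalars R) ∘ₗ c = TensorProduct.mk R S M 1 ∘ₗ π := by
      refine LinearMap.pi_ext' fun i => LinearMap.ext_ring ?_
      have : c (Pi.single i 1) = Pi.single i 1 := by
        ext j
        by_cases h : j = i
        · subst h; simp [c]
        · simp [c, h]
      change Pm (c (Pi.single i 1)) = 1 ⊗ₜ[R] π (Pi.single i 1)
      rw [this, hPmsingle]
    exact fun w => LinearMap.congr_fun this w
  refine ⟨Pm, ?_, ?_⟩
  · intro x
    induction x using TensorProduct.induction_on with
    | zero => exact ⟨0, map_zero _⟩
    | tmul s m =>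
      obtain ⟨w, rfl⟩ := hπ m
      refine ⟨s • c w, ?_⟩
      rw [map_smul, hPmc, TensorProduct.smul_tmul', smul_eq_mul, mul_one]
    | add x y hx hy =>
      obtain ⟨a, rfl⟩ := hx
      obtain ⟨b, rfl⟩ := hy
      exact ⟨a + b, map_add _ _ _⟩
  · apply le_antisymm
    -- The map `back` induced by `q` extends to `S ⊗ M`, and its composite with `Pm` is the
    -- projection modulo `N`. Hence the kernel of `Pm` lies in `N`.
    · let q : (n → R) →ₗ[R] ((n → S) ⧸ N) := (N.mkQ.restrictScalars R) ∘ₗ c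
      have hq : LinearMap.ker π ≤ LinearMap.ker q := by
        rw [hA, Submodule.span_le]
        rintro _ ⟨i, rfl⟩
        change N.mkQ (c (A i)) = 0
        rw [Submodule.mkQ_apply, Submodule.Quotient.mk_eq_zero]
        exact Submodule.subset_span ⟨i, rfl⟩
      let e := π.quotKerEquivOfSurjective hπ
      let back : M →ₗ[R] ((n → S) ⧸ N) := ((LinearMap.ker π).liftQ q hq) ∘ₗ e.symm.toLinearMap
      have hback : ∀ w, back (π w) = q w := by
        intro w
        have : e.symm (π w) = (LinearMap.ker π).mkQ w := by
          rw [LinearEquiv.symm_apply_eq]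
          rfl
        change (LinearMap.ker π).liftQ q hq (e.symm (π w)) = q w
        rw [this]
        rfl
      let Back : S ⊗[R] M →ₗ[S] ((n → S) ⧸ N) := LinearMap.liftBaseChange S back
      have hcomp : Back ∘ₗ Pm = N.mkQ := by
        refine LinearMap.pi_ext' fun i => LinearMap.ext_ring ?_
        change Back (Pm (Pi.single i 1)) = N.mkQ (Pi.single i 1)
        rw [hPmsingle]
        simp only [Back, LinearMap.liftBaseChange_tmul, one_smul, hback]
        change N.mkQ (c (Pi.single i 1)) = _
        congr 1
        ext j
        by_cases h : j = i
        · subst h; simp [c]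
        · simp [c, h]
      intro v hv
      have := LinearMap.congr_fun hcomp v
      rw [LinearMap.comp_apply, LinearMap.mem_ker.1 hv, map_zero] at this
      exact (Submodule.Quotient.mk_eq_zero N).1 this.symm
    · rw [Submodule.span_le]
      rintro _ ⟨i, rfl⟩
      change Pm (c (A i)) = 0
      have : π (A i) = 0 := by
        rw [← LinearMap.mem_ker, hA]
        exact Submodule.subset_span ⟨i, rfl⟩
      rw [hPmc, this, TensorProduct.tmul_zero]

/-- If the rows of a matrix sum to zero, deleting a column shifts the elementary ideals. -/
theorem matrixElementaryIdeal_delete_column {m n : Type*} [Fintype n] [DecidableEq n]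
    (J : Matrix m n R) (hJ : ∀ i, ∑ j, J i j = 0) (x₀ : n) (ℓ : ℕ) :
    matrixElementaryIdeal (J.submatrix id (Subtype.val : {x // x ≠ x₀} → n)) ℓ =
      matrixElementaryIdeal J (ℓ + 1) := by
  simp only [matrixElementaryIdeal_eq]
  have hc : Fintype.card {x // x ≠ x₀} - ℓ = Fintype.card n - (ℓ + 1) := by
    rw [Fintype.card_subtype_compl, Fintype.card_subtype_eq]
    omega
  rw [hc]
  refine le_antisymm (minorIdeal_submatrix_le _ _ _ _) ?_
  -- Multiplication by `V` on the right restores the deleted column as minus the sum of the others.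
  let V : Matrix {x // x ≠ x₀} n R := Matrix.of fun y x =>
    if x = x₀ then -1 else if y.1 = x then 1 else 0
  have : J = J.submatrix id (Subtype.val : {x // x ≠ x₀} → n) * V := by
    ext i x
    rw [Matrix.mul_apply]
    by_cases hx : x = x₀
    · subst hx
      have h := hJ i
      rw [← Fintype.sum_subtype_add_sum_subtype (fun y => y ≠ x)] at h
      have h2 : ∑ y : {y // ¬ y ≠ x}, J i y.1 = J i x := by
        have : Unique {y // ¬ y ≠ x} := ⟨⟨⟨x, by simp⟩⟩, fun y => Subtype.ext (not_not.1 y.2)⟩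
        rw [Fintype.sum_unique]
        congr 1
        exact not_not.1 (default : {y // ¬ y ≠ x}).2
      rw [h2] at h
      simp [V]
      linear_combination h
    · rw [Finset.sum_eq_single (⟨x, hx⟩ : {x // x ≠ x₀})]
      · simp [V, hx]
      · intro y _ hy
        have : y.1 ≠ x := fun h => hy (Subtype.ext h)
        simp [V, hx, this]
      · simp
  conv_lhs => rw [this]
  exact minorIdeal_mul_right_le _ _ _

end ElementaryIdeals

/-! ### Polynomial matrices evaluated at a square matrix -/

section BlockEval

open Polynomial
open scoped Kronecker

variable {R : Type*} [CommRing R]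

/-- An intertwiner of two matrices intertwines all polynomials in them. Below, `T` is in turn a
change of basis, an invariant vector, the projection along that vector, and a left eigenvector. -/
theorem mul_aeval_of_intertwine {k k' : Type*} [Fintype k] [DecidableEq k] [Fintype k']
    [DecidableEq k'] (T : Matrix k k' R) (W' : Matrix k' k' R) (W : Matrix k k R)
    (h : T * W' = W * T) (q : R[X]) : T * aeval W' q = aeval W q * T := by
  induction q using Polynomial.induction_on' with
  | add p q hp hq => simp only [map_add, Matrix.mul_add, Matrix.add_mul, hp, hq]
  | monomial n a =>
    have hpow : ∀ n : ℕ, T * W' ^ n = W ^ n * T := fun n => by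
      induction n with
      | zero => simp
      | succ n ih =>
        rw [pow_succ, ← Matrix.mul_assoc, ih, Matrix.mul_assoc, h, ← Matrix.mul_assoc, ← pow_succ]
    rw [← C_mul_X_pow_eq_monomial]
    simp only [map_mul, aeval_C, map_pow, aeval_X, Algebra.algebraMap_eq_smul_one, smul_mul_assoc,
      one_mul, Matrix.mul_smul, Matrix.smul_mul, hpow]

/-- The block matrix obtained from a matrix of polynomials by evaluation at a square matrix. -/
noncomputable def blockEval {C X k : Type*} [Fintype k] [DecidableEq k] (W : Matrix k k R)
    (J : Matrix C X R[X]) : Matrix (C × k) (X × k) R :=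
  Matrix.of fun a b => aeval W (J a.1 b.1) a.2 b.2

theorem kronecker_mul_blockEval {C X k k' : Type*} [Fintype C] [Fintype X] [DecidableEq C]
    [DecidableEq X] [Fintype k] [DecidableEq k] [Fintype k'] [DecidableEq k']
    (T : Matrix k k' R) (W' : Matrix k' k' R) (W : Matrix k k R)
    (h : T * W' = W * T) (J : Matrix C X R[X]) :
    ((1 : Matrix C C R) ⊗ₖ T) * blockEval W' J = blockEval W J * ((1 : Matrix X X R) ⊗ₖ T) := by
  ext ⟨c, i⟩ ⟨x, j⟩
  have := congrFun (congrFun (mul_aeval_of_intertwine T W' W h (J c x)) i) j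
  simp only [Matrix.mul_apply] at this
  simp only [Matrix.mul_apply, Fintype.sum_prod_type, Matrix.kroneckerMap_apply, blockEval,
    Matrix.of_apply, Matrix.one_apply]
  rw [Finset.sum_eq_single c, Finset.sum_eq_single x]
  · simpa using this
  · intro b _ hb
    simp [hb]
  · simp
  · intro b _ hb
    simp [hb.symm]
  · simp

/-- Conjugating `W'` by `U` conjugates every block at once, through the Kronecker products of
identity matrices with `U` and `V`; multiplication on either side does not enlarge ideals of minors.
-/
theorem minorIdeal_blockEval_le_of_conj {C X k : Type*} [Fintype C] [Fintype X] [Fintype k]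
    [DecidableEq k] (U V W W' : Matrix k k R) (hUV : U * V = 1) (h : U * W' = W * U)
    (J : Matrix C X R[X]) (l : ℕ) :
    minorIdeal (blockEval W J) l ≤ minorIdeal (blockEval W' J) l := by
  classical
  have h1 := kronecker_mul_blockEval U W' W h J
  have h2 : blockEval W J =
      ((1 : Matrix C C R) ⊗ₖ U) * (blockEval W' J * ((1 : Matrix X X R) ⊗ₖ V)) := by
    rw [← Matrix.mul_assoc, h1, Matrix.mul_assoc, ← Matrix.mul_kronecker_mul, hUV, one_mul,
      Matrix.one_kronecker_one, Matrix.mul_one]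
  rw [h2]
  exact (minorIdeal_mul_left_le _ _ _).trans (minorIdeal_mul_right_le _ _ _)

/-- The first unit vector is fixed by `W`, so a polynomial `q` in `W` multiplies it by `q(1)`. -/
theorem aeval_zero_column {N : ℕ} (W : Matrix (Fin (N + 1)) (Fin (N + 1)) R)
    (hW : ∀ i, W i 0 = if i = 0 then 1 else 0) (q : R[X]) (i : Fin (N + 1)) :
    aeval W q i 0 = if i = 0 then q.eval 1 else 0 := by
  let T : Matrix (Fin (N + 1)) Unit R := Matrix.of fun i _ => if i = 0 then 1 else 0
  have h : T * (1 : Matrix Unit Unit R) = W * T := by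
    ext i ⟨⟩
    simp [T, Matrix.mul_apply, hW]
  have h2 := congrFun (congrFun (mul_aeval_of_intertwine T 1 W h q) i) ()
  have h3 : aeval (1 : Matrix Unit Unit R) q = algebraMap R _ (q.eval 1) := by
    rw [← map_one (algebraMap R (Matrix Unit Unit R)),
      aeval_algebraMap_apply_eq_algebraMap_eval]
  rw [h3] at h2
  simp [T, Matrix.mul_apply, Matrix.algebraMap_eq_diagonal] at h2
  exact h2.symm

/-- The remaining coordinates describe the quotient by the invariant first unit vector. -/
theorem aeval_succ_succ {N : ℕ} (W : Matrix (Fin (N + 1)) (Fin (N + 1)) R)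
    (hW : ∀ i, W i 0 = if i = 0 then 1 else 0) (q : R[X]) (i j : Fin N) :
    aeval W q i.succ j.succ = aeval (W.submatrix Fin.succ Fin.succ) q i j := by
  let T : Matrix (Fin N) (Fin (N + 1)) R := Matrix.of fun i j => if j = i.succ then 1 else 0
  have h : T * W = W.submatrix Fin.succ Fin.succ * T := by
    ext i j
    refine Fin.cases ?_ (fun j => ?_) j
    · simp [T, Matrix.mul_apply, hW, (Fin.succ_ne_zero _).symm]
    · simp [T, Matrix.mul_apply]
  have h2 := congrFun (congrFun (mul_aeval_of_intertwine T W _ h q) i) j.succ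
  simpa [T, Matrix.mul_apply] using h2

/-- Splitting off the first index of the second factor. -/
def splitEquiv (X : Type*) (N : ℕ) : (X × Fin N) ⊕ X ≃ X × Fin (N + 1) where
  toFun := Sum.elim (fun a => (a.1, a.2.succ)) fun x => (x, 0)
  invFun a := Fin.cases (motive := fun _ => (X × Fin N) ⊕ X) (Sum.inr a.1)
    (fun i => Sum.inl (a.1, i)) a.2
  left_inv := by rintro (⟨x, i⟩ | x) <;> rfl
  right_inv := by
    rintro ⟨x, i⟩
    refine Fin.cases ?_ (fun i => ?_) i <;> rfl

/-- The index `0` is placed last, so that the zero block is at the upper right and the value of `J`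
at `1` is the lower right block, the one that is subject to the condition on rows and columns. -/
theorem blockEval_split {C X : Type*} {N : ℕ} (W : Matrix (Fin (N + 1)) (Fin (N + 1)) R)
    (hW : ∀ i, W i 0 = if i = 0 then 1 else 0) (J : Matrix C X R[X]) :
    (blockEval W J).submatrix (splitEquiv C N) (splitEquiv X N) =
      Matrix.fromBlocks (blockEval (W.submatrix Fin.succ Fin.succ) J) 0
        (Matrix.of fun c a => aeval W (J c a.1) 0 a.2.succ) (J.map (eval 1)) := by
  ext (⟨c, i⟩ | c) (⟨x, j⟩ | x)
  · exact aeval_succ_succ W hW _ _ _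
  · exact (aeval_zero_column W hW _ _).trans (if_neg (Fin.succ_ne_zero i))
  · rfl
  · exact (aeval_zero_column W hW _ _).trans (if_pos rfl)

theorem matrixElementaryIdeal_blockEval_le {C X : Type*} [Fintype C] [Fintype X] {N : ℕ}
    (hcard : Fintype.card C ≤ Fintype.card X)
    (W : Matrix (Fin (N + 1)) (Fin (N + 1)) R) (hW : ∀ i, W i 0 = if i = 0 then 1 else 0)
    (J : Matrix C X R[X]) (ℓ : ℕ) :
    matrixElementaryIdeal (blockEval W J) ℓ ≤
      matrixElementaryIdeal (blockEval (W.submatrix Fin.succ Fin.succ) J) ℓ *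
        matrixElementaryIdeal (J.map (eval 1)) ℓ := by
  rw [← matrixElementaryIdeal_submatrix (blockEval W J) (splitEquiv C N) (splitEquiv X N),
    blockEval_split W hW]
  exact matrixElementaryIdeal_fromBlocks_le _ _ _ hcard ℓ

/-- For unitriangular `W` the complement of the first index is again unitriangular. The splitting
can therefore be repeated, and each stage contributes one factor from `J(1)`. -/
theorem matrixElementaryIdeal_blockEval_le_pow {C X : Type*} [Fintype C] [Fintype X]
    (hcard : Fintype.card C ≤ Fintype.card X) {n : ℕ} (W : Matrix (Fin n) (Fin n) R)
    (hW1 : ∀ i, W i i = 1) (hW0 : ∀ i j, j < i → W i j = 0) (J : Matrix C X R[X]) (ℓ : ℕ) :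
    matrixElementaryIdeal (blockEval W J) ℓ ≤ matrixElementaryIdeal (J.map (eval 1)) ℓ ^ n := by
  induction n with
  | zero => simp
  | succ N ih =>
    refine (matrixElementaryIdeal_blockEval_le hcard W (fun i => ?_) J ℓ).trans ?_
    · by_cases hi : i = 0
      · subst hi; simp [hW1]
      · rw [hW0 i 0 (Fin.pos_of_ne_zero hi), if_neg hi]
    · rw [pow_succ]
      exact Ideal.mul_mono_left (ih (W.submatrix Fin.succ Fin.succ) (fun i => hW1 _)
        (fun i j h => hW0 _ _ (Fin.succ_lt_succ_iff.2 h)))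

/-- A polynomial `q` in an upper unitriangular matrix is upper triangular with all diagonal entries
`q(1)`. -/
theorem det_aeval_of_unitriangular {n : ℕ} (W : Matrix (Fin n) (Fin n) R)
    (hW1 : ∀ i, W i i = 1) (hW0 : ∀ i j, j < i → W i j = 0) (q : R[X]) :
    (aeval W q).det = q.eval 1 ^ n := by
  induction n with
  | zero => simp
  | succ N ih =>
    have hW : ∀ i, W i 0 = if i = 0 then 1 else 0 := fun i => by
      by_cases hi : i = 0
      · subst hi; simp [hW1]
      · rw [hW0 i 0 (Fin.pos_of_ne_zero hi), if_neg hi]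
    rw [Matrix.det_succ_column_zero, Fin.sum_univ_succ, Finset.sum_eq_zero, add_zero]
    · have : (aeval W q).submatrix (Fin.succAbove 0) Fin.succ =
          aeval (W.submatrix Fin.succ Fin.succ) q := by
        ext i j
        simpa using aeval_succ_succ W hW q i j
      rw [this, ih (W.submatrix Fin.succ Fin.succ) (fun i => hW1 _)
        (fun i j h => hW0 _ _ (Fin.succ_lt_succ_iff.2 h)), aeval_zero_column W hW]
      simp [pow_succ']
    · intro i _
      rw [aeval_zero_column W hW]
      simp

end BlockEval

/-! ### Block circulant matrices and the binomial basis -/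

section Circulant

open Polynomial

variable {R : Type*} [CommRing R]

/-- The matrix of the cyclic shift. -/
def cyclicShift (R : Type*) [CommRing R] (N : ℕ) : Matrix (Fin (N + 1)) (Fin (N + 1)) R :=
  Matrix.of fun i j => if j = i + 1 then 1 else 0

theorem cyclicShift_pow (N d : ℕ) (i j : Fin (N + 1)) :
    (cyclicShift R N ^ d) i j = if j = i + Fin.ofNat (N + 1) d then 1 else 0 := by
  induction d generalizing i j with
  | zero => simp [Matrix.one_apply, eq_comm]
  | succ d ih =>
    have hd : Fin.ofNat (N + 1) (d + 1) = 1 + Fin.ofNat (N + 1) d := by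
      ext
      simp [Fin.ofNat, Fin.val_add, add_comm]
    rw [pow_succ', Matrix.mul_apply, Finset.sum_eq_single (i + 1)]
    · rw [ih, hd, add_assoc]
      simp [cyclicShift]
    · intro b _ hb
      simp [cyclicShift, hb]
    · simp

/-- The polynomials whose coefficients are the blocks of a block circulant matrix. -/
noncomputable def circulantPoly {C X : Type*} {N : ℕ} (a : C → X → Fin (N + 1) → R) :
    Matrix C X R[X] :=
  Matrix.of fun c x => ∑ d : Fin (N + 1), Polynomial.C (a c x d) * Polynomial.X ^ (d : ℕ)

/-- The powers of the shift with exponents `0, …, N` have disjoint supports; the entry at `(i, j)`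
only sees the exponent `j - i`. -/
theorem blockEval_circulantPoly {C X : Type*} {N : ℕ} (a : C → X → Fin (N + 1) → R) :
    blockEval (cyclicShift R N) (circulantPoly a) =
      Matrix.of fun (b : C × Fin (N + 1)) (b' : X × Fin (N + 1)) => a b.1 b'.1 (b'.2 - b.2) := by
  ext ⟨c, i⟩ ⟨x, j⟩
  simp only [blockEval, circulantPoly, Matrix.of_apply, map_sum, map_mul, aeval_C, map_pow, aeval_X,
    Matrix.sum_apply]
  rw [Finset.sum_eq_single (j - i)]
  · rw [← Algebra.smul_def, Matrix.smul_apply, cyclicShift_pow, Fin.ofNat_val_eq_self]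
    simp
  · intro b _ hb
    rw [← Algebra.smul_def, Matrix.smul_apply, cyclicShift_pow, Fin.ofNat_val_eq_self, if_neg,
      smul_zero]
    rintro rfl
    simp at hb
  · simp

theorem circulantPoly_map_eval_one {C X : Type*} {N : ℕ} (a : C → X → Fin (N + 1) → R) :
    (circulantPoly a).map (eval 1) = Matrix.of fun c x => ∑ d, a c x d := by
  ext c x
  simp [circulantPoly, eval_finsetSum]

/-- Multiplication by `1 + y` in the basis `1, y, …, y ^ N` of the polynomials modulo
`(1 + y) ^ (N + 1) - 1`. -/
def binomialShift (R : Type*) [CommRing R] (N : ℕ) : Matrix (Fin (N + 1)) (Fin (N + 1)) R :=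
  Matrix.of fun i j => (if j = i then 1 else 0) +
    if (i : ℕ) = N then (if (j : ℕ) = 0 then 0 else -((N + 1).choose j : R))
    else if (j : ℕ) = i + 1 then 1 else 0

/-- The matrix of binomial coefficients. -/
def pascalMatrix (R : Type*) [CommRing R] (N : ℕ) : Matrix (Fin (N + 1)) (Fin (N + 1)) R :=
  Matrix.of fun i j => ((i : ℕ).choose j : R)

theorem det_pascalMatrix (N : ℕ) : (pascalMatrix R N).det = 1 := by
  rw [Matrix.det_of_isLowerTriangular]
  · simp [pascalMatrix]
  · intro i j hij
    have : (i : ℕ) < j := hij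
    simp [pascalMatrix, Nat.choose_eq_zero_of_lt this]

/-- Row `i` of the Pascal matrix lists the coefficients of `(1 + y) ^ i`. Both sides express that
multiplication by `1 + y` takes this power to the next, the exponent being read modulo `N + 1`. -/
theorem pascalMatrix_mul_binomialShift (N : ℕ) :
    pascalMatrix R N * binomialShift R N = cyclicShift R N * pascalMatrix R N := by
  ext i k
  have hR : (cyclicShift R N * pascalMatrix R N) i k = ((i + 1 : Fin (N + 1)) : ℕ).choose k := by
    simp [cyclicShift, pascalMatrix, Matrix.mul_apply]
  have hL : (pascalMatrix R N * binomialShift R N) i k = ((i : ℕ).choose k : R) +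
      ((∑ m : Fin N, ((i : ℕ).choose m : R) * if (k : ℕ) = m + 1 then 1 else 0) +
      ((i : ℕ).choose N : R) * if (k : ℕ) = 0 then 0 else -((N + 1).choose k : R)) := by
    simp only [Matrix.mul_apply, pascalMatrix, binomialShift, Matrix.of_apply, mul_add,
      Finset.sum_add_distrib]
    congr 1
    · simp
    · rw [Fin.sum_univ_castSucc]
      congr 1
      · refine Finset.sum_congr rfl fun m _ => ?_
        simp [m.2.ne]
      · simp
  have hsum : (∑ m : Fin N, ((i : ℕ).choose m : R) * if (k : ℕ) = m + 1 then 1 else 0) =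
      if (k : ℕ) = 0 then 0 else ((i : ℕ).choose (k - 1) : R) := by
    by_cases hk : (k : ℕ) = 0
    · simp [hk]
    · rw [if_neg hk, Finset.sum_eq_single (⟨k - 1, by omega⟩ : Fin N)]
      · rw [if_pos (by simp; omega), mul_one]
      · intro m _ hm
        rw [if_neg, mul_zero]
        intro h
        exact hm (Fin.ext (by simp; omega))
      · simp
  rw [hL, hR, hsum]
  -- For `i < N` this is Pascal's rule. For `i = N` the index `i + 1` wraps around to `0`, and the
  -- correction in the last row of `binomialShift` encodes `(1 + y) ^ (N + 1) = 1`.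
  rcases Nat.lt_or_ge i N with hi | hi
  · have h1 : ((i + 1 : Fin (N + 1)) : ℕ) = i + 1 := by
      rw [Fin.val_add_one_of_lt]
      exact hi
    rw [h1, Nat.choose_eq_zero_of_lt hi]
    by_cases hk : (k : ℕ) = 0
    · simp [hk]
    · obtain ⟨k', hk'⟩ := Nat.exists_eq_succ_of_ne_zero hk
      rw [hk']
      simp [Nat.choose_succ_succ, add_comm]
  · have hi' : i = Fin.last N := Fin.ext (by simp; omega)
    subst hi'
    rw [Fin.last_add_one]
    by_cases hk : (k : ℕ) = 0
    · simp [hk]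
    · obtain ⟨k', hk'⟩ := Nat.exists_eq_succ_of_ne_zero hk
      simp only [hk', Fin.val_last]
      simp [Nat.choose_succ_succ]

theorem minorIdeal_cyclicShift_le {C X : Type*} [Fintype C] [Fintype X] {N : ℕ}
    (J : Matrix C X R[X]) (l : ℕ) :
    minorIdeal (blockEval (cyclicShift R N) J) l ≤ minorIdeal (blockEval (binomialShift R N) J) l :=
      by
  refine minorIdeal_blockEval_le_of_conj (pascalMatrix R N) (pascalMatrix R N)⁻¹ _ _ ?_
    (pascalMatrix_mul_binomialShift N) J l
  exact Matrix.mul_nonsing_inv _ (by rw [det_pascalMatrix]; exact isUnit_one)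

theorem binomialShift_zero_column (N : ℕ) (i : Fin (N + 1)) :
    binomialShift R N i 0 = if i = 0 then 1 else 0 := by
  simp [binomialShift, eq_comm]

theorem binomialShift_diag {N : ℕ} (h : ∀ j, 0 < j → j < N + 1 → ((N + 1).choose j : R) = 0)
    (i : Fin (N + 1)) : binomialShift R N i i = 1 := by
  simp only [binomialShift, Matrix.of_apply, if_true]
  split_ifs with h1 h2 h3
  · simp
  · rw [h _ (Nat.pos_of_ne_zero h2) i.2]; simp
  · omega
  · simp

theorem binomialShift_lower {N : ℕ} (h : ∀ j, 0 < j → j < N + 1 → ((N + 1).choose j : R) = 0)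
    (i j : Fin (N + 1)) (hij : j < i) : binomialShift R N i j = 0 := by
  have h' : (j : ℕ) < i := hij
  simp only [binomialShift, Matrix.of_apply, if_neg hij.ne]
  split_ifs with h1 h2 h3
  · simp
  · rw [h _ (Nat.pos_of_ne_zero h2) j.2]; simp
  · omega
  · simp

theorem choose_prime_pow_cast_eq_zero (p r : ℕ) (hp : p.Prime) [CharP R p] {j : ℕ} (hj : 0 < j)
    (hj' : j < p ^ r) : ((p ^ r).choose j : R) = 0 := by
  rw [CharP.cast_eq_zero_iff R p]
  exact hp.dvd_choose_pow hj.ne' hj'.ne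

/-- The elementary ideals of a block circulant matrix are contained in those of the matrix of the
sums of the blocks. -/
theorem matrixElementaryIdeal_circulant_le {C X : Type*} [Fintype C] [Fintype X] {N : ℕ}
    (hcard : Fintype.card C ≤ Fintype.card X) (a : C → X → Fin (N + 1) → R) (ℓ : ℕ) :
    matrixElementaryIdeal
      (Matrix.of fun (b : C × Fin (N + 1)) (b' : X × Fin (N + 1)) => a b.1 b'.1 (b'.2 - b.2)) ℓ ≤
      matrixElementaryIdeal (Matrix.of fun c x => ∑ d, a c x d) ℓ := by
  rw [← blockEval_circulantPoly, ← circulantPoly_map_eval_one]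
  refine le_trans (minorIdeal_cyclicShift_le (circulantPoly a) _) ?_
  refine (matrixElementaryIdeal_blockEval_le hcard _ (binomialShift_zero_column N) _ ℓ).trans ?_
  -- Only the factor of the block at `1` is kept.
  rw [mul_comm]
  exact Ideal.mul_le_left

theorem matrixElementaryIdeal_circulant_le_pow {C X : Type*} [Fintype C] [Fintype X] {N : ℕ}
    (hcard : Fintype.card C ≤ Fintype.card X) (a : C → X → Fin (N + 1) → R) (p r : ℕ)
    (hp : p.Prime) [CharP R p] (hN : N + 1 = p ^ r) (ℓ : ℕ) :
    matrixElementaryIdeal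
      (Matrix.of fun (b : C × Fin (N + 1)) (b' : X × Fin (N + 1)) => a b.1 b'.1 (b'.2 - b.2)) ℓ ≤
      matrixElementaryIdeal (Matrix.of fun c x => ∑ d, a c x d) ℓ ^ (N + 1) := by
  have h : ∀ j, 0 < j → j < N + 1 → ((N + 1).choose j : R) = 0 := fun j hj hj' => by
    rw [hN] at hj' ⊢
    exact choose_prime_pow_cast_eq_zero p r hp hj hj'
  rw [← blockEval_circulantPoly, ← circulantPoly_map_eval_one]
  refine le_trans (minorIdeal_cyclicShift_le (circulantPoly a) _) ?_
  exact matrixElementaryIdeal_blockEval_le_pow hcard _ (binomialShift_diag h)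
    (binomialShift_lower h) _ ℓ

end Circulant

/-! ### Adjugates of block triangular matrices and first minors -/

section Adjugate

open Polynomial

variable {R : Type*} [CommRing R]

/-- The product of the block matrix with either side is its determinant times the identity. A matrix
whose determinant is regular can be cancelled. -/
theorem adjugate_fromBlocks_zero₁₂_of_regular {m n : Type*} [Fintype m] [DecidableEq m] [Fintype n]
    [DecidableEq n] (D : Matrix m m R) (Z : Matrix n m R) (A : Matrix n n R)
    (hD : IsLeftRegular D.det) (hA : IsLeftRegular A.det) :
    (Matrix.fromBlocks D 0 Z A).adjugate =
      Matrix.fromBlocks (A.det • D.adjugate) 0 (-(A.adjugate * Z * D.adjugate))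
        (D.det • A.adjugate) := by
  have hdet : IsLeftRegular (Matrix.fromBlocks D 0 Z A).det := by
    rw [Matrix.det_fromBlocks_zero₁₂]
    exact hD.mul hA
  refine (Matrix.isRegular_of_isLeftRegular_det hdet).left ?_
  change _ * _ = _ * _
  rw [Matrix.mul_adjugate, Matrix.det_fromBlocks_zero₁₂, Matrix.fromBlocks_multiply,
    ← Matrix.fromBlocks_one, Matrix.fromBlocks_smul]
  congr 1
  · simp [Matrix.mul_adjugate, smul_smul, mul_comm]
  · simp
  · rw [Matrix.mul_neg, ← Matrix.mul_assoc, ← Matrix.mul_assoc, Matrix.mul_adjugate]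
    simp
  · simp [Matrix.mul_adjugate, smul_smul]

/-- The matrix `M + X`, whose determinant is monic up to the order of its terms. -/
noncomputable def addX {k : Type*} [DecidableEq k] (M : Matrix k k R) : Matrix k k R[X] :=
  (Polynomial.X : R[X]) • (1 : Matrix k k R[X]) + M.map Polynomial.C

theorem isLeftRegular_det_addX {k : Type*} [Fintype k] [DecidableEq k] (M : Matrix k k R) :
    IsLeftRegular (addX M).det := by
  refine (Polynomial.Monic.isRegular ?_).left
  exact Polynomial.leadingCoeff_det_X_one_add_C M

theorem addX_map_eval_zero {k : Type*} [DecidableEq k] (M : Matrix k k R) :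
    (addX M).map (evalRingHom 0) = M := by
  ext i j
  simp [addX]

/-- Regularity is not needed: adding the indeterminate to the diagonal blocks makes their
determinants monic, and the identity obtained over the polynomial ring specializes at zero. The
application below has `det A = 0`. -/
theorem adjugate_fromBlocks_zero₁₂ {m n : Type*} [Fintype m] [DecidableEq m] [Fintype n]
    [DecidableEq n] (D : Matrix m m R) (Z : Matrix n m R) (A : Matrix n n R) :
    (Matrix.fromBlocks D 0 Z A).adjugate =
      Matrix.fromBlocks (A.det • D.adjugate) 0 (-(A.adjugate * Z * D.adjugate))
        (D.det • A.adjugate) := by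
  have key := congrArg (fun M => M.map (evalRingHom (0 : R)))
    (adjugate_fromBlocks_zero₁₂_of_regular (addX D) (Z.map Polynomial.C) (addX A)
      (isLeftRegular_det_addX D) (isLeftRegular_det_addX A))
  have hadj : ∀ {k : Type _} [Fintype k] [DecidableEq k] (M : Matrix k k R),
      (addX M).adjugate.map (evalRingHom (0 : R)) = M.adjugate := fun {k} _ _ M => by
    rw [← RingHom.mapMatrix_apply, RingHom.map_adjugate, RingHom.mapMatrix_apply,
      addX_map_eval_zero]
  have hadj' : ∀ {k : Type _} [Fintype k] [DecidableEq k] (M : Matrix k k R),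
      (addX M).adjugate.map (evalRingHom (0 : R)) = M.adjugate := fun {k} _ _ M => by
    rw [← RingHom.mapMatrix_apply, RingHom.map_adjugate, RingHom.mapMatrix_apply,
      addX_map_eval_zero]
  have hdet : ∀ {k : Type _} [Fintype k] [DecidableEq k] (M : Matrix k k R),
      evalRingHom (0 : R) (addX M).det = M.det := fun {k} _ _ M => by
    rw [RingHom.map_det, RingHom.mapMatrix_apply, addX_map_eval_zero]
  have hdet' : ∀ {k : Type _} [Fintype k] [DecidableEq k] (M : Matrix k k R),
      evalRingHom (0 : R) (addX M).det = M.det := fun {k} _ _ M => by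
    rw [RingHom.map_det, RingHom.mapMatrix_apply, addX_map_eval_zero]
  have hZ : (Z.map Polynomial.C).map (evalRingHom (0 : R)) = Z := by
    ext i j
    simp
  have hL : (Matrix.fromBlocks (addX D) 0 (Z.map Polynomial.C) (addX A)).map (evalRingHom (0 : R)) =
      Matrix.fromBlocks D 0 Z A := by
    rw [Matrix.fromBlocks_map, addX_map_eval_zero, addX_map_eval_zero, hZ,
      Matrix.map_zero _ (map_zero _)]
  have h1 : ((addX A).det • (addX D).adjugate).map (evalRingHom (0 : R)) = A.det • D.adjugate := by
    rw [← hadj D, ← hdet' A]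
    ext i j
    simp
  have h2 : ((addX D).det • (addX A).adjugate).map (evalRingHom (0 : R)) = D.det • A.adjugate := by
    rw [← hadj' A, ← hdet D]
    ext i j
    simp
  have h3 : (-((addX A).adjugate * Z.map Polynomial.C * (addX D).adjugate)).map
      (evalRingHom (0 : R)) = -(A.adjugate * Z * D.adjugate) := by
    rw [← hadj D, ← hadj' A, ← hZ, ← Matrix.map_mul, ← Matrix.map_mul, hZ]
    ext i j
    simp
  rw [← RingHom.mapMatrix_apply, RingHom.map_adjugate, RingHom.mapMatrix_apply, hL,
    Matrix.fromBlocks_map, h1, h2, h3, Matrix.map_zero _ (map_zero _)] at key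
  exact key

theorem adjugate_mem_minorIdeal {n : Type*} [Fintype n] [DecidableEq n] (A : Matrix n n R)
    (i j : n) : A.adjugate i j ∈ minorIdeal A (Fintype.card n - 1) := by
  rw [Matrix.adjugate_apply]
  refine det_mem_of_rows _ (fun k => k ≠ j) _ fun g => ?_
  have : (A.updateRow j (Pi.single i 1)).submatrix (Subtype.val : {k // k ≠ j} → n) g =
      A.submatrix Subtype.val g := by
    ext a b
    simp [Matrix.updateRow_apply, a.2]
  rw [this]
  refine det_submatrix_mem_minorIdeal _ _ _ ?_
  rw [Fintype.card_subtype_compl, Fintype.card_subtype_eq]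

theorem det_updateCol_mem_minorIdeal {n : Type*} [Fintype n] [DecidableEq n] (A : Matrix n n R)
    (j : n) (v : n → R) : (A.updateCol j v).det ∈ minorIdeal A (Fintype.card n - 1) := by
  refine det_mem_of_columns _ (fun k => k ≠ j) _ fun g => ?_
  have : (A.updateCol j v).submatrix g (Subtype.val : {k // k ≠ j} → n) =
      A.submatrix g Subtype.val := by
    ext a b
    simp [b.2]
  rw [this]
  refine det_submatrix_mem_minorIdeal _ _ _ ?_
  rw [Fintype.card_subtype_compl, Fintype.card_subtype_eq]

theorem exists_perm_eq_succAbove_comp {k : ℕ} (f : Fin k → Fin (k + 1))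
    (hf : Function.Injective f) : ∃ (i : Fin (k + 1)) (σ : Equiv.Perm (Fin k)),
      f = i.succAbove ∘ σ := by
  have : ¬ Function.Surjective f := fun h => by
    have := Fintype.card_le_of_surjective f h
    simp at this
  rw [Function.Surjective] at this
  push Not at this
  obtain ⟨i, hi⟩ := this
  choose σ hσ using fun a => Fin.exists_succAbove_eq (hi a)
  have hσi : Function.Injective σ := fun a b hab => hf (by rw [← hσ, ← hσ, hab])
  exact ⟨i, Equiv.ofBijective σ (Finite.injective_iff_bijective.1 hσi), funext fun a => (hσ a).symm⟩

theorem minorIdeal_le_of_adjugate_fin {k : ℕ} (A : Matrix (Fin (k + 1)) (Fin (k + 1)) R)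
    (I : Ideal R) (h : ∀ i j, A.adjugate i j ∈ I) : minorIdeal A k ≤ I := by
  rw [minorIdeal_le_iff]
  intro f g
  by_cases hf : Function.Injective f
  swap
  · rw [Function.Injective] at hf
    push Not at hf
    obtain ⟨a, b, hab, hne⟩ := hf
    rw [Matrix.det_zero_of_row_eq hne]
    · exact Ideal.zero_mem _
    · funext j; simp [hab]
  by_cases hg : Function.Injective g
  swap
  · rw [Function.Injective] at hg
    push Not at hg
    obtain ⟨a, b, hab, hne⟩ := hg
    rw [Matrix.det_zero_of_column_eq hne]
    · exact Ideal.zero_mem _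
    · intro j; simp [hab]
  obtain ⟨i, σ, rfl⟩ := exists_perm_eq_succAbove_comp f hf
  obtain ⟨j, τ, rfl⟩ := exists_perm_eq_succAbove_comp g hg
  have h1 : A.submatrix (i.succAbove ∘ σ) (j.succAbove ∘ τ) =
      ((A.submatrix i.succAbove j.succAbove).submatrix σ id).submatrix id τ := rfl
  rw [h1, Matrix.det_permute', Matrix.det_permute]
  refine I.mul_mem_left _ (I.mul_mem_left _ ?_)
  have h2 := h j i
  rw [Matrix.adjugate_fin_succ_eq_det_submatrix] at h2
  have h3 := I.mul_mem_left ((-1) ^ (i + j : ℕ)) h2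
  rwa [← mul_assoc, ← pow_add, Even.neg_one_pow (Even.add_self _), one_mul] at h3

/-- Up to sign and order of rows and columns, every first minor without repeated indices is an entry
of the adjugate. -/
theorem minorIdeal_le_of_adjugate {n : Type*} [Fintype n] [DecidableEq n] [Nonempty n]
    (A : Matrix n n R) (I : Ideal R) (h : ∀ i j, A.adjugate i j ∈ I) :
    minorIdeal A (Fintype.card n - 1) ≤ I := by
  obtain ⟨k, hk⟩ := Nat.exists_eq_succ_of_ne_zero (Fintype.card_ne_zero (α := n))
  let e : Fin (k + 1) ≃ n := (Fintype.equivFinOfCardEq hk).symm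
  have h1 : minorIdeal A (Fintype.card n - 1) ≤ minorIdeal (A.submatrix e e) k := by
    have := minorIdeal_submatrix_le (A.submatrix e e) e.symm e.symm k
    rw [hk]
    simpa using this
  refine h1.trans (minorIdeal_le_of_adjugate_fin _ I fun i j => ?_)
  rw [Matrix.adjugate_submatrix_equiv_self]
  exact h _ _

theorem derivative_det {n : Type*} [Fintype n] [DecidableEq n] (M : Matrix n n R[X]) :
    derivative M.det = ∑ j, (M.updateCol j fun i => derivative (M i j)).det := by
  simp only [Matrix.det_apply, map_sum]
  rw [Finset.sum_comm]
  refine Finset.sum_congr rfl fun σ _ => ?_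
  rw [← Finset.smul_sum, Units.smul_def, Units.smul_def, map_zsmul, derivative_prod_finset]
  congr 1
  refine Finset.sum_congr rfl fun j _ => ?_
  rw [← Finset.mul_prod_erase _ _ (Finset.mem_univ j), mul_comm]
  congr 1
  · simp
  · refine Finset.prod_congr rfl fun i hi => ?_
    rw [Matrix.updateCol_ne (Finset.ne_of_mem_erase hi)]

/-- If the determinant of a matrix of polynomials vanishes at `1`, the quotient by `X - 1` has at
`1` a value in the ideal of the first minors. -/
theorem exists_det_eq_mul {n : Type*} [Fintype n] [DecidableEq n] (M : Matrix n n R[X])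
    (hM : (M.map (eval 1)).det = 0) : ∃ η : R[X], M.det = (X - 1) * η ∧
      η.eval 1 ∈ minorIdeal (M.map (eval 1)) (Fintype.card n - 1) := by
  have hmap : ∀ N : Matrix n n R[X], N.det.eval 1 = (N.map (eval 1)).det := fun N => by
    have := RingHom.map_det (evalRingHom (1 : R)) N
    rwa [RingHom.mapMatrix_apply, coe_evalRingHom] at this
  have h1 : M.det.IsRoot 1 := by rw [IsRoot, hmap, hM]
  obtain ⟨η, hη⟩ := dvd_iff_isRoot.2 h1
  rw [map_one] at hη
  refine ⟨η, hη, ?_⟩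
  -- Each term of the derivative of the determinant has a single column differentiated, and
  -- expansion along that column leaves first minors.
  have h2 : η.eval 1 = (derivative M.det).eval 1 := by
    rw [hη]; simp
  rw [h2, derivative_det, eval_finsetSum]
  refine Ideal.sum_mem _ fun j _ => ?_
  rw [hmap]
  have : (M.updateCol j fun i => derivative (M i j)).map (eval 1) =
      (M.map (eval 1)).updateCol j fun i => (derivative (M i j)).eval 1 := by
    ext a b
    simp only [Matrix.map_apply, Matrix.updateCol_apply]
    split_ifs <;> rfl
  rw [this]
  exact det_updateCol_mem_minorIdeal _ _ _

/-- The blocks commute with each other, being polynomials in `W`, so the determinant can be taken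
first over the polynomials and then over `R`. -/
theorem det_blockEval {n k : Type*} [Fintype n] [DecidableEq n] [Fintype k] [DecidableEq k]
    (W : Matrix k k R) (M : Matrix n n R[X]) : (blockEval W M).det = (aeval W M.det).det := by
  have := Matrix.det_det M (aeval W : R[X] →ₐ[R] Matrix k k R).toRingHom
  exact this.symm

/-- The matrix is of companion type, with ones above the diagonal and last row starting with `-(N +
1)`. The upper rows force a kernel vector to vanish in all coordinates but the first, and the last
row then kills the first. -/
theorem det_binomialShift_sub_one_ne_zero [IsDomain R] {N : ℕ} (hN : ((N + 1 : ℕ) : R) ≠ 0) :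
    ((binomialShift R N).submatrix Fin.succ Fin.succ - 1).det ≠ 0 := by
  intro h
  rw [← Matrix.exists_mulVec_eq_zero_iff] at h
  obtain ⟨v, hv, h⟩ := h
  apply hv
  have hentry : ∀ i j : Fin N, ((binomialShift R N).submatrix Fin.succ Fin.succ - 1) i j =
      if (i : ℕ) + 1 = N then -((N + 1).choose (j + 1) : R)
      else if (j : ℕ) = i + 1 then 1 else 0 := by
    intro i j
    have h1 : (if j.succ = i.succ then (1 : R) else 0) = (1 : Matrix (Fin N) (Fin N) R) i j := by
      simp [Matrix.one_apply, eq_comm]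
    simp only [binomialShift, Matrix.sub_apply, Matrix.submatrix_apply, Matrix.of_apply, h1]
    simp
  have hrow : ∀ i : Fin N, ∑ j,
    ((binomialShift R N).submatrix Fin.succ Fin.succ - 1) i j * v j = 0 :=
    fun i => congrFun h i
  have hpos : ∀ j : Fin N, 0 < (j : ℕ) → v j = 0 := by
    intro j hj
    have := hrow ⟨j - 1, by omega⟩
    rw [Finset.sum_eq_single j] at this
    · rw [hentry, if_neg (by simp; omega), if_pos (by simp; omega), one_mul] at this
      exact this
    · intro b _ hb
      rw [hentry, if_neg (by simp; omega), if_neg, zero_mul]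
      intro hb'
      exact hb (Fin.ext (by simp at hb'; omega))
    · simp
  funext j
  by_cases hj : 0 < (j : ℕ)
  · exact hpos j hj
  · have hj0 : (j : ℕ) = 0 := by omega
    have := hrow ⟨N - 1, by omega⟩
    rw [Finset.sum_eq_single j] at this
    · rw [hentry, if_pos (by simp; omega), hj0, zero_add, Nat.choose_one_right] at this
      rcases mul_eq_zero.1 this with h0 | h0
      · exact (hN (neg_eq_zero.1 h0)).elim
      · exact h0
    · intro b _ hb
      rw [hpos b, mul_zero]
      rw [Nat.pos_iff_ne_zero]
      intro hb'
      exact hb (Fin.ext (by omega))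
    · simp

end Adjugate
-- The first elementary divisor and its reduction modulo p
section FirstElementaryIdeal

open Polynomial

variable {R : Type*} [CommRing R]

/-- A left eigenvector of a matrix with first column `e₀` splits off the first row of its
polynomials, up to a determinant. -/
theorem exists_aeval_zero_row {N : ℕ} (W : Matrix (Fin (N + 1)) (Fin (N + 1)) R)
    (hW : ∀ i, W i 0 = if i = 0 then 1 else 0) : ∃ y : Fin N → R, ∀ (q : R[X]) (l : Fin N),
      (W.submatrix Fin.succ Fin.succ - 1).det * aeval W q 0 l.succ =
        q.eval 1 * y l - ∑ k, y k * aeval (W.submatrix Fin.succ Fin.succ) q k l := by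
  set S := W.submatrix Fin.succ Fin.succ - 1 with hS
  let z : Fin N → R := fun l => W 0 l.succ
  -- Chosen such that `y S = -(det S) z`. This makes `u` below, with entries `det S` and `y`, a left
  -- eigenvector of `W` for the eigenvalue `1`.
  let y : Fin N → R := -(Matrix.vecMul z S.adjugate)
  have hy : ∀ l, ∑ k, y k * S k l = -(S.det * z l) := fun l => by
    have h1 : Matrix.vecMul y S = -(S.det • z) := by
      simp only [y, Matrix.neg_vecMul, Matrix.vecMul_vecMul, Matrix.adjugate_mul,
        Matrix.vecMul_smul, Matrix.vecMul_one]
    exact congrFun h1 l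
  refine ⟨y, fun q l => ?_⟩
  let u : Fin (N + 1) → R := Fin.cons S.det y
  let T : Matrix Unit (Fin (N + 1)) R := Matrix.of fun _ j => u j
  have hT : T * W = (1 : Matrix Unit Unit R) * T := by
    ext ⟨⟩ j
    rw [Matrix.one_mul]
    refine Fin.cases ?_ (fun l => ?_) j
    · simp [T, Matrix.mul_apply, hW]
    · have h2 : ∀ k, W (Fin.succ k) l.succ = S k l + (1 : Matrix (Fin N) (Fin N) R) k l :=
        fun k => by simp [hS]
      simp only [T, u, Matrix.mul_apply, Matrix.of_apply, Fin.sum_univ_succ, Fin.cons_zero,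
        Fin.cons_succ, h2, mul_add, Finset.sum_add_distrib, hy]
      simp [z, Matrix.one_apply]
  have h2 := congrFun (congrFun (mul_aeval_of_intertwine T W 1 hT q) ()) l.succ
  have h3 : aeval (1 : Matrix Unit Unit R) q = algebraMap R _ (q.eval 1) := by
    rw [← map_one (algebraMap R (Matrix Unit Unit R)),
      aeval_algebraMap_apply_eq_algebraMap_eval]
  rw [h3] at h2
  simp only [T, u, Matrix.mul_apply, Matrix.of_apply, Fin.sum_univ_succ, Fin.cons_zero,
    Fin.cons_succ, aeval_succ_succ W hW, Matrix.algebraMap_eq_diagonal] at h2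
  simp at h2
  linear_combination h2

/-- This is an integral refinement of the inclusion for circulant matrices: besides `Δ`, it retains
the factor contributed by the complementary block, in a form that can be reduced modulo `p`. Here
`η` is the quotient of the determinant of the circulant polynomial matrix by `X - 1`. -/
theorem exists_firstElementaryIdeal_circulant_le [IsDomain R] {n : Type*} [Fintype n]
    [DecidableEq n]
    [Nonempty n] {N : ℕ} (hN : ((N + 1 : ℕ) : R) ≠ 0) (a : n → n → Fin (N + 1) → R)
    (hdet : (Matrix.of fun c x => ∑ d, a c x d).det = 0) :
    ∃ η : R[X], η.eval 1 ∈ matrixElementaryIdeal (Matrix.of fun c x => ∑ d, a c x d) 1 ∧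
      ∀ Δ : R, matrixElementaryIdeal (Matrix.of fun c x => ∑ d, a c x d) 1 ≤ Ideal.span {Δ} →
        matrixElementaryIdeal (Matrix.of fun (b : n × Fin (N + 1)) (b' : n × Fin (N + 1)) =>
          a b.1 b'.1 (b'.2 - b.2)) 1 ≤
        Ideal.span {Δ * (aeval ((binomialShift R N).submatrix Fin.succ Fin.succ) η).det} := by
  rw [← blockEval_circulantPoly, ← circulantPoly_map_eval_one] at *
  set J := circulantPoly a with hJ
  set A := J.map (eval 1) with hA
  obtain ⟨η, hη, hη1⟩ := exists_det_eq_mul J hdet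
  refine ⟨η, hη1, fun Δ hΔ => ?_⟩
  refine le_trans (minorIdeal_cyclicShift_le J _) ?_
  set W := binomialShift R N with hWdef
  have hW : ∀ i, W i 0 = if i = 0 then 1 else 0 := binomialShift_zero_column N
  change matrixElementaryIdeal (blockEval W J) 1 ≤ _
  rw [← matrixElementaryIdeal_submatrix (blockEval W J) (splitEquiv n N) (splitEquiv n N),
    blockEval_split W hW]
  set C := W.submatrix Fin.succ Fin.succ with hC
  set D := blockEval C J with hD
  set Z : Matrix n (n × Fin N) R := Matrix.of fun c a => aeval W (J c a.1) 0 a.2.succ with hZ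
  set s := (C - 1).det with hs
  have hs0 : s ≠ 0 := det_binomialShift_sub_one_ne_zero hN
  have hDdet : D.det = s * (aeval C η).det := by
    rw [hD, det_blockEval, hη, map_mul, Matrix.det_mul, map_sub, aeval_X, map_one]
  obtain ⟨y, hy⟩ := exists_aeval_zero_row W hW
  let Y : Matrix n (n × Fin N) R := Matrix.of fun c b => if c = b.1 then y b.2 else 0
  -- Up to the factor `s` the off-diagonal block is a coboundary: over a ring with `s` invertible,
  -- the matrix would be conjugate to a block diagonal one.
  have hsZ : s • Z = A * Y - Y * D := by
    ext c ⟨x, l⟩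
    have h1 : (A * Y) c (x, l) = (J c x).eval 1 * y l := by
      simp [Matrix.mul_apply, Y, hA]
    have h2 : (Y * D) c (x, l) = ∑ k, y k * aeval C (J c x) k l := by
      rw [Matrix.mul_apply, Fintype.sum_prod_type, Finset.sum_eq_single c]
      · simp [Y, hD, blockEval]
      · intro b _ hb
        simp [Y, hb.symm]
      · simp
    rw [Matrix.sub_apply, h1, h2, Matrix.smul_apply, smul_eq_mul]
    exact hy (J c x) l
  have hadjA : ∀ i j, A.adjugate i j ∈ Ideal.span {Δ} := fun i j =>
    hΔ (adjugate_mem_minorIdeal A i j)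
  -- The term with `A * Y` drops out because `A.adjugate * A = det A = 0`.
  have hkey : s • (A.adjugate * Z * D.adjugate) = -(D.det • (A.adjugate * Y)) := by
    have h1 : s • (A.adjugate * Z * D.adjugate) = A.adjugate * (s • Z) * D.adjugate := by
      rw [Matrix.mul_smul, Matrix.smul_mul]
    rw [h1, hsZ, Matrix.mul_sub, ← Matrix.mul_assoc, Matrix.adjugate_mul, hdet, zero_smul,
      Matrix.zero_mul, zero_sub, Matrix.neg_mul, Matrix.mul_assoc, Matrix.mul_assoc,
      Matrix.mul_adjugate, Matrix.mul_smul, Matrix.mul_one, Matrix.mul_smul]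
  refine minorIdeal_le_of_adjugate _ _ fun i j => ?_
  rw [adjugate_fromBlocks_zero₁₂, hdet, zero_smul]
  rcases i with i | i <;> rcases j with j | j
  · exact Ideal.zero_mem _
  · exact Ideal.zero_mem _
  · change -((A.adjugate * Z * D.adjugate) i j) ∈ _
    rw [neg_mem_iff]
    have h1 : s * (A.adjugate * Z * D.adjugate) i j = -(D.det * (A.adjugate * Y) i j) :=
      congrFun (congrFun hkey i) j
    have h2 : (A.adjugate * Y) i j ∈ Ideal.span {Δ} := by
      rw [Matrix.mul_apply]
      exact Ideal.sum_mem _ fun k _ => Ideal.mul_mem_right _ _ (hadjA i k)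
    obtain ⟨t, ht⟩ := Ideal.mem_span_singleton.1 h2
    rw [Ideal.mem_span_singleton]
    -- The determinant of `D` contains the same factor `s`, so it cancels in the domain `R` and does
    -- not spoil the divisibility.
    refine ⟨-t, mul_left_cancel₀ hs0 ?_⟩
    rw [h1, ht, hDdet]
    ring
  · change D.det * A.adjugate i j ∈ _
    rw [hDdet, Ideal.mem_span_singleton]
    obtain ⟨t, ht⟩ := Ideal.mem_span_singleton.1 (hadjA i j)
    exact ⟨s * t, by rw [ht]; ring⟩

theorem map_aeval_matrix {S k : Type*} [CommRing S] [Fintype k] [DecidableEq k] (φ : R →+* S)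
    (W : Matrix k k R) (q : R[X]) : (aeval W q).map φ = aeval (W.map φ) (q.map φ) := by
  change φ.mapMatrix (aeval W q) = aeval (φ.mapMatrix W) (q.map φ)
  rw [aeval_def, hom_eval₂, aeval_def, eval₂_map]
  congr 1
  ext r : 1
  ext i j
  by_cases h : i = j
  · subst h; simp [Matrix.algebraMap_eq_diagonal]
  · simp [Matrix.algebraMap_eq_diagonal, h]

/-- Reduction to characteristic `p` of the determinant of a polynomial in the binomial shift. -/
theorem map_det_aeval_binomialShift {S : Type*} [CommRing S] (φ : R →+* S) (p r : ℕ) (hp : p.Prime)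
    [CharP S p] {N : ℕ} (hN : N + 1 = p ^ r) (η : R[X]) :
    φ (aeval ((binomialShift R N).submatrix Fin.succ Fin.succ) η).det = φ (η.eval 1) ^ N := by
  have h : ∀ j, 0 < j → j < N + 1 → ((N + 1).choose j : S) = 0 := fun j hj hj' => by
    rw [hN] at hj' ⊢
    exact choose_prime_pow_cast_eq_zero p r hp hj hj'
  have hmap : (binomialShift R N).map φ = binomialShift S N := by
    ext i j
    simp only [binomialShift, Matrix.map_apply, Matrix.of_apply, map_add]
    congr 1
    · split_ifs <;> simp
    · split_ifs <;> simp
  rw [RingHom.map_det, RingHom.mapMatrix_apply, map_aeval_matrix, ← Matrix.submatrix_map, hmap,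
    det_aeval_of_unitriangular ((binomialShift S N).submatrix Fin.succ Fin.succ)
      (fun i => binomialShift_diag h _)
      (fun i j hij => binomialShift_lower h _ _ (Fin.succ_lt_succ_iff.2 hij))]
  congr 1
  have := eval_map_apply (f := φ) (p := η) 1
  rwa [map_one] at this

theorem idealGcd_dvd_of_le [IsDomain R] [IsNoetherianRing R] [UniqueFactorizationMonoid R]
    {I : Ideal R} {c : R} (h : I ≤ Ideal.span {c}) : c ∣ idealGcd I :=
  Ideal.span_singleton_le_span_singleton.1 ((isIdealGcd_idealGcd I).2 c h)

theorem idealGcd_pow_dvd_of_le_pow [IsDomain R] [IsNoetherianRing R] [UniqueFactorizationMonoid R]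
    {I J : Ideal R} {k : ℕ} (h : I ≤ J ^ k) : idealGcd J ^ k ∣ idealGcd I := by
  refine idealGcd_dvd_of_le (h.trans ?_)
  rw [← Ideal.span_singleton_pow]
  exact Ideal.pow_right_mono (isIdealGcd_idealGcd J).1 k

theorem idealGcd_dvd_idealGcd [IsDomain R] [IsNoetherianRing R] [UniqueFactorizationMonoid R]
    {I J : Ideal R} (h : I ≤ J) : idealGcd J ∣ idealGcd I :=
  idealGcd_dvd_of_le (h.trans (isIdealGcd_idealGcd J).1)

/-- The divisibility of the reductions of the first elementary divisors of a block circulant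
matrix and of the matrix of the sums of its blocks. -/
theorem map_idealGcd_circulant_pow_dvd [IsDomain R] [IsNoetherianRing R]
    [UniqueFactorizationMonoid R]
    {S : Type*} [CommRing S] (φ : R →+* S) (p r : ℕ) (hp : p.Prime) [CharP S p]
    {n : Type*} [Fintype n] [DecidableEq n] [Nonempty n] {N : ℕ} (hN : N + 1 = p ^ r)
    (hN0 : ((N + 1 : ℕ) : R) ≠ 0) (a : n → n → Fin (N + 1) → R)
    (hdet : (Matrix.of fun c x => ∑ d, a c x d).det = 0) :
    φ (idealGcd (matrixElementaryIdeal (Matrix.of fun c x => ∑ d, a c x d) 1)) ^ (N + 1) ∣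
      φ (idealGcd (matrixElementaryIdeal (Matrix.of fun (b : n × Fin (N + 1))
        (b' : n × Fin (N + 1)) => a b.1 b'.1 (b'.2 - b.2)) 1)) := by
  obtain ⟨η, hη, h⟩ := exists_firstElementaryIdeal_circulant_le hN0 a hdet
  have hle := (isIdealGcd_idealGcd
    (matrixElementaryIdeal (Matrix.of fun c x => ∑ d, a c x d) 1)).1
  obtain ⟨t, ht⟩ := Ideal.mem_span_singleton.1 (hle hη)
  refine dvd_trans ?_ (map_dvd φ (idealGcd_dvd_of_le (h _ hle)))
  -- One factor comes from the block at `1`, and `N` factors come from the image of `η(1) ^ N`.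
  rw [map_mul, map_det_aeval_binomialShift φ p r hp hN, ht, map_mul, mul_pow, ← mul_assoc,
    ← pow_succ']
  exact dvd_mul_right _ _

end FirstElementaryIdeal
-- Fox calculus: the Jacobian presents the Alexander module
section Metabelian

variable {G : Type*} [Group G]

theorem commutatorClass_mul (x : G) (c d : commutator G) :
    commutatorClass x (c * d) = commutatorClass x c + commutatorClass x d := rfl

theorem commutatorClass_one (x : G) : commutatorClass x (1 : commutator G) = 0 := rfl

theorem commutatorClass_surjective (x : G) : Function.Surjective (commutatorClass x) := by
  intro a
  obtain ⟨c, hc⟩ := QuotientGroup.mk_surjective (Additive.toMul a : Abelianization (commutator G))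
  exact ⟨c, congrArg Additive.ofMul hc⟩

theorem T_smul_commutatorClass (x : G) (n : ℤ) (c : commutator G) :
    (LaurentPolynomial.T n : ℤ[T;T⁻¹]) • commutatorClass x c =
      commutatorClass x (MulAut.conjNormal (H := commutator G) (x ^ n) c) := by
  induction n using Int.induction_on generalizing c with
  | zero => simp
  | succ n ih =>
    rw [LaurentPolynomial.T_add, mul_smul, T_one_smul_commutatorClass, ih]
    congr 1
    rw [zpow_add, zpow_one, map_mul, MulAut.mul_apply]
  | pred n ih =>
    have h : commutatorClass x c = (LaurentPolynomial.T 1 : ℤ[T;T⁻¹]) •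
        commutatorClass x (MulAut.conjNormal (H := commutator G) x⁻¹ c) := by
      rw [T_one_smul_commutatorClass, ← MulAut.mul_apply, ← map_mul, mul_inv_cancel, map_one,
        MulAut.one_apply]
    rw [h, ← mul_smul, ← LaurentPolynomial.T_add, sub_add_cancel, ih]
    congr 1
    rw [← MulAut.mul_apply, ← map_mul, zpow_sub, zpow_one]

end Metabelian

namespace VirtualKnotDiagram

section AlexanderModule

variable (K : VirtualKnotDiagram)

open LaurentPolynomial

theorem sign_eq (c : K.Crossing) : K.sign c = 1 ∨ K.sign c = -1 := by
  rw [sign]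
  split_ifs <;> simp

theorem sum_jacobian (c : K.Crossing) : ∑ x, K.jacobian c x = 0 := by
  simp [jacobian, Finset.sum_add_distrib, Finset.sum_sub_distrib]

/-- The Wirtinger relation of a crossing in the knot group. -/
theorem of_arcOut (c : K.Crossing) : (PresentedGroup.of (K.arcOut c) : K.KnotGroup) =
    PresentedGroup.of (K.arcOver c) ^ (-K.sign c) * PresentedGroup.of (K.arcIn c) *
      PresentedGroup.of (K.arcOver c) ^ K.sign c := by
  have h : (PresentedGroup.mk (Set.range K.relator)) (K.relator c) = 1 :=
    PresentedGroup.one_of_mem ⟨c, rfl⟩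
  rw [relator, map_mul, map_inv, mul_inv_eq_one, map_mul, map_mul, map_zpow, map_zpow] at h
  exact h.symm

/-- The homomorphism from the knot group to `ℤ` that maps every meridian to `1`. -/
noncomputable def degreeHom : K.KnotGroup →* Multiplicative ℤ :=
  PresentedGroup.toGroup (f := fun _ => Multiplicative.ofAdd 1) (by
    rintro _ ⟨c, rfl⟩
    simp [relator])

/-- The degree of an element of the knot group. -/
noncomputable def degree (g : K.KnotGroup) : ℤ := Multiplicative.toAdd (K.degreeHom g)

theorem degree_of (x : K.Arc) : K.degree (PresentedGroup.of x) = 1 := by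
  simp [degree, degreeHom]

theorem degree_mul (g h : K.KnotGroup) : K.degree (g * h) = K.degree g + K.degree h := by
  simp [degree]

theorem degree_one : K.degree 1 = 0 := by simp [degree]

theorem degree_inv (g : K.KnotGroup) : K.degree g⁻¹ = -K.degree g := by simp [degree]

theorem degree_zpow (g : K.KnotGroup) (n : ℤ) : K.degree (g ^ n) = n * K.degree g := by
  simp [degree]

theorem degree_meridian : K.degree K.meridian = 1 := K.degree_of _

theorem degree_commutator (c : commutator K.KnotGroup) : K.degree c = 0 := by
  have := Abelianization.commutator_subset_ker K.degreeHom c.2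
  rw [MonoidHom.mem_ker] at this
  rw [degree, this]
  rfl

/-- All arcs of the diagram are connected by undercrossings. -/
noncomputable def ArcsConnected : Prop :=
  ∀ S : Set K.Arc, S.Nonempty → (∀ c, K.arcIn c ∈ S → K.arcOut c ∈ S) → ∀ x, x ∈ S

variable {K}

/-- The two generators of arcs that meet at an undercrossing are conjugate. Connectedness then makes
all meridians equal in the abelianization, which is therefore generated by one of them, and the
degree detects its powers. -/
theorem mem_commutator_of_degree (hK : K.ArcsConnected) (g : K.KnotGroup) (hg : K.degree g = 0) :
    g ∈ commutator K.KnotGroup := by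
  have key : (Abelianization.of : K.KnotGroup →* Abelianization K.KnotGroup) =
      (zpowersHom _ (Abelianization.of K.meridian)).comp K.degreeHom := by
    refine PresentedGroup.ext fun x => ?_
    have hx : K.degreeHom (PresentedGroup.of x) = Multiplicative.ofAdd 1 := K.degree_of x
    rw [MonoidHom.comp_apply, hx, zpowersHom_apply, toAdd_ofAdd, zpow_one]
    refine hK {x | Abelianization.of (PresentedGroup.of x : K.KnotGroup) =
      Abelianization.of K.meridian} ⟨K.arcFrom 0, rfl⟩ (fun c hc => ?_) x
    change Abelianization.of _ = _
    rw [K.of_arcOut, map_mul, map_mul, map_zpow, map_zpow, mul_comm (_ ^ _), mul_assoc, ← zpow_add,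
      neg_add_cancel, zpow_zero, mul_one]
    exact hc
  rw [← Abelianization.ker_of, MonoidHom.mem_ker, key, MonoidHom.comp_apply]
  have : K.degreeHom g = 1 := hg
  rw [this, map_one]

/-- The element of the commutator subgroup obtained by dividing by a power of the meridian. -/
noncomputable def normalize (hK : K.ArcsConnected) (g : K.KnotGroup) : commutator K.KnotGroup :=
  ⟨g * K.meridian ^ (-K.degree g), mem_commutator_of_degree hK _ (by
    rw [degree_mul, degree_zpow, degree_meridian]; ring)⟩

/-- The universal crossed homomorphism to the Alexander module that vanishes at the meridian. -/
noncomputable def crossedHom (hK : K.ArcsConnected) (g : K.KnotGroup) : K.AlexanderModule :=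
  commutatorClass K.meridian (normalize hK g)

/-- With `m` the meridian and `a`, `b` the degrees of `g`, `h`, this is the factorization of `g h
m^(-a-b)` into `g m^(-a)` and the conjugate of `h m^(-b)` by `m^a`. -/
theorem crossedHom_mul (hK : K.ArcsConnected) (g h : K.KnotGroup) :
    crossedHom hK (g * h) = crossedHom hK g + (T (K.degree g) : ℤ[T;T⁻¹]) • crossedHom hK h := by
  rw [crossedHom, crossedHom, crossedHom, T_smul_commutatorClass, ← commutatorClass_mul]
  congr 1
  ext
  simp only [normalize, Subgroup.coe_mul, MulAut.conjNormal_apply, degree_mul]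
  group

theorem crossedHom_one (hK : K.ArcsConnected) : crossedHom hK 1 = 0 := by
  rw [crossedHom, ← commutatorClass_one K.meridian]
  congr 1

theorem crossedHom_inv (hK : K.ArcsConnected) (g : K.KnotGroup) :
    crossedHom hK g⁻¹ = -((T (-K.degree g) : ℤ[T;T⁻¹]) • crossedHom hK g) := by
  have h := crossedHom_mul hK g⁻¹ g
  rw [inv_mul_cancel, crossedHom_one, degree_inv] at h
  exact eq_neg_of_add_eq_zero_left h.symm

theorem crossedHom_meridian (hK : K.ArcsConnected) : crossedHom hK K.meridian = 0 := by
  rw [crossedHom, ← commutatorClass_one K.meridian]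
  congr 1
  ext
  simp [normalize, degree_meridian]

theorem crossedHom_commutator (hK : K.ArcsConnected) (c : commutator K.KnotGroup) :
    crossedHom hK c = commutatorClass K.meridian c := by
  rw [crossedHom]
  congr 1
  ext
  simp [normalize, degree_commutator]

theorem crossedHom_relation (hK : K.ArcsConnected) (c : K.Crossing) :
    (T (-K.sign c) : ℤ[T;T⁻¹]) • crossedHom hK (PresentedGroup.of (K.arcIn c)) -
      crossedHom hK (PresentedGroup.of (K.arcOut c)) +
      (1 - T (-K.sign c) : ℤ[T;T⁻¹]) • crossedHom hK (PresentedGroup.of (K.arcOver c)) = 0 := by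
  rw [K.of_arcOut]
  rcases K.sign_eq c with h | h <;> rw [h]
  · simp only [zpow_neg, zpow_one, crossedHom_mul, crossedHom_inv, degree_mul, degree_inv,
    degree_of,
      neg_add_cancel, T_zero, one_smul, sub_smul]
    abel
  · simp only [neg_neg, zpow_neg, zpow_one, crossedHom_mul, crossedHom_inv, degree_mul, degree_of,
      sub_smul, one_smul, smul_neg, ← mul_smul, ← T_add]
    norm_num
    abel

/-- The coordinate vectors in the cokernel of the Jacobian matrix. -/
noncomputable def jacobianCokernelClass (x : K.Arc) :
    (K.Arc → ℤ[T;T⁻¹]) ⧸ Submodule.span ℤ[T;T⁻¹] (Set.range fun c => K.jacobian c) :=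
  Submodule.Quotient.mk (Pi.single x 1)

theorem jacobianCokernel_relation (c : K.Crossing) :
    (T (-K.sign c) : ℤ[T;T⁻¹]) • jacobianCokernelClass (K.arcIn c) -
      jacobianCokernelClass (K.arcOut c) +
      (1 - T (-K.sign c) : ℤ[T;T⁻¹]) • jacobianCokernelClass (K.arcOver c) = 0 := by
  have h : (Submodule.Quotient.mk (K.jacobian c) : (K.Arc → ℤ[T;T⁻¹]) ⧸
      Submodule.span ℤ[T;T⁻¹] (Set.range fun c => K.jacobian c)) = 0 :=
    (Submodule.Quotient.mk_eq_zero _).2 (Submodule.subset_span ⟨c, rfl⟩)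
  have h2 : K.jacobian c = (T (-K.sign c) : ℤ[T;T⁻¹]) • Pi.single (K.arcIn c) (1 : ℤ[T;T⁻¹]) -
      Pi.single (K.arcOut c) 1 + (1 - T (-K.sign c) : ℤ[T;T⁻¹]) • Pi.single (K.arcOver c) 1 := by
    simp only [jacobian, ← Pi.single_smul, smul_eq_mul, mul_one]
  rw [← h, h2]
  rfl

/-- The affine automorphism of the cokernel of the Jacobian matrix given by a generator. -/
noncomputable def foxPerm (x : K.Arc) : Equiv.Perm ((K.Arc → ℤ[T;T⁻¹]) ⧸
    Submodule.span ℤ[T;T⁻¹] (Set.range fun c => K.jacobian c)) where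
  toFun v := (T 1 : ℤ[T;T⁻¹]) • v + jacobianCokernelClass x
  invFun v := (T (-1) : ℤ[T;T⁻¹]) • (v - jacobianCokernelClass x)
  left_inv v := by simp only [add_sub_cancel_right, ← mul_smul, ← T_add]; simp
  right_inv v := by simp only [← mul_smul, ← T_add]; simp

theorem foxPerm_apply (x : K.Arc) (v) :
    foxPerm x v = (T 1 : ℤ[T;T⁻¹]) • v + jacobianCokernelClass x := rfl

/-- The Fox calculus as an affine action of the knot group on the cokernel of the Jacobian
matrix. -/
noncomputable def foxHom : K.KnotGroup →* Equiv.Perm ((K.Arc → ℤ[T;T⁻¹]) ⧸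
    Submodule.span ℤ[T;T⁻¹] (Set.range fun c => K.jacobian c)) :=
  PresentedGroup.toGroup (f := foxPerm) (by
    rintro _ ⟨c, rfl⟩
    have hrel := jacobianCokernel_relation c
    simp only [relator, map_mul, map_zpow, map_inv, FreeGroup.lift_apply_of]
    rw [mul_inv_eq_one]
    rcases K.sign_eq c with h | h <;> rw [h] at hrel ⊢
    · rw [zpow_neg, zpow_one, mul_assoc, inv_mul_eq_iff_eq_mul]
      ext v : 1
      -- For a positive crossing the group relation has been rewritten without inverses, which
      -- corresponds to multiplying the row of the Jacobian by `t`.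
      have h2 := congrArg (fun w => (T 1 : ℤ[T;T⁻¹]) • w) hrel
      simp only [smul_add, smul_sub, sub_smul, one_smul, ← mul_smul, ← T_add, smul_zero] at h2
      simp only [add_neg_cancel, T_zero, one_smul] at h2
      simp only [Equiv.Perm.mul_apply, foxPerm_apply, smul_add, ← mul_smul, ← T_add]
      rw [← sub_eq_zero, ← h2]
      abel
    · rw [neg_neg, zpow_neg, zpow_one, mul_inv_eq_iff_eq_mul]
      ext v : 1
      simp only [neg_neg, sub_smul, one_smul] at hrel
      simp only [Equiv.Perm.mul_apply, foxPerm_apply, smul_add, ← mul_smul, ← T_add]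
      rw [← sub_eq_zero, ← hrel]
      abel)

/-- The Fox derivative. -/
noncomputable def foxDeriv (g : K.KnotGroup) : (K.Arc → ℤ[T;T⁻¹]) ⧸
    Submodule.span ℤ[T;T⁻¹] (Set.range fun c => K.jacobian c) := foxHom g 0

/-- Generators act by affine maps with linear part `t`, so `g` acts with linear part `t ^ degree g`;
the translation part is the Fox derivative. -/
theorem foxHom_apply (g : K.KnotGroup) (v) :
    foxHom g v = (T (K.degree g) : ℤ[T;T⁻¹]) • v + foxDeriv g := by
  have hg : g ∈ Subgroup.closure (Set.range (PresentedGroup.of (rels := Set.range K.relator))) := by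
    rw [PresentedGroup.closure_range_of]; trivial
  induction hg using Subgroup.closure_induction generalizing v with
  | mem g hg =>
    obtain ⟨x, rfl⟩ := hg
    simp only [foxDeriv, foxHom, PresentedGroup.toGroup.of, foxPerm_apply, degree_of, smul_zero,
      zero_add]
  | one => simp [foxDeriv, degree_one]
  | mul g h _ _ hg hh =>
    simp only [foxDeriv] at hg hh ⊢
    simp only [map_mul, Equiv.Perm.mul_apply]
    rw [hh, hg, hg (foxHom h 0), degree_mul, smul_add, ← mul_smul, ← T_add]
    abel
  | inv g _ hg =>
    have h1 : ∀ w, foxHom g⁻¹ w = (T (-K.degree g) : ℤ[T;T⁻¹]) • (w - foxDeriv g) := by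
      intro w
      have h2 : foxHom g (foxHom g⁻¹ w) = w := by
        rw [← Equiv.Perm.mul_apply, ← map_mul, mul_inv_cancel, map_one]; rfl
      rw [hg] at h2
      rw [← eq_sub_of_add_eq h2, ← mul_smul, ← T_add]
      simp
    rw [foxDeriv, h1, h1, degree_inv]
    simp only [smul_sub, smul_zero]
    abel

theorem foxDeriv_mul (g h : K.KnotGroup) :
    foxDeriv (g * h) = foxDeriv g + (T (K.degree g) : ℤ[T;T⁻¹]) • foxDeriv h := by
  rw [foxDeriv, map_mul, Equiv.Perm.mul_apply, foxHom_apply, add_comm]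
  rfl

theorem foxDeriv_one : foxDeriv (1 : K.KnotGroup) = 0 := by
  rw [foxDeriv, map_one]; rfl

theorem foxDeriv_inv (g : K.KnotGroup) :
    foxDeriv g⁻¹ = -((T (-K.degree g) : ℤ[T;T⁻¹]) • foxDeriv g) := by
  have h := foxDeriv_mul g⁻¹ g
  rw [inv_mul_cancel, foxDeriv_one, degree_inv] at h
  exact eq_neg_of_add_eq_zero_left h.symm

theorem foxDeriv_of (x : K.Arc) :
    foxDeriv (PresentedGroup.of x : K.KnotGroup) = jacobianCokernelClass x := by
  simp [foxDeriv, foxHom, PresentedGroup.toGroup.of, foxPerm_apply]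

/-- The Fox derivative on the Alexander module. -/
noncomputable def foxAddHom : K.AlexanderModule →+ (K.Arc → ℤ[T;T⁻¹]) ⧸
    Submodule.span ℤ[T;T⁻¹] (Set.range fun c => K.jacobian c) :=
  MonoidHom.toAdditiveLeft (Abelianization.lift
    ({ toFun := fun c => Multiplicative.ofAdd (foxDeriv (c : K.KnotGroup))
       map_one' := by rw [Subgroup.coe_one, foxDeriv_one]; rfl
       map_mul' := fun c d => by
        rw [Subgroup.coe_mul, foxDeriv_mul, degree_commutator, T_zero, one_smul]
        rfl } : commutator K.KnotGroup →* Multiplicative ((K.Arc → ℤ[T;T⁻¹]) ⧸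
    Submodule.span ℤ[T;T⁻¹] (Set.range fun c => K.jacobian c))))

theorem foxAddHom_commutatorClass (c : commutator K.KnotGroup) :
    foxAddHom (commutatorClass K.meridian c) = foxDeriv (c : K.KnotGroup) := rfl

/-- On degree zero elements, conjugation by `m ^ k` multiplies the Fox derivative by `t ^ k`, since
the contributions of `m ^ k` and of its inverse cancel. -/
theorem foxAddHom_smul (r : ℤ[T;T⁻¹]) (a : K.AlexanderModule) :
    foxAddHom (r • a) = r • foxAddHom a := by
  induction r using LaurentPolynomial.induction_on' with
  | add p q hp hq => rw [add_smul, map_add, hp, hq, add_smul]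
  | C_mul_T n k =>
    have hC : (C k : ℤ[T;T⁻¹]) = (k : ℤ[T;T⁻¹]) := by simp
    rw [hC, mul_smul, mul_smul, Int.cast_smul_eq_zsmul, Int.cast_smul_eq_zsmul, map_zsmul]
    congr 1
    obtain ⟨c, rfl⟩ := commutatorClass_surjective K.meridian a
    rw [T_smul_commutatorClass, foxAddHom_commutatorClass, foxAddHom_commutatorClass,
      MulAut.conjNormal_apply, foxDeriv_mul, foxDeriv_mul, degree_mul, degree_commutator, add_zero,
      foxDeriv_inv, degree_zpow, degree_meridian, mul_one, smul_neg, ← mul_smul, ← T_add]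
    simp

theorem foxAddHom_crossedHom_of (hK : K.ArcsConnected) (x : K.Arc) :
    foxAddHom (crossedHom hK (PresentedGroup.of x)) =
      jacobianCokernelClass x - jacobianCokernelClass (K.arcFrom 0) := by
  rw [crossedHom, foxAddHom_commutatorClass]
  simp only [normalize, degree_of, zpow_neg, zpow_one]
  rw [foxDeriv_mul, foxDeriv_inv, degree_of, degree_meridian, foxDeriv_of, meridian, foxDeriv_of,
    smul_neg, ← mul_smul, ← T_add]
  simp [sub_eq_add_neg]

theorem crossedHom_mem_span (hK : K.ArcsConnected) (g : K.KnotGroup) :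
    crossedHom hK g ∈ Submodule.span ℤ[T;T⁻¹]
      (Set.range fun x : K.Arc => crossedHom hK (PresentedGroup.of x)) := by
  have hg : g ∈ Subgroup.closure (Set.range (PresentedGroup.of (rels := Set.range K.relator))) := by
    rw [PresentedGroup.closure_range_of]; trivial
  induction hg using Subgroup.closure_induction with
  | mem g hg =>
    obtain ⟨x, rfl⟩ := hg
    exact Submodule.subset_span ⟨x, rfl⟩
  | one => rw [crossedHom_one]; exact Submodule.zero_mem _
  | mul g h _ _ hg hh =>
    rw [crossedHom_mul]
    exact Submodule.add_mem _ hg (Submodule.smul_mem _ _ hh)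
  | inv g _ hg =>
    rw [crossedHom_inv]
    exact Submodule.neg_mem _ (Submodule.smul_mem _ _ hg)

/-- The Jacobian matrix without the column of one arc presents the Alexander module. -/
theorem isPresentationMatrix_jacobian (hK : K.ArcsConnected) :
    IsPresentationMatrix (K.jacobian.submatrix id
      (Subtype.val : {x // x ≠ K.arcFrom 0} → K.Arc)) K.AlexanderModule := by
  let π : ({x // x ≠ K.arcFrom 0} → ℤ[T;T⁻¹]) →ₗ[ℤ[T;T⁻¹]] K.AlexanderModule :=
    Fintype.linearCombination ℤ[T;T⁻¹] fun x => crossedHom hK (PresentedGroup.of x.1)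
  have hπ : ∀ v, π v = ∑ x, v x • crossedHom hK (PresentedGroup.of x.1) := fun v => rfl
  refine ⟨π, ?_, ?_⟩
  · rw [← LinearMap.range_eq_top, eq_top_iff]
    intro a _
    obtain ⟨c, rfl⟩ := commutatorClass_surjective K.meridian a
    rw [← crossedHom_commutator hK]
    refine (Submodule.span_le.2 ?_) (crossedHom_mem_span hK _)
    rintro _ ⟨x, rfl⟩
    by_cases hx : x = K.arcFrom 0
    · have : crossedHom hK (PresentedGroup.of x) = 0 := by
        rw [hx]; exact crossedHom_meridian hK
      change crossedHom hK (PresentedGroup.of x) ∈ _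
      rw [this]
      exact Submodule.zero_mem _
    · refine ⟨Pi.single ⟨x, hx⟩ 1, ?_⟩
      rw [hπ, Finset.sum_eq_single ⟨x, hx⟩]
      · simp
      · intro b _ hb
        simp [hb]
      · simp
  · apply le_antisymm
    · intro v hv
      rw [LinearMap.mem_ker, hπ] at hv
      -- The Fox derivative turns a relation in the module into a combination of rows of the
      -- Jacobian. Forgetting the coordinate of the base arc gives back `v`.
      have h1 := congrArg foxAddHom hv
      rw [map_sum, map_zero] at h1
      simp only [foxAddHom_smul, foxAddHom_crossedHom_of] at h1
      have h2 : (∑ x : {x // x ≠ K.arcFrom 0}, v x • (Pi.single x.1 (1 : ℤ[T;T⁻¹]) -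
          Pi.single (K.arcFrom 0) 1 : K.Arc → ℤ[T;T⁻¹])) ∈
          Submodule.span ℤ[T;T⁻¹] (Set.range fun c => K.jacobian c) := by
        rw [← Submodule.ker_mkQ (Submodule.span ℤ[T;T⁻¹] (Set.range fun c => K.jacobian c)),
          LinearMap.mem_ker, map_sum]
        exact h1
      have h3 := Submodule.mem_map_of_mem (f := LinearMap.funLeft ℤ[T;T⁻¹] ℤ[T;T⁻¹]
        (Subtype.val : {x // x ≠ K.arcFrom 0} → K.Arc)) h2
      rw [Submodule.map_span, ← Set.range_comp] at h3
      suffices hv' : v = LinearMap.funLeft ℤ[T;T⁻¹] ℤ[T;T⁻¹]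
          (Subtype.val : {x // x ≠ K.arcFrom 0} → K.Arc) (∑ x : {x // x ≠ K.arcFrom 0},
          v x • (Pi.single x.1 (1 : ℤ[T;T⁻¹]) - Pi.single (K.arcFrom 0) 1 : K.Arc → ℤ[T;T⁻¹])) by
        rw [hv']; exact h3
      ext1 y
      simp only [LinearMap.funLeft_apply, Finset.sum_apply, Pi.smul_apply, Pi.sub_apply]
      rw [Finset.sum_eq_single y]
      · simp [y.2]
      · intro b _ hb
        have : y.1 ≠ b.1 := fun h => hb (Subtype.ext h.symm)
        simp [y.2, this]
      · simp
    · rw [Submodule.span_le]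
      rintro _ ⟨c, rfl⟩
      have h0 : ∑ x, K.jacobian c x • crossedHom hK (PresentedGroup.of x) = 0 := by
        rw [← crossedHom_relation hK c]
        simp only [jacobian, Pi.add_apply, Pi.sub_apply, add_smul, sub_smul, Finset.sum_add_distrib,
          Finset.sum_sub_distrib]
        have hs : ∀ (y : K.Arc) (r : ℤ[T;T⁻¹]), ∑ x, (Pi.single y r : K.Arc → ℤ[T;T⁻¹]) x •
            crossedHom hK (PresentedGroup.of x) = r • crossedHom hK (PresentedGroup.of y) := by
          intro y r
          rw [Finset.sum_eq_single y]
          · simp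
          · intro b _ hb
            simp [hb]
          · simp
        simp only [hs, sub_smul, one_smul]
      have h1 : ∑ x : {x // ¬ x ≠ K.arcFrom 0}, K.jacobian c x.1 •
          crossedHom hK (PresentedGroup.of x.1) = 0 := by
        refine Finset.sum_eq_zero fun x _ => ?_
        have : crossedHom hK (PresentedGroup.of x.1) = 0 := by
          rw [not_not.1 x.2]; exact crossedHom_meridian hK
        rw [this, smul_zero]
      rw [← Fintype.sum_subtype_add_sum_subtype (fun y => y ≠ K.arcFrom 0), h1, add_zero] at h0
      exact h0

instance : Finite K.Crossing := K.underPoints_finite.to_subtype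

theorem elementaryIdeal_alexanderModule (hK : K.ArcsConnected) (ℓ : ℕ) :
    elementaryIdeal ℤ[T;T⁻¹] K.AlexanderModule ℓ = matrixElementaryIdeal K.jacobian (ℓ + 1) := by
  rw [elementaryIdeal_eq_of_isPresentationMatrix _ (isPresentationMatrix_jacobian hK),
    matrixElementaryIdeal_delete_column _ K.sum_jacobian]

theorem elementaryIdeal_modP_alexanderModule (hK : K.ArcsConnected) (p ℓ : ℕ) :
    elementaryIdeal (ZMod p)[T;T⁻¹] (ModP p K.AlexanderModule) ℓ =
      matrixElementaryIdeal (K.jacobianMod p) (ℓ + 1) := by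
  have h := (isPresentationMatrix_jacobian hK).baseChange (ZMod p)[T;T⁻¹]
  rw [elementaryIdeal_eq_of_isPresentationMatrix _ h]
  have h2 : ∀ c, ∑ x, K.jacobianMod p c x = 0 := fun c => by
    have := congrArg (reduceMod p) (K.sum_jacobian c)
    rwa [map_sum, map_zero] at this
  exact matrixElementaryIdeal_delete_column (K.jacobianMod p) h2 (K.arcFrom 0) ℓ

end AlexanderModule

/-! ### Coverings of the parameter circle -/

section Circle

theorem coe_eq_coe_iff_exists (x y : ℝ) :
    (x : UnitAddCircle) = (y : UnitAddCircle) ↔ ∃ k : ℤ, y = x + k := by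
  rw [QuotientAddGroup.eq, AddSubgroup.mem_zmultiples_iff]
  constructor
  · rintro ⟨k, hk⟩
    refine ⟨k, ?_⟩
    simp only [zsmul_eq_mul, mul_one] at hk
    rw [hk]; ring
  · rintro ⟨k, rfl⟩
    exact ⟨k, by simp⟩

theorem forwardDist_mem (s e : UnitAddCircle) : forwardDist s e ∈ Set.Ioc (0 : ℝ) 1 := by
  have h := (AddCircle.equivIoc (1 : ℝ) 0 (e - s)).2
  exact ⟨h.1, h.2.trans_eq (zero_add 1)⟩

theorem coe_forwardDist (s e : UnitAddCircle) : (forwardDist s e : UnitAddCircle) = e - s :=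
  (AddCircle.equivIoc (1 : ℝ) 0).symm_apply_apply (e - s)

theorem forwardDist_eq {s e : UnitAddCircle} {t : ℝ} (h0 : 0 < t) (h1 : t ≤ 1)
    (h : (t : UnitAddCircle) = e - s) : forwardDist s e = t := by
  rw [forwardDist, ← h]
  have h2 := (AddCircle.equivIoc (1 : ℝ) 0).apply_symm_apply ⟨t, by simpa using ⟨h0, h1⟩⟩
  exact congrArg Subtype.val h2

variable {d : ℕ} {h : ℝ → ℝ}

theorem IsCoveringLift.continuous (hh : IsCoveringLift d h) : Continuous h := hh.smooth.continuous

theorem IsCoveringLift.strictMono (hh : IsCoveringLift d h) : StrictMono h :=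
  strictMono_of_deriv_pos hh.deriv_pos

theorem IsCoveringLift.add_nat (hh : IsCoveringLift d h) (x : ℝ) (k : ℕ) :
    h (x + k) = h x + k * d := by
  induction k with
  | zero => simp
  | succ k ih =>
    rw [Nat.cast_succ, ← add_assoc, hh.degree, ih]
    ring

theorem IsCoveringLift.surjective (hh : IsCoveringLift d h) (hd : 0 < d) :
    Function.Surjective h := by
  have hd' : (1 : ℝ) ≤ d := by exact_mod_cast hd
  intro y
  obtain ⟨k, hk⟩ := exists_nat_ge (|y - h 0|)
  have hk' := abs_le.1 hk
  have hkd : (k : ℝ) ≤ k * d := le_mul_of_one_le_right (Nat.cast_nonneg k) hd'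
  have h1 : y ≤ h k := by
    have := hh.add_nat 0 k
    rw [zero_add] at this
    rw [this]; linarith
  have h2 : h (-k) ≤ y := by
    have := hh.add_nat (-k) k
    rw [neg_add_cancel] at this
    linarith
  obtain ⟨x, -, hx⟩ := intermediate_value_Icc
    (by linarith [Nat.cast_nonneg (α := ℝ) k] : (-k : ℝ) ≤ k) hh.continuous.continuousOn ⟨h2, h1⟩
  exact ⟨x, hx⟩

theorem IsCoveringLift.periodic (hh : IsCoveringLift d h) :
    Function.Periodic (fun x => (h x : UnitAddCircle)) 1 := by
  intro x
  change (h (x + 1) : UnitAddCircle) = h x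
  rw [hh.degree]
  exact ((coe_eq_coe_iff_exists _ _).2 ⟨d, by simp⟩).symm

/-- The covering of the circle with a given lift. -/
noncomputable def circleMap (hh : IsCoveringLift d h) : UnitAddCircle → UnitAddCircle :=
  hh.periodic.lift

theorem circleMap_coe (hh : IsCoveringLift d h) (x : ℝ) :
    circleMap hh (x : UnitAddCircle) = (h x : UnitAddCircle) :=
  hh.periodic.lift_coe x

theorem circleMap_surjective (hh : IsCoveringLift d h) (hd : 0 < d) :
    Function.Surjective (circleMap hh) := by
  intro s
  obtain ⟨y, rfl⟩ := QuotientAddGroup.mk_surjective s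
  obtain ⟨x, rfl⟩ := hh.surjective hd y
  exact ⟨x, circleMap_coe hh x⟩

/-- A fibre of a covering of the circle of degree `d` has at most `d` elements. -/
theorem exists_injective_fibre (hh : IsCoveringLift d h) (s : UnitAddCircle) :
    ∃ κ : {s' // circleMap hh s' = circleMap hh s} → Fin d, Function.Injective κ := by
  obtain ⟨x, rfl⟩ := QuotientAddGroup.mk_surjective s
  have key : ∀ s' : {s' // circleMap hh s' = circleMap hh (x : UnitAddCircle)},
      ∃ k : Fin d, ∃ y : ℝ, (y : UnitAddCircle) = s'.1 ∧ h y = h x + (k : ℕ) := by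
    rintro ⟨s', hs'⟩
    -- For a representative in `[x, x + 1)` the integer `h y - h x` lies in `[0, d)`, and it
    -- determines `y` because `h` is strictly increasing.
    let y : ℝ := AddCircle.equivIco (1 : ℝ) x s'
    have hy : (y : UnitAddCircle) = s' := (AddCircle.equivIco (1 : ℝ) x).symm_apply_apply s'
    have hy2 : y ∈ Set.Ico x (x + 1) := (AddCircle.equivIco (1 : ℝ) x s').2
    rw [← hy, circleMap_coe, circleMap_coe, eq_comm, coe_eq_coe_iff_exists] at hs'
    obtain ⟨k, hk⟩ := hs'
    have h1 : h x ≤ h y := hh.strictMono.monotone hy2.1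
    have h2 : h y < h x + d := by
      rw [← hh.degree]
      exact hh.strictMono hy2.2
    have hk0 : 0 ≤ k := by
      have : (0 : ℝ) ≤ k := by linarith
      exact_mod_cast this
    obtain ⟨k, rfl⟩ := Int.eq_ofNat_of_zero_le hk0
    have hkd : k < d := by
      have : (k : ℝ) < d := by
        rw [hk] at h2
        simpa using h2
      exact_mod_cast this
    exact ⟨⟨k, hkd⟩, y, hy, by simpa using hk⟩
  choose κ y hy hκ using key
  refine ⟨κ, fun a b hab => Subtype.ext ?_⟩
  rw [← hy a, ← hy b]
  congr 1
  apply hh.strictMono.injective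
  rw [hκ, hκ, hab]

/-- The excluded parameters form a countable subset of the real line. -/
theorem dense_preimage_compl (hh : IsCoveringLift d h) {S : Set UnitAddCircle} (hS : S.Finite) :
    Dense {x : ℝ | (h x : UnitAddCircle) ∉ S} := by
  have hc : {x : ℝ | (h x : UnitAddCircle) ∈ S}.Countable := by
    have h1 : {y : ℝ | (y : UnitAddCircle) ∈ S}.Countable := by
      have : {y : ℝ | (y : UnitAddCircle) ∈ S} = ⋃ s ∈ S, {y : ℝ | (y : UnitAddCircle) = s} := by
        ext y; simp
      rw [this]
      refine hS.countable.biUnion fun s _ => ?_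
      obtain ⟨x, rfl⟩ := QuotientAddGroup.mk_surjective s
      have : {y : ℝ | (y : UnitAddCircle) = (x : UnitAddCircle)} ⊆
          Set.range fun k : ℤ => x + k := by
        intro y hy
        obtain ⟨k, hk⟩ := (coe_eq_coe_iff_exists x y).1 hy.symm
        exact ⟨k, hk.symm⟩
      exact (Set.countable_range _).mono this
    exact h1.preimage_of_injOn hh.strictMono.injective.injOn
  exact hc.dense_compl ℝ

end Circle

/-! ### Long arcs under coverings -/

section Arcs

variable (K : VirtualKnotDiagram)

theorem forwardDist_arcFrom_le (s : UnitAddCircle) (a : K.Arc) :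
    forwardDist s (K.arcFrom s).1 ≤ forwardDist s a.1 :=
  (Finite.exists_min fun a : K.Arc => forwardDist s a.1).choose_spec a

/-- The terminal point of the arc leaving a parameter is the first endpoint after it. -/
theorem exists_arcFrom (x : ℝ) : ∃ y, x < y ∧ (y : UnitAddCircle) = (K.arcFrom x).1 ∧
    ∀ z, x < z → z < y → (z : UnitAddCircle) ∉ K.arcEnds := by
  have hm := forwardDist_mem x (K.arcFrom x).1
  refine ⟨x + forwardDist x (K.arcFrom x).1, by linarith [hm.1], ?_, ?_⟩
  · rw [AddCircle.coe_add, coe_forwardDist]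
    abel
  · intro z hz hz' hmem
    have h1 := K.forwardDist_arcFrom_le x ⟨z, hmem⟩
    have h2 : forwardDist (x : UnitAddCircle) (z : UnitAddCircle) = z - x := by
      refine forwardDist_eq (by linarith) (by linarith [hm.2]) ?_
      rw [AddCircle.coe_sub]
    simp only [h2] at h1
    linarith

theorem arcFrom_eq {x y : ℝ} (hxy : x < y) (hy : (y : UnitAddCircle) ∈ K.arcEnds)
    (h : ∀ z, x < z → z < y → (z : UnitAddCircle) ∉ K.arcEnds) :
    (K.arcFrom x).1 = (y : UnitAddCircle) := by
  obtain ⟨z, hxz, hz, hz'⟩ := K.exists_arcFrom x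
  rcases lt_trichotomy y z with hlt | heq | hlt
  · exact (hz' y hxy hlt hy).elim
  · rw [heq, hz]
  · exact (h z hxz hlt (hz ▸ (K.arcFrom x).2)).elim

/-- The lift is increasing and continuous and matches endpoints with endpoints, so it takes the
first endpoint after `x` to the first one after `h x`. -/
theorem arcFrom_circleMap {K₁ K₂ : VirtualKnotDiagram} {d : ℕ} {h : ℝ → ℝ}
    (hh : IsCoveringLift d h)
    (hends : ∀ s, circleMap hh s ∈ K₂.arcEnds ↔ s ∈ K₁.arcEnds) (s : UnitAddCircle) :
    (K₂.arcFrom (circleMap hh s)).1 = circleMap hh (K₁.arcFrom s).1 := by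
  obtain ⟨x, rfl⟩ := QuotientAddGroup.mk_surjective s
  obtain ⟨y, hxy, hy, hy'⟩ := K₁.exists_arcFrom x
  have hmem : (y : UnitAddCircle) ∈ K₁.arcEnds := hy ▸ (K₁.arcFrom x).2
  change (K₂.arcFrom (circleMap hh (x : UnitAddCircle))).1 =
    circleMap hh (K₁.arcFrom (x : UnitAddCircle)).1
  rw [← hy, circleMap_coe, circleMap_coe]
  refine K₂.arcFrom_eq (hh.strictMono hxy) ?_ ?_
  · rw [← circleMap_coe hh, hends]
    exact hmem
  · intro z hz hz' hzmem
    obtain ⟨w, hw, rfl⟩ := intermediate_value_Ioo hxy.le hh.continuous.continuousOn ⟨hz, hz'⟩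
    rw [← circleMap_coe hh, hends] at hzmem
    exact hy' w hw.1 hw.2 hzmem

/-- If `b` were missing, take the arc of `S` whose end has the least forward distance to `b`. The
next arc is again in `S` and, not being `b`, ends strictly nearer to it. Without classical crossings
there is only one arc. -/
theorem arcsConnected : K.ArcsConnected := by
  intro S hS hclosed b
  by_contra hb
  have : Nonempty S := hS.to_subtype
  obtain ⟨⟨a, ha⟩, hmin⟩ := Finite.exists_min fun a : S => forwardDist a.1.1 b.1
  rcases a.2 with hau | ⟨ha0, hempty⟩
  · have hout : K.arcFrom a.1 ∈ S := hclosed ⟨a.1, hau⟩ ha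
    have h1 := hmin ⟨_, hout⟩
    have h2 := K.forwardDist_arcFrom_le a.1 b
    have hne : forwardDist a.1 (K.arcFrom a.1).1 ≠ forwardDist a.1 b.1 := by
      intro heq
      have h3 := coe_forwardDist a.1 (K.arcFrom a.1).1
      rw [heq, coe_forwardDist, sub_left_inj] at h3
      exact hb (Subtype.ext h3 ▸ hout)
    have hlt := lt_of_le_of_ne h2 hne
    have hm := forwardDist_mem a.1 (K.arcFrom a.1).1
    have hm' := forwardDist_mem a.1 b.1
    have h4 : forwardDist (K.arcFrom a.1).1 b.1 =
        forwardDist a.1 b.1 - forwardDist a.1 (K.arcFrom a.1).1 := by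
      refine forwardDist_eq (by linarith) (by linarith [hm.1, hm'.2]) ?_
      rw [AddCircle.coe_sub, coe_forwardDist, coe_forwardDist]
      abel
    simp only [h4] at h1
    linarith [hm.1]
  · rcases b.2 with hbu | ⟨hb0, -⟩
    · rw [hempty] at hbu
      exact hbu
    · have : a = b := Subtype.ext (ha0.trans hb0.symm)
      exact hb (this ▸ ha)

end Arcs

/-! ### The closing map of a sector and orientations -/

section CloseSector

theorem norm_closeSector {n : ℕ} {z : ℂ} (hz : z ≠ 0) : ‖closeSector n z‖ = ‖z‖ := by
  have : ‖z‖ ≠ 0 := norm_ne_zero_iff.2 hz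
  simp [closeSector, this]

theorem closeSector_ne_zero {n : ℕ} {z : ℂ} (hz : z ≠ 0) : closeSector n z ≠ 0 := by
  rw [← norm_ne_zero_iff, norm_closeSector hz]
  exact norm_ne_zero_iff.2 hz

theorem closeSector_mul_root {n : ℕ} {ζ z : ℂ} (hζ : ζ ^ n = 1) (hn : ‖ζ‖ = 1) :
    closeSector n (ζ * z) = closeSector n z := by
  rw [closeSector, closeSector, norm_mul, hn, one_mul, mul_div_assoc, mul_pow, hζ, one_mul]

/-- Equal images have equal norms, hence equal `n`-th powers, and differ by a root of unity. -/
theorem exists_eq_root_mul {n : ℕ} (hn : n ≠ 0) {z w : ℂ} (hz : z ≠ 0) (hw : w ≠ 0)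
    (h : closeSector n z = closeSector n w) :
    ∃ j < n, w = Complex.exp (2 * Real.pi * Complex.I / n) ^ j * z := by
  have : NeZero n := ⟨hn⟩
  have hnorm : ‖z‖ = ‖w‖ := by rw [← norm_closeSector (n := n) hz, h, norm_closeSector hw]
  have hz' : (‖z‖ : ℂ) ≠ 0 := by exact_mod_cast norm_ne_zero_iff.2 hz
  rw [closeSector, closeSector, ← hnorm, mul_right_inj' hz', div_pow, div_pow,
    div_left_inj' (pow_ne_zero _ hz')] at h
  have hone : (w / z) ^ n = 1 := by
    rw [div_pow, ← h, div_self (pow_ne_zero _ hz)]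
  obtain ⟨j, hj, hj'⟩ := (Complex.isPrimitiveRoot_exp n hn).eq_pow_of_pow_eq_one hone
  exact ⟨j, hj, by rw [hj', div_mul_cancel₀ _ hz]⟩

theorem hasDerivAt_norm {γ : ℝ → ℂ} {v : ℂ} {x : ℝ} (h : HasDerivAt γ v x) (h0 : γ x ≠ 0) :
    HasDerivAt (fun y => ‖γ y‖) (‖γ x‖ * (v / γ x).re) x := by
  have hne : ‖γ x‖ ≠ 0 := norm_ne_zero_iff.2 h0
  have h1 := (h.norm_sq).sqrt (pow_ne_zero 2 hne)
  simp only [Real.sqrt_sq (norm_nonneg _)] at h1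
  convert h1 using 1
  have h2 : inner ℝ (γ x) v = ‖γ x‖ ^ 2 * (v / γ x).re := by
    rw [Complex.inner, Complex.div_re, ← Complex.normSq_eq_norm_sq]
    have : Complex.normSq (γ x) ≠ 0 := Complex.normSq_pos.2 h0 |>.ne'
    field_simp
    simp
  rw [h2]
  field_simp

/-- In logarithmic coordinates the velocity is `v / γ`, with radial real part and angular imaginary
part. The closing map keeps the former and multiplies the latter by `N + 1`. -/
theorem hasDerivAt_closeSector {γ : ℝ → ℂ} {v : ℂ} {x : ℝ} (N : ℕ) (h : HasDerivAt γ v x)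
    (h0 : γ x ≠ 0) : HasDerivAt (fun y => closeSector (N + 1) (γ y))
      (closeSector (N + 1) (γ x) * ((v / γ x).re + (N + 1) * (v / γ x).im * Complex.I)) x := by
  have hne : (‖γ x‖ : ℂ) ≠ 0 := by exact_mod_cast norm_ne_zero_iff.2 h0
  have h1 : HasDerivAt (fun y => (‖γ y‖ : ℂ)) ((‖γ x‖ * (v / γ x).re : ℝ) : ℂ) x :=
    (hasDerivAt_norm h h0).ofReal_comp
  have h2 := h1.mul ((h.div h1 hne).pow (N + 1))
  refine h2.congr_deriv ?_
  have hv : v = γ x * ((v / γ x).re + (v / γ x).im * Complex.I) := by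
    rw [Complex.re_add_im, mul_div_cancel₀ _ h0]
  generalize hα : (v / γ x).re = α at *
  generalize hβ : (v / γ x).im = β at *
  have hu : (v * (‖γ x‖ : ℂ) - γ x * ((‖γ x‖ * α : ℝ) : ℂ)) / (‖γ x‖ : ℂ) ^ 2 =
      γ x / ‖γ x‖ * (β * Complex.I) := by
    rw [hv]
    push_cast
    field_simp
    ring
  rw [hu]
  simp only [closeSector, Pi.div_apply, Pi.pow_apply, Nat.add_sub_cancel]
  push_cast
  generalize γ x / (‖γ x‖ : ℂ) = u
  ring

/-- Both imaginary parts are positive multiples of the determinant of the logarithmic velocities.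
The factors `r` and `s` account for the reparametrization of the two strands. -/
theorem im_conj_mul_pos_iff {G z a b v w : ℂ} {r s : ℝ} {m : ℝ} (hG : G ≠ 0) (hz : z ≠ 0)
    (hr : 0 < r) (hs : 0 < s) (hm : 0 < m)
    (ha : r * a = G * ((v / z).re + m * (v / z).im * Complex.I))
    (hb : s * b = G * ((w / z).re + m * (w / z).im * Complex.I)) :
    0 < (starRingEnd ℂ a * b).im ↔ 0 < (starRingEnd ℂ v * w).im := by
  have hv : v = z * ((v / z).re + (v / z).im * Complex.I) := by
    rw [Complex.re_add_im, mul_div_cancel₀ _ hz]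
  have hw : w = z * ((w / z).re + (w / z).im * Complex.I) := by
    rw [Complex.re_add_im, mul_div_cancel₀ _ hz]
  generalize (v / z).re = α at *
  generalize (v / z).im = β at *
  generalize (w / z).re = α' at *
  generalize (w / z).im = β' at *
  have h1 : (starRingEnd ℂ v * w).im = Complex.normSq z * (α * β' - β * α') := by
    rw [hv, hw]
    simp [Complex.normSq_apply]
    ring
  have h2 : r * s * (starRingEnd ℂ a * b).im = m * Complex.normSq G * (α * β' - β * α') := by
    have : r * s * (starRingEnd ℂ a * b).im = (starRingEnd ℂ (r * a) * (s * b)).im := by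
      simp
      ring
    rw [this, ha, hb]
    simp [Complex.normSq_apply]
    ring
  have hz' := Complex.normSq_pos.2 hz
  have hG' := Complex.normSq_pos.2 hG
  rw [h1, mul_pos_iff_of_pos_left hz', ← mul_pos_iff_of_pos_left (mul_pos hr hs), h2,
    mul_pos_iff_of_pos_left (mul_pos hm hG')]

variable {K Kq : VirtualKnotDiagram}

theorem hasDerivAt_curve (K : VirtualKnotDiagram) (x : ℝ) :
    HasDerivAt (fun y : ℝ => K.curve (y : UnitAddCircle)) (K.velocity (x : UnitAddCircle)) x := by
  have h1 : K.velocity (x : UnitAddCircle) = deriv (fun y : ℝ => K.curve (y : UnitAddCircle)) x :=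
    by
    have := deriv_comp_const_add (fun y : ℝ => K.curve (y : UnitAddCircle)) x 0
    rw [add_zero] at this
    rw [← this, velocity]
    congr 1
  rw [h1]
  exact (K.smooth.differentiable (by simp) x).hasDerivAt

/-- The quotient map preserves the orientation of crossing strands. -/
theorem velocity_im_pos_iff {n : ℕ} (hn : 0 < n) {g : ℝ → ℝ} (hg : IsCoveringLift n g)
    (h0 : ∀ s, K.curve s ≠ 0)
    (hcurve : ∀ s, Kq.curve (circleMap hg s) = closeSector n (K.curve s)) (s t : UnitAddCircle)
    (hst : K.curve s = K.curve t) :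
    0 < (starRingEnd ℂ (Kq.velocity (circleMap hg s)) * Kq.velocity (circleMap hg t)).im ↔
      0 < (starRingEnd ℂ (K.velocity s) * K.velocity t).im := by
  obtain ⟨N, rfl⟩ := Nat.exists_eq_succ_of_ne_zero hn.ne'
  have key : ∀ x : ℝ, ((deriv g x : ℝ) : ℂ) * Kq.velocity (circleMap hg (x : UnitAddCircle)) =
      closeSector (N + 1) (K.curve x) * ((K.velocity x / K.curve x).re +
        ((N + 1 : ℝ) : ℂ) * (K.velocity x / K.curve x).im * Complex.I) := by
    intro x
    have h1 := hasDerivAt_closeSector N (K.hasDerivAt_curve x) (h0 x)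
    have h2 := HasDerivAt.scomp x (Kq.hasDerivAt_curve (g x))
      (hg.smooth.differentiable (by simp) x).hasDerivAt
    have h3 : (fun y : ℝ => Kq.curve (y : UnitAddCircle)) ∘ g =
        fun y : ℝ => closeSector (N + 1) (K.curve (y : UnitAddCircle)) := by
      funext y
      rw [← hcurve, circleMap_coe]
      rfl
    rw [h3] at h2
    have h4 := h2.unique h1
    rw [circleMap_coe, ← Complex.real_smul, h4]
    push_cast
    rfl
  obtain ⟨x, rfl⟩ := QuotientAddGroup.mk_surjective s
  obtain ⟨y, rfl⟩ := QuotientAddGroup.mk_surjective t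
  have hx := key x
  have hy := key y
  change K.curve (x : UnitAddCircle) = K.curve (y : UnitAddCircle) at hst
  rw [← hst] at hy
  exact im_conj_mul_pos_iff (closeSector_ne_zero (h0 x)) (h0 x) (hg.deriv_pos x) (hg.deriv_pos y)
    (by positivity) hx hy

end CloseSector

/-! ### The cyclic covering of diagrams and the circulant Jacobian -/

section CyclicCover

/-- The rotation `ρ` of a periodic diagram and the projection `φ` to the quotient diagram, as maps
of the parameter circles. -/
structure IsCyclicCover (K Kq : VirtualKnotDiagram) (n : ℕ) (ρ φ : UnitAddCircle → UnitAddCircle) :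
    Prop where
  pos : 0 < n
  curve_ne_zero : ∀ s, K.curve s ≠ 0
  curve_rot : ∀ s, K.curve (ρ s) = Complex.exp (2 * Real.pi * Complex.I / n) * K.curve s
  overSet_rot : ∀ s, ρ s ∈ K.overSet ↔ s ∈ K.overSet
  curve_quot : ∀ s, Kq.curve (φ s) = closeSector n (K.curve s)
  overSet_quot : ∀ s, φ s ∈ Kq.overSet ↔ s ∈ K.overSet
  quot_rot : ∀ s, φ (ρ s) = φ s
  exists_of_quot_eq : ∀ s t, φ s = φ t → ∃ j < n, t = ρ^[j] s
  surjective : Function.Surjective φ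
  velocity_quot : ∀ s t, K.curve s = K.curve t →
    (0 < (starRingEnd ℂ (Kq.velocity (φ s)) * Kq.velocity (φ t)).im ↔
      0 < (starRingEnd ℂ (K.velocity s) * K.velocity t).im)
  -- The premise is needed since, without classical crossings, the only endpoint is the basepoint
  -- `0`, which the maps need not respect.
  arcFrom_rot : (∀ s, ρ s ∈ K.arcEnds ↔ s ∈ K.arcEnds) →
    ∀ s, (K.arcFrom (ρ s)).1 = ρ (K.arcFrom s).1
  arcFrom_quot : (∀ s, φ s ∈ Kq.arcEnds ↔ s ∈ K.arcEnds) →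
    ∀ s, (Kq.arcFrom (φ s)).1 = φ (K.arcFrom s).1

theorem exists_isCyclicCover {K Kq : VirtualKnotDiagram} {n : ℕ} (hn : 0 < n)
    (hper : K.IsPeriodic n) (hquot : K.IsQuotient n Kq) :
    ∃ ρ φ, IsCyclicCover K Kq n ρ φ := by
  obtain ⟨h0, f, hf, hfc, hfo⟩ := hper
  obtain ⟨g, hg, hgc, hgo⟩ := hquot
  have hprim := Complex.isPrimitiveRoot_exp n hn.ne'
  set ζ := Complex.exp (2 * Real.pi * Complex.I / n) with hζ
  have hζn : ‖ζ‖ = 1 := hprim.norm'_eq_one hn.ne'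
  have curve_rot : ∀ s, K.curve (circleMap hf s) = ζ * K.curve s := fun s => by
    obtain ⟨x, rfl⟩ := QuotientAddGroup.mk_surjective s
    exact (congrArg K.curve (circleMap_coe hf x)).trans (hfc x)
  have curve_quot : ∀ s, Kq.curve (circleMap hg s) = closeSector n (K.curve s) := fun s => by
    obtain ⟨x, rfl⟩ := QuotientAddGroup.mk_surjective s
    exact (congrArg Kq.curve (circleMap_coe hg x)).trans (hgc x)
  -- Both parameters have the same point on the quotient curve, which forces equality away from
  -- double points; density and continuity extend it to the whole circle.
  have quot_rot : ∀ s, circleMap hg (circleMap hf s) = circleMap hg s := by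
    have hd := dense_preimage_compl hg Kq.finite_double
    have hcont1 : Continuous fun x : ℝ => (g (f x) : UnitAddCircle) :=
      (AddCircle.continuous_mk' (1 : ℝ)).comp (hg.continuous.comp hf.continuous)
    have hcont2 : Continuous fun x : ℝ => (g x : UnitAddCircle) :=
      (AddCircle.continuous_mk' (1 : ℝ)).comp hg.continuous
    have heq := Continuous.ext_on hd hcont1 hcont2 (fun x hx => by
      by_contra hne
      refine hx ⟨_, hne, ?_⟩
      rw [← circleMap_coe hg, ← circleMap_coe hg, ← circleMap_coe hf, curve_quot, curve_quot,
        curve_rot, closeSector_mul_root hprim.pow_eq_one hζn])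
    intro s
    obtain ⟨x, rfl⟩ := QuotientAddGroup.mk_surjective s
    have := congrFun heq x
    rwa [← circleMap_coe hg, ← circleMap_coe hg, ← circleMap_coe hf] at this
  have curve_iter : ∀ (j : ℕ) s, K.curve ((circleMap hf)^[j] s) = ζ ^ j * K.curve s := by
    intro j
    induction j with
    | zero => simp
    | succ j ih =>
      intro s
      rw [Function.iterate_succ_apply', curve_rot, ih, pow_succ', mul_assoc]
  have quot_iter : ∀ (j : ℕ) s, circleMap hg ((circleMap hf)^[j] s) = circleMap hg s := by
    intro j
    induction j with
    | zero => simp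
    | succ j ih =>
      intro s
      rw [Function.iterate_succ_apply', quot_rot, ih]
  refine ⟨circleMap hf, circleMap hg, hn, h0, curve_rot, ?_, curve_quot, ?_, quot_rot, ?_,
    circleMap_surjective hg hn, velocity_im_pos_iff hn hg h0 curve_quot, arcFrom_circleMap hf,
    arcFrom_circleMap hg⟩
  · intro s
    obtain ⟨x, rfl⟩ := QuotientAddGroup.mk_surjective s
    exact (iff_of_eq (congrArg (· ∈ K.overSet) (circleMap_coe hf x))).trans (hfo x)
  · intro s
    obtain ⟨x, rfl⟩ := QuotientAddGroup.mk_surjective s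
    exact (iff_of_eq (congrArg (· ∈ Kq.overSet) (circleMap_coe hg x))).trans (hgo x)
  · intro s t hst
    -- The fibre has at most `n` elements, and the orbit of `s` already supplies `n` of them, told
    -- apart by the factors `ζ ^ j` of their nonzero curve points.
    obtain ⟨κ, hκ⟩ := exists_injective_fibre hg s
    let o : Fin n → {s' // circleMap hg s' = circleMap hg s} :=
      fun j => ⟨(circleMap hf)^[j] s, quot_iter j s⟩
    have ho : Function.Injective o := by
      intro i j hij
      have h1 := congrArg K.curve (congrArg Subtype.val hij)
      simp only [o, curve_iter] at h1
      exact Fin.ext (hprim.pow_inj i.2 j.2 (mul_right_cancel₀ (h0 s) h1))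
    have hsurj : Function.Surjective (κ ∘ o) :=
      (Finite.injective_iff_surjective.1 (hκ.comp ho))
    obtain ⟨j, hj⟩ := hsurj (κ ⟨t, hst.symm⟩)
    exact ⟨j, j.2, (congrArg Subtype.val (hκ hj)).symm⟩

variable {K Kq : VirtualKnotDiagram} {n : ℕ} {ρ φ : UnitAddCircle → UnitAddCircle}

theorem overPoint_ne (c : K.Crossing) : K.overPoint c ≠ c.1 := c.2.choose_spec.2.1

theorem curve_overPoint (c : K.Crossing) : K.curve (K.overPoint c) = K.curve c.1 :=
  c.2.choose_spec.2.2

/-- The absence of triple points makes the choice in `overPoint` canonical, hence compatible with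
the rotation and the projection. -/
theorem overPoint_unique (c : K.Crossing) (o : UnitAddCircle) (ho : o ≠ c.1)
    (h : K.curve o = K.curve c.1) : K.overPoint c = o := by
  rcases K.no_triple o c.1 (K.overPoint c) h (curve_overPoint c).symm with h1 | h1 | h1
  · exact (ho h1).elim
  · exact (overPoint_ne c h1.symm).elim
  · exact h1.symm

namespace IsCyclicCover

theorem quot_iterate (H : IsCyclicCover K Kq n ρ φ) (j : ℕ) (s : UnitAddCircle) : φ (ρ^[j] s) = φ s
    := by
  induction j with
  | zero => rfl
  | succ j ih => rw [Function.iterate_succ_apply', H.quot_rot, ih]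

theorem curve_iterate (H : IsCyclicCover K Kq n ρ φ) (j : ℕ) (s : UnitAddCircle) :
    K.curve (ρ^[j] s) = Complex.exp (2 * Real.pi * Complex.I / n) ^ j * K.curve s := by
  induction j with
  | zero => simp
  | succ j ih => rw [Function.iterate_succ_apply', H.curve_rot, ih, pow_succ',
    mul_assoc (Complex.exp _)]

theorem overSet_iterate (H : IsCyclicCover K Kq n ρ φ) (j : ℕ) (s : UnitAddCircle)
    : ρ^[j] s ∈ K.overSet ↔ s ∈ K.overSet := by
  induction j with
  | zero => rfl
  | succ j ih => rw [Function.iterate_succ_apply', H.overSet_rot, ih]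

theorem eq_of_curve_iterate (H : IsCyclicCover K Kq n ρ φ) {i j : ℕ} (hi : i < n) (hj : j < n)
    {s : UnitAddCircle}
    (h : K.curve (ρ^[i] s) = K.curve (ρ^[j] s)) : i = j := by
  rw [H.curve_iterate, H.curve_iterate] at h
  exact (Complex.isPrimitiveRoot_exp n H.pos.ne').pow_inj hi hj
    (mul_right_cancel₀ (H.curve_ne_zero s) h)

theorem iterate_n (H : IsCyclicCover K Kq n ρ φ) (s : UnitAddCircle) : ρ^[n] s = s := by
  obtain ⟨j, hj, h⟩ := H.exists_of_quot_eq s (ρ^[n] s) (H.quot_iterate n s).symm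
  have h1 : K.curve (ρ^[n] s) = K.curve (ρ^[0] s) := by
    rw [H.curve_iterate, (Complex.isPrimitiveRoot_exp n H.pos.ne').pow_eq_one, one_mul]
    rfl
  rw [h] at h1 ⊢
  rw [H.eq_of_curve_iterate hj H.pos h1]
  rfl

theorem rot_injective (H : IsCyclicCover K Kq n ρ φ) : Function.Injective ρ := by
  intro s t h
  obtain ⟨N, rfl⟩ := Nat.exists_eq_succ_of_ne_zero H.pos.ne'
  rw [← H.iterate_n s, ← H.iterate_n t, Function.iterate_succ_apply, Function.iterate_succ_apply, h]

/-- Parameters with the same image are related by a rotation, and a nontrivial rotation moves the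
point on the curve. So the two strands at a double point remain distinct in the quotient. -/
theorem quot_ne (H : IsCyclicCover K Kq n ρ φ) {s t : UnitAddCircle} (hst : s ≠ t)
    (h : K.curve s = K.curve t) : φ s ≠ φ t := by
  intro hφ
  obtain ⟨j, hj, rfl⟩ := H.exists_of_quot_eq s t hφ
  have := H.eq_of_curve_iterate H.pos hj (s := s) h
  subst this
  exact hst rfl

theorem curve_quot_eq (H : IsCyclicCover K Kq n ρ φ) {s t : UnitAddCircle}
    (h : K.curve s = K.curve t) :
    Kq.curve (φ s) = Kq.curve (φ t) := by
  rw [H.curve_quot, H.curve_quot, h]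

theorem underPoints_quot (H : IsCyclicCover K Kq n ρ φ) (s : UnitAddCircle)
    : φ s ∈ Kq.underPoints ↔ s ∈ K.underPoints := by
  constructor
  · rintro ⟨o', ho', hne, hcurve⟩
    obtain ⟨o, rfl⟩ := H.surjective o'
    rw [H.curve_quot, H.curve_quot] at hcurve
    -- An arbitrary lift of the over-strand need not pass through the given point, but one of its
    -- rotates does.
    obtain ⟨j, -, hj⟩ := exists_eq_root_mul H.pos.ne' (H.curve_ne_zero o) (H.curve_ne_zero s) hcurve
    refine ⟨ρ^[j] o, ?_, ?_, ?_⟩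
    · rwa [H.overSet_iterate, ← H.overSet_quot]
    · rintro rfl
      exact hne (H.quot_iterate j o).symm
    · rw [H.curve_iterate, hj]
  · rintro ⟨o, ho, hne, hcurve⟩
    exact ⟨φ o, (H.overSet_quot o).2 ho, H.quot_ne hne hcurve, H.curve_quot_eq hcurve⟩

theorem underPoints_rot (H : IsCyclicCover K Kq n ρ φ) (s : UnitAddCircle)
    : ρ s ∈ K.underPoints ↔ s ∈ K.underPoints := by
  rw [← H.underPoints_quot, H.quot_rot, H.underPoints_quot]

theorem underPoints_eq_empty_iff (H : IsCyclicCover K Kq n ρ φ)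
    : Kq.underPoints = ∅ ↔ K.underPoints = ∅ := by
  simp only [Set.eq_empty_iff_forall_notMem]
  constructor
  · intro h s hs
    exact h (φ s) ((H.underPoints_quot s).2 hs)
  · intro h s hs
    obtain ⟨t, rfl⟩ := H.surjective s
    exact h t ((H.underPoints_quot t).1 hs)

/-- The bijection between a `φ`-saturated set and the product of its image with a cyclic group. -/
theorem fibre_bijective (H : IsCyclicCover K Kq n ρ φ) (P P' : Set UnitAddCircle)
    (hP : ∀ s, φ s ∈ P' ↔ s ∈ P) :
    Function.Bijective (fun b : {s // s ∈ P'} × Fin n =>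
      (⟨ρ^[b.2] (Function.surjInv H.surjective b.1.1), by
        rw [← hP, H.quot_iterate, Function.surjInv_eq H.surjective]; exact b.1.2⟩ : {s // s ∈ P}))
          := by
  constructor
  · rintro ⟨s, i⟩ ⟨t, j⟩ h
    have h1 := congrArg Subtype.val h
    simp only at h1
    have h2 := congrArg φ h1
    rw [H.quot_iterate, H.quot_iterate, Function.surjInv_eq H.surjective,
      Function.surjInv_eq H.surjective] at h2
    have h3 : s = t := Subtype.ext h2
    subst h3
    have := H.eq_of_curve_iterate i.2 j.2 (congrArg K.curve h1)
    rw [Fin.ext this]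
  · rintro ⟨t, ht⟩
    obtain ⟨j, hj, hj'⟩ := H.exists_of_quot_eq (Function.surjInv H.surjective (φ t)) t
      (Function.surjInv_eq H.surjective _)
    exact ⟨(⟨φ t, (hP t).2 ht⟩, ⟨j, hj⟩), Subtype.ext hj'.symm⟩

/-- The bijection between a `φ`-saturated set and the product of its image with a cyclic group. -/
noncomputable def fibreEquiv (H : IsCyclicCover K Kq n ρ φ) (P P' : Set UnitAddCircle)
    (hP : ∀ s, φ s ∈ P' ↔ s ∈ P) :
    {s // s ∈ P'} × Fin n ≃ {s // s ∈ P} :=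
  Equiv.ofBijective _ (H.fibre_bijective P P' hP)

theorem fibreEquiv_val (H : IsCyclicCover K Kq n ρ φ) (P P' : Set UnitAddCircle)
    (hP : ∀ s, φ s ∈ P' ↔ s ∈ P)
    (b : {s // s ∈ P'} × Fin n) :
    (H.fibreEquiv P P' hP b).1 = ρ^[b.2] (Function.surjInv H.surjective b.1.1) := rfl

theorem quot_fibreEquiv (H : IsCyclicCover K Kq n ρ φ) (P P' : Set UnitAddCircle)
    (hP : ∀ s, φ s ∈ P' ↔ s ∈ P)
    (b : {s // s ∈ P'} × Fin n) : φ (H.fibreEquiv P P' hP b).1 = b.1.1 := by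
  rw [fibreEquiv_val, H.quot_iterate, Function.surjInv_eq H.surjective]

theorem overPoint_quot (H : IsCyclicCover K Kq n ρ φ) (c : K.Crossing) (c' : Kq.Crossing)
    (hc : φ c.1 = c'.1) :
    Kq.overPoint c' = φ (K.overPoint c) := by
  apply overPoint_unique
  · rw [← hc]
    exact H.quot_ne (overPoint_ne c) (curve_overPoint c)
  · rw [← hc]
    exact H.curve_quot_eq (curve_overPoint c)

theorem overPoint_rot (H : IsCyclicCover K Kq n ρ φ) (c d : K.Crossing) (hd : d.1 = ρ c.1) :
    K.overPoint d = ρ (K.overPoint c) := by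
  apply overPoint_unique
  · rw [hd]
    exact fun h => overPoint_ne c (H.rot_injective h)
  · rw [hd, H.curve_rot, H.curve_rot, curve_overPoint]

theorem sign_quot (H : IsCyclicCover K Kq n ρ φ) (c : K.Crossing) (c' : Kq.Crossing)
    (hc : φ c.1 = c'.1) :
    Kq.sign c' = K.sign c := by
  have h := H.velocity_quot _ _ (curve_overPoint c)
  rw [sign, sign, H.overPoint_quot c c' hc, ← hc]
  simp only [h]

theorem sign_rot (H : IsCyclicCover K Kq n ρ φ) (c d : K.Crossing) (hd : d.1 = ρ c.1)
    : K.sign d = K.sign c := by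
  have h1 : φ c.1 ∈ Kq.underPoints := (H.underPoints_quot _).2 c.2
  rw [← H.sign_quot c ⟨φ c.1, h1⟩ rfl, H.sign_quot d ⟨φ c.1, h1⟩ (by rw [hd, H.quot_rot])]

theorem arcEnds_quot (H : IsCyclicCover K Kq n ρ φ) (s : UnitAddCircle) (hne : K.underPoints ≠ ∅) :
    φ s ∈ Kq.arcEnds ↔ s ∈ K.arcEnds := by
  have h1 : ¬ Kq.underPoints = ∅ := fun h => hne (H.underPoints_eq_empty_iff.1 h)
  simp [arcEnds, hne, h1, H.underPoints_quot]

theorem arcEnds_rot (H : IsCyclicCover K Kq n ρ φ) (s : UnitAddCircle) (hne : K.underPoints ≠ ∅) :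
    ρ s ∈ K.arcEnds ↔ s ∈ K.arcEnds := by
  simp [arcEnds, hne, H.underPoints_rot]

end IsCyclicCover

theorem jacobian_apply (c : K.Crossing) (x : K.Arc) : K.jacobian c x =
    (if x = K.arcIn c then LaurentPolynomial.T (-K.sign c) else 0) -
      (if x = K.arcOut c then 1 else 0) +
      (if x = K.arcOver c then 1 - LaurentPolynomial.T (-K.sign c) else 0) := by
  simp only [jacobian, Pi.add_apply, Pi.sub_apply, Pi.single_apply]

theorem IsCyclicCover.jacobian_rot (H : IsCyclicCover K Kq n ρ φ) (hne : K.underPoints ≠ ∅)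
    (c d : K.Crossing) (x y : K.Arc) (hd : d.1 = ρ c.1) (hy : y.1 = ρ x.1) :
    K.jacobian d y = K.jacobian c x := by
  have hfrom := H.arcFrom_rot fun s => H.arcEnds_rot s hne
  have hiff : ∀ a b : K.Arc, b.1 = ρ a.1 → (y = b ↔ x = a) := fun a b hb => by
    constructor
    · rintro rfl
      exact Subtype.ext (H.rot_injective (hy.symm.trans hb))
    · rintro rfl
      exact Subtype.ext (hy.trans hb.symm)
  rw [jacobian_apply, jacobian_apply, H.sign_rot c d hd]
  have e1 := hiff (K.arcIn c) (K.arcIn d) hd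
  have e2 := hiff (K.arcOut c) (K.arcOut d) (by rw [arcOut, hd, hfrom]; rfl)
  have e3 := hiff (K.arcOver c) (K.arcOver d) (by
    rw [arcOver, H.overPoint_rot c d hd, hfrom]; rfl)
  simp only [e1, e2, e3]

/-- The Jacobian matrix of a periodic diagram is block circulant, and the sum of its blocks is the
Jacobian matrix of the quotient. -/
theorem IsCyclicCover.exists_circulant {N : ℕ} (H : IsCyclicCover K Kq (N + 1) ρ φ)
    (hne : K.underPoints ≠ ∅) :
    ∃ (eC : Kq.Crossing × Fin (N + 1) ≃ K.Crossing) (eX : Kq.Arc × Fin (N + 1) ≃ K.Arc)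
      (a : Kq.Crossing → Kq.Arc → Fin (N + 1) → ℤ[T;T⁻¹]),
      (K.jacobian.submatrix eC eX = Matrix.of fun b b' => a b.1 b'.1 (b'.2 - b.2)) ∧
      Kq.jacobian = Matrix.of fun c x => ∑ d, a c x d := by
  let eC : Kq.Crossing × Fin (N + 1) ≃ K.Crossing :=
    H.fibreEquiv K.underPoints Kq.underPoints H.underPoints_quot
  let eX : Kq.Arc × Fin (N + 1) ≃ K.Arc :=
    H.fibreEquiv K.arcEnds Kq.arcEnds fun s => H.arcEnds_quot s hne
  have hiter : ∀ (i : Fin (N + 1)) (s : UnitAddCircle),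
      ρ^[((i + 1 : Fin (N + 1)) : ℕ)] s = ρ (ρ^[i] s) := by
    intro i s
    rw [← Function.iterate_succ_apply' ρ]
    rcases Nat.lt_or_ge i N with hi | hi
    · rw [Fin.val_add_one_of_lt hi]
    · have : i = Fin.last N := Fin.ext (by simp; omega)
      subst this
      rw [Fin.last_add_one, Fin.val_last, H.iterate_n]
      rfl
  have hC : ∀ c i, (eC (c, i + 1)).1 = ρ (eC (c, i)).1 := fun c i => hiter i _
  have hX : ∀ x i, (eX (x, i + 1)).1 = ρ (eX (x, i)).1 := fun x i => hiter i _
  have hstep : ∀ c i x j, K.jacobian (eC (c, i + 1)) (eX (x, j + 1)) =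
      K.jacobian (eC (c, i)) (eX (x, j)) := fun c i x j =>
    H.jacobian_rot hne _ _ _ _ (hC c i) (hX x j)
  -- Rotating crossing and arc simultaneously reduces to the chosen lift of the crossing. The
  -- wrap-around of indices in `Fin (N + 1)` is justified by the rotation having order dividing `N +
  -- 1`.
  have hcirc : ∀ c x i j, K.jacobian (eC (c, i)) (eX (x, j)) =
      K.jacobian (eC (c, 0)) (eX (x, j - i)) := by
    intro c x i
    induction i using Fin.induction with
    | zero => intro j; rw [sub_zero]
    | succ i ih =>
      intro j
      rw [← Fin.coeSucc_eq_succ]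
      have := hstep c i.castSucc x (j - 1)
      rw [sub_add_cancel] at this
      rw [this, ih, sub_sub, add_comm (1 : Fin (N + 1))]
  refine ⟨eC, eX, fun c x d => K.jacobian (eC (c, 0)) (eX (x, d)), ?_, ?_⟩
  · ext1 ⟨c, i⟩ ⟨x, j⟩
    exact hcirc c x i j
  · ext1 c x
    have hφc : φ (eC (c, 0)).1 = c.1 := H.quot_fibreEquiv _ _ _ _
    have hfrom := H.arcFrom_quot fun s => H.arcEnds_quot s hne
    -- Exactly one lift of the arc `y'` is `y`, so summing over lifts turns the incidences of a
    -- crossing of `K` into those of its image.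
    have hsum : ∀ (y : K.Arc) (y' : Kq.Arc) (v : ℤ[T;T⁻¹]), y'.1 = φ y.1 →
        ∑ d, (if eX (x, d) = y then v else 0) = if x = y' then v else 0 := by
      intro y y' v hy
      obtain ⟨⟨x₀, d₀⟩, rfl⟩ := eX.surjective y
      have hy' : y' = x₀ := Subtype.ext (hy.trans (H.quot_fibreEquiv _ _ _ _))
      subst hy'
      simp only [EmbeddingLike.apply_eq_iff_eq, Prod.mk.injEq]
      by_cases hx : x = y'
      · simp [hx]
      · simp [hx]
    simp only [Matrix.of_apply, jacobian_apply, Finset.sum_add_distrib, Finset.sum_sub_distrib]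
    rw [H.sign_quot _ c hφc]
    rw [hsum (K.arcIn (eC (c, 0))) (Kq.arcIn c) _ hφc.symm,
      hsum (K.arcOut (eC (c, 0))) (Kq.arcOut c) _ (by rw [arcOut, ← hφc, hfrom]; rfl),
      hsum (K.arcOver (eC (c, 0))) (Kq.arcOver c) _ (by
        rw [arcOver, H.overPoint_quot _ c hφc, hfrom]; rfl)]

end CyclicCover

end VirtualKnotDiagram

/-! ### Application to periodic diagrams, with the crossingless case apart -/

theorem matrixElementaryIdeal_of_isEmpty {R m n : Type*} [CommRing R] [IsEmpty m] [Fintype n]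
    (A : Matrix m n R) (hn : Fintype.card n = 1) (ℓ : ℕ) :
    matrixElementaryIdeal A ℓ = if ℓ = 0 then ⊥ else ⊤ := by
  rw [matrixElementaryIdeal_eq, hn]
  split_ifs with h
  · subst h
    rw [eq_bot_iff, minorIdeal_le_iff]
    intro f
    exact isEmptyElim (f 0)
  · rw [show 1 - ℓ = 0 by omega, minorIdeal_zero]

namespace VirtualKnotDiagram

variable {K Kq : VirtualKnotDiagram}

theorem isEmpty_crossing (h : K.underPoints = ∅) : IsEmpty K.Crossing :=
  ⟨fun c => Set.eq_empty_iff_forall_notMem.1 h c.1 c.2⟩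

theorem card_arc (h : K.underPoints = ∅) : Fintype.card K.Arc = 1 := by
  have h0 : ∀ a : K.Arc, a.1 = 0 := fun a => by
    rcases a.2 with ha | ⟨ha, -⟩
    · rw [h] at ha; exact ha.elim
    · exact ha
  rw [Fintype.card_eq_one_iff]
  exact ⟨K.arcFrom 0, fun a => Subtype.ext ((h0 a).trans (h0 _).symm)⟩

/-- Every arc of a diagram with classical crossings ends at exactly one of them. -/
noncomputable def arcEquivCrossing (h : K.underPoints ≠ ∅) : K.Arc ≃ K.Crossing :=
  Equiv.subtypeEquivRight fun s => by simp [arcEnds, h]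

theorem matrixElementaryIdeal_jacobian_of_quotient {n : ℕ} (hn : 0 < n) (hper : K.IsPeriodic n)
    (hquot : K.IsQuotient n Kq) (ℓ : ℕ) :
    matrixElementaryIdeal K.jacobian ℓ ≤ matrixElementaryIdeal Kq.jacobian ℓ := by
  obtain ⟨ρ, φ, H⟩ := exists_isCyclicCover hn hper hquot
  by_cases hne : K.underPoints = ∅
  · have hne' := H.underPoints_eq_empty_iff.2 hne
    have := isEmpty_crossing hne
    have := isEmpty_crossing hne'
    rw [matrixElementaryIdeal_of_isEmpty _ (card_arc hne),
      matrixElementaryIdeal_of_isEmpty _ (card_arc hne')]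
  · obtain ⟨N, rfl⟩ := Nat.exists_eq_succ_of_ne_zero hn.ne'
    have hne' : Kq.underPoints ≠ ∅ := fun h => hne (H.underPoints_eq_empty_iff.1 h)
    have : Fintype Kq.Crossing := Fintype.ofFinite _
    obtain ⟨eC, eX, a, ha, haq⟩ := H.exists_circulant hne
    rw [← matrixElementaryIdeal_submatrix K.jacobian eC eX, ha, haq]
    exact matrixElementaryIdeal_circulant_le (Fintype.card_congr (arcEquivCrossing hne')).ge a ℓ

theorem matrixElementaryIdeal_jacobianMod_of_quotient {n : ℕ} (hn : 0 < n) (hper : K.IsPeriodic n)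
    (hquot : K.IsQuotient n Kq) (p r : ℕ) (hp : p.Prime) (hpr : n = p ^ r) (ℓ : ℕ) :
    matrixElementaryIdeal (K.jacobianMod p) ℓ ≤
      matrixElementaryIdeal (Kq.jacobianMod p) ℓ ^ p ^ r := by
  obtain ⟨ρ, φ, H⟩ := exists_isCyclicCover hn hper hquot
  by_cases hne : K.underPoints = ∅
  · have hne' := H.underPoints_eq_empty_iff.2 hne
    have := isEmpty_crossing hne
    have := isEmpty_crossing hne'
    rw [matrixElementaryIdeal_of_isEmpty _ (card_arc hne),
      matrixElementaryIdeal_of_isEmpty _ (card_arc hne')]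
    split_ifs
    · exact bot_le
    · rw [Ideal.top_pow]
  · obtain ⟨N, rfl⟩ := Nat.exists_eq_succ_of_ne_zero hn.ne'
    have hne' : Kq.underPoints ≠ ∅ := fun h => hne (H.underPoints_eq_empty_iff.1 h)
    have : Fintype Kq.Crossing := Fintype.ofFinite _
    obtain ⟨eC, eX, a, ha, haq⟩ := H.exists_circulant hne
    have : CharP (ZMod p)[T;T⁻¹] p :=
      charP_of_injective_algebraMap (R := ZMod p) (FaithfulSMul.algebraMap_injective _ _) p
    let b : Kq.Crossing → Kq.Arc → Fin (N + 1) → (ZMod p)[T;T⁻¹] :=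
      fun c x d => reduceMod p (a c x d)
    have hb : (K.jacobianMod p).submatrix eC eX =
        Matrix.of fun c x => b c.1 x.1 (x.2 - c.2) := by
      rw [jacobianMod, Matrix.submatrix_map, ha]
      rfl
    have hbq : Kq.jacobianMod p = Matrix.of fun c x => ∑ d, b c x d := by
      rw [jacobianMod, haq]
      ext1 c x
      exact map_sum (reduceMod p) (a c x) Finset.univ
    rw [← matrixElementaryIdeal_submatrix (K.jacobianMod p) eC eX, hb, hbq, ← hpr]
    exact matrixElementaryIdeal_circulant_le_pow (Fintype.card_congr (arcEquivCrossing hne')).ge b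
      p r hp hpr ℓ

theorem reduceMod_idealGcd_jacobian_dvd {n : ℕ} (hn : 0 < n) (hper : K.IsPeriodic n)
    (hquot : K.IsQuotient n Kq) (p r : ℕ) (hp : p.Prime) (hpr : n = p ^ r) :
    reduceMod p (idealGcd (matrixElementaryIdeal Kq.jacobian 1)) ^ p ^ r ∣
      reduceMod p (idealGcd (matrixElementaryIdeal K.jacobian 1)) := by
  obtain ⟨ρ, φ, H⟩ := exists_isCyclicCover hn hper hquot
  by_cases hne : K.underPoints = ∅
  · have hne' := H.underPoints_eq_empty_iff.2 hne
    have := isEmpty_crossing hne'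
    -- A Jacobian with one column and no rows has the whole ring as its first elementary ideal.
    have hunit : IsUnit (idealGcd (matrixElementaryIdeal Kq.jacobian 1)) := by
      rw [← Ideal.span_singleton_eq_top, eq_top_iff]
      refine le_trans ?_ (isIdealGcd_idealGcd _).1
      rw [matrixElementaryIdeal_of_isEmpty _ (card_arc hne'), if_neg one_ne_zero]
    exact ((hunit.map (reduceMod p)).pow _).dvd
  · obtain ⟨N, rfl⟩ := Nat.exists_eq_succ_of_ne_zero hn.ne'
    have hne' : Kq.underPoints ≠ ∅ := fun h => hne (H.underPoints_eq_empty_iff.1 h)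
    have : CharP (ZMod p)[T;T⁻¹] p :=
      charP_of_injective_algebraMap (R := ZMod p) (FaithfulSMul.algebraMap_injective _ _) p
    obtain ⟨eC, eX, a, ha, haq⟩ := H.exists_circulant hne
    -- Indexing the crossings by the arcs that end there makes the blocks square, as the determinant
    -- argument requires.
    let e := arcEquivCrossing hne'
    let b : Kq.Arc → Kq.Arc → Fin (N + 1) → ℤ[T;T⁻¹] := fun c x d => a (e c) x d
    have hb : K.jacobian.submatrix ((e.prodCongr (Equiv.refl (Fin (N + 1)))).trans eC) eX =
        Matrix.of fun c x => b c.1 x.1 (x.2 - c.2) :=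
      congrArg (fun M => M.submatrix (e.prodCongr (Equiv.refl (Fin (N + 1)))) id) ha
    have hbq : Kq.jacobian.submatrix e (Equiv.refl _) = Matrix.of fun c x => ∑ d, b c x d := by
      rw [haq]
      rfl
    -- The rows of a Jacobian sum to zero, so the constant vector lies in its kernel.
    have hdet : (Matrix.of fun c x => ∑ d, b c x d).det = 0 := by
      rw [← hbq, ← Matrix.exists_mulVec_eq_zero_iff]
      refine ⟨1, one_ne_zero, ?_⟩
      ext1 c
      simp only [Matrix.mulVec, dotProduct, Pi.one_apply, mul_one]
      exact Kq.sum_jacobian (e c)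
    have : CharZero ℤ[T;T⁻¹] :=
      charZero_of_injective_algebraMap (R := ℤ) (FaithfulSMul.algebraMap_injective _ _)
    rw [← matrixElementaryIdeal_submatrix K.jacobian
      ((e.prodCongr (Equiv.refl (Fin (N + 1)))).trans eC) eX, hb,
      ← matrixElementaryIdeal_submatrix Kq.jacobian e (Equiv.refl _), hbq, ← hpr]
    exact map_idealGcd_circulant_pow_dvd (reduceMod p) p r hp hpr
      (Nat.cast_ne_zero.2 (Nat.succ_ne_zero N)) b hdet

end VirtualKnotDiagram

end PeriodicVirtualKnot

open PeriodicVirtualKnot in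
theorem mainTheorem6 (K Kq : VirtualKnotDiagram) (n : ℕ) (hn : 0 < n)
    (hper : K.IsPeriodic n) (hquot : K.IsQuotient n Kq) :
    (∀ ℓ : ℕ,
      elementaryIdeal ℤ[T;T⁻¹] K.AlexanderModule ℓ ≤
          elementaryIdeal ℤ[T;T⁻¹] Kq.AlexanderModule ℓ ∧
        idealGcd (elementaryIdeal ℤ[T;T⁻¹] Kq.AlexanderModule ℓ) ∣
          idealGcd (elementaryIdeal ℤ[T;T⁻¹] K.AlexanderModule ℓ) ∧
        matrixElementaryIdeal K.jacobian ℓ ≤ matrixElementaryIdeal Kq.jacobian ℓ ∧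
        idealGcd (matrixElementaryIdeal Kq.jacobian ℓ) ∣
          idealGcd (matrixElementaryIdeal K.jacobian ℓ)) ∧
    ∀ p r : ℕ, p.Prime → n = p ^ r →
      reduceMod p (idealGcd (matrixElementaryIdeal Kq.jacobian 1)) ^ p ^ r ∣
        reduceMod p (idealGcd (matrixElementaryIdeal K.jacobian 1)) ∧
      ∀ ℓ : ℕ,
      elementaryIdeal (ZMod p)[T;T⁻¹] (ModP p K.AlexanderModule) ℓ ≤
          elementaryIdeal (ZMod p)[T;T⁻¹] (ModP p Kq.AlexanderModule) ℓ ^ p ^ r ∧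
        idealGcd (elementaryIdeal (ZMod p)[T;T⁻¹] (ModP p Kq.AlexanderModule) ℓ) ^ p ^ r ∣
          idealGcd (elementaryIdeal (ZMod p)[T;T⁻¹] (ModP p K.AlexanderModule) ℓ) ∧
        matrixElementaryIdeal (K.jacobianMod p) ℓ ≤
          matrixElementaryIdeal (Kq.jacobianMod p) ℓ ^ p ^ r ∧
        idealGcd (matrixElementaryIdeal (Kq.jacobianMod p) ℓ) ^ p ^ r ∣
          idealGcd (matrixElementaryIdeal (K.jacobianMod p) ℓ) := by
  have h1 := VirtualKnotDiagram.matrixElementaryIdeal_jacobian_of_quotient hn hper hquot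
  refine ⟨fun ℓ => ?_, fun p r hp hpr => ⟨?_, fun ℓ => ?_⟩⟩
  -- The module statement at `ℓ` is the matrix statement at `ℓ + 1`.
  · rw [VirtualKnotDiagram.elementaryIdeal_alexanderModule K.arcsConnected,
      VirtualKnotDiagram.elementaryIdeal_alexanderModule Kq.arcsConnected]
    exact ⟨h1 _, idealGcd_dvd_idealGcd (h1 _), h1 _, idealGcd_dvd_idealGcd (h1 _)⟩
  · exact VirtualKnotDiagram.reduceMod_idealGcd_jacobian_dvd hn hper hquot p r hp hpr
  · have : Fact p.Prime := ⟨hp⟩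
    have h2 := VirtualKnotDiagram.matrixElementaryIdeal_jacobianMod_of_quotient hn hper hquot p r
      hp hpr
    rw [VirtualKnotDiagram.elementaryIdeal_modP_alexanderModule K.arcsConnected,
      VirtualKnotDiagram.elementaryIdeal_modP_alexanderModule Kq.arcsConnected]
    exact ⟨h2 _, idealGcd_pow_dvd_of_le_pow (h2 _), h2 _, idealGcd_pow_dvd_of_le_pow (h2 _)⟩
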